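/- Let $A=\bigoplus_{n\in\mathbb{Z}}A_n$ be a commutative $\mathbb{Z}$-graded ring, let $I^+ := A_{>0}\cdot A$ be the ideal generated by the homogeneous elements of positive degree, and assume that $I^+$ is finitely generated, by homogeneous elements $f_1,\dots,f_r$. Let ${\rm Gr}(A)$ be the abelian category of $\mathbb{Z}$-graded $A$-modules and degree-preserving $A$-linear maps. *Notation.* Let ${\rm Tor}^+\subset{\rm Gr}(A)$ be the Serre subcategory of those $M$ such that for every homogeneous $x\in M$ and every $f\in I^+$ there is $n>0$ with $f^nx=0$; let ${\rm Q}^+{\rm Gr}(A):={\rm Gr}(A)/{\rm Tor}^+$ be the Serre quotient, with exact quotient functor $\phi^*:{\rm Gr}(A)\to{\rm Q}^+{\rm Gr}(A)$. For $\spadesuit\in\{\varnothing,+,-,b\}$ and an abelian category $\mathcal{C}$, let $\mathcal{D}^\spadesuit(\mathcal{C})\subset\mathcal{D}(\mathcal{C})$ be the full subcategory of complexes whose cohomology is arbitrary, bounded below, bounded above, bounded, respectively; write again $\phi^*$ for the induced exact functors $\mathcal{D}^\spadesuit({\rm Gr}(A))\to\mathcal{D}^\spadesuit({\rm Q}^+{\rm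 Gr}(A))$, and let $\mathcal{D}^\spadesuit_{{\rm Tor}^+}({\rm Gr}(A))\subset \mathcal{D}^\spadesuit({\rm Gr}(A))$ be the full subcategory of complexes with cohomology in ${\rm Tor}^+$. For $M\in{\rm Gr}(A)$ let $${\bm R}\Gamma_{I^+}(M)=\Bigl[M\xrightarrow{d^0}\prod_{i_0}M_{f_{i_0}}\xrightarrow{d^1}\prod_{i_0<i_1}M_{f_{i_0}f_{i_1}}\to\cdots\to M_{f_1\cdots f_r}\Bigr]$$ be the extended Čech complex, with $M$ in degree $0$ and $d^m$ the alternating sum of the localization maps, and let $$\check{\mathcal{C}}_{I^+}(M)=\Bigl[\prod_{i_0}M_{f_{i_0}}\xrightarrow{-d^1}\prod_{i_0<i_1}M_{f_{i_0}f_{i_1}}\xrightarrow{-d^2}\cdots\to M_{f_1\cdots f_r}\Bigr]$$ be the Čech complex, with $\prod_{i_0} M_{f_{i_0}}$ in degree $0$; on complexes of graded modules take total complexes. Both constructions preserve quasi-isomorphisms and so give functors ${\bm R}\Gamma_{I^+},\check{\mathcal{C}}_{I^+}:\mathcal{D}({\rm Gr}(A))\to\mathcal{D}({\rm Gr}(A))$.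 Let $\mathcal{D}^\spadesuit_{I^+\text{-triv}}({\rm Gr}(A))\subset\mathcal{D}^\spadesuit({\rm Gr}(A))$ be the full subcategory of all $M$ with ${\bm R}\Gamma_{I^+}(M)\simeq0$. *Statement.* 1. For each $\spadesuit\in\{\varnothing,+,-,b\}$, ${\rm Tor}^+\subset{\rm Gr}(A)$ is $\mathcal{D}^\spadesuit$-localizing: the functor $\phi^*:\mathcal{D}^\spadesuit({\rm Gr}(A))\to\mathcal{D}^\spadesuit({\rm Q}^+{\rm Gr}(A))$ has a right adjoint ${\bm R}\phi_*$ such that the counit $\phi^*\circ{\bm R}\phi_*\Rightarrow{\rm id}$ is an isomorphism. 2. The functor ${\bm R}\phi_*:\mathcal{D}({\rm Q}^+{\rm Gr}(A))\to\mathcal{D}({\rm Gr}(A))$ is fully faithful, and for each $\spadesuit$ its restriction to $\mathcal{D}^\spadesuit({\rm Q}^+{\rm Gr}(A))$ is isomorphic to the functor ${\bm R}\phi_*$ of (1) followed by the inclusion $\mathcal{D}^\spadesuit({\rm Gr}(A))\subset\mathcal{D}({\rm Gr}(A))$. 3. For each $\spadesuit$ there is a semi-orthogonal decomposition $$\mathcal{D}^\spadesuit({\rm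 Gr}(A))=\bigl\langle\,{\bm R}\phi_*(\mathcal{D}^\spadesuit({\rm Q}^+{\rm Gr}(A)))\,,\;\mathcal{D}^\spadesuit_{{\rm Tor}^+}({\rm Gr}(A))\,\bigr\rangle .$$ Here $\mathcal{D}=\langle\mathcal{E}_1,\mathcal{E}_2\rangle$ means that $\mathcal{E}_1,\mathcal{E}_2$ are full triangulated subcategories of $\mathcal{D}$ with ${\rm Hom}_{\mathcal D}(E_2,E_1)=0$ for all $E_i\in\mathcal{E}_i$, and that each $X\in\mathcal{D}$ sits in an exact triangle $E_2\to X\to E_1\to E_2[1]$ with $E_i\in\mathcal{E}_i$. 4. For each $\spadesuit$, the functor $\check{\mathcal{C}}_{I^+}$ maps $\mathcal{D}^\spadesuit({\rm Gr}(A))$ to itself, and ${\bm R}\phi_*\circ\phi^*\cong\check{\mathcal{C}}_{I^+}$ as functors $\mathcal{D}^\spadesuit({\rm Gr}(A))\to\mathcal{D}^\spadesuit({\rm Gr}(A))$. 5. For each $\spadesuit$, the subcategory $\mathcal{D}^\spadesuit_{I^+\text{-triv}}({\rm Gr}(A))$ is triangulated, and $\phi^*$ restricts to an exact equivalence $\mathcal{D}^\spadesuit_{I^+\text{-triv}}({\rm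 Gr}(A))\xrightarrow{\simeq}\mathcal{D}^\spadesuit({\rm Q}^+{\rm Gr}(A))$ with quasi-inverse ${\bm R}\phi_*$. -/

import Mathlib

open CategoryTheory CategoryTheory.Limits

universe u w w'

noncomputable section

/-- A graded module over the `ℤ`-graded commutative ring `A = ⨁ 𝒜 n`: an `A`-module `M` with
additive subgroups `M_j` such that `M = ⨁ M_j` and `A_i • M_j ⊆ M_{i+j}`. -/
structure GrMod {A : Type u} [CommRing A] (𝒜 : ℤ → AddSubgroup A) where
  carrier : Type u
  [addCommGroup : AddCommGroup carrier]
  [module : Module A carrier]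
  deg : ℤ → AddSubgroup carrier
  isInternal : DirectSum.IsInternal deg
  smul_mem : ∀ {i j : ℤ} {a : A} {x : carrier}, a ∈ 𝒜 i → x ∈ deg j → a • x ∈ deg (i + j)

namespace GrMod

variable {A : Type u} [CommRing A] {𝒜 : ℤ → AddSubgroup A}

instance : CoeSort (GrMod 𝒜) (Type u) := ⟨GrMod.carrier⟩
instance (M : GrMod 𝒜) : AddCommGroup M := M.addCommGroup
instance (M : GrMod 𝒜) : Module A M := M.module

/-- The projection of a graded module onto its component of degree `i`. -/
def proj (M : GrMod 𝒜) (i : ℤ) : M →+ M :=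
  letI := M.isInternal.chooseDecomposition
  (M.deg i).subtype.comp
    ((DFinsupp.evalAddMonoidHom i).comp (DirectSum.decomposeAddEquiv M.deg).toAddMonoidHom)

lemma proj_mem (M : GrMod 𝒜) (i : ℤ) (x : M) : M.proj i x ∈ M.deg i := by
  simp [proj]

lemma proj_of_mem (M : GrMod 𝒜) {i : ℤ} {x : M} (hx : x ∈ M.deg i) : M.proj i x = x := by
  let _ := M.isInternal.chooseDecomposition
  exact DirectSum.decompose_of_mem_same M.deg hx

lemma proj_of_mem_ne (M : GrMod 𝒜) {i j : ℤ} {x : M} (hx : x ∈ M.deg i) (h : i ≠ j) :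
    M.proj j x = 0 := by
  let _ := M.isInternal.chooseDecomposition
  exact DirectSum.decompose_of_mem_ne M.deg hx h

lemma mem_closure (M : GrMod 𝒜) (x : M) :
    x ∈ AddSubgroup.closure {y : M | ∃ i, y ∈ M.deg i} := by
  let _ := M.isInternal.chooseDecomposition
  induction x using DirectSum.Decomposition.inductionOn M.deg with
  | zero => exact zero_mem _
  | homogeneous m => exact AddSubgroup.subset_closure ⟨_, m.2⟩
  | add m m' h h' => exact add_mem h h'

lemma ext_proj (M : GrMod 𝒜) {x y : M} (h : ∀ i, M.proj i x = M.proj i y) : x = y := by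
  let _ := M.isInternal.chooseDecomposition
  refine (DirectSum.decompose M.deg).injective (DFinsupp.ext fun i => Subtype.ext (h i))

/-- A criterion for a family of subgroups to be a grading. -/
lemma isInternal_of_proj {X : Type*} [AddCommGroup X] (deg : ℤ → AddSubgroup X)
    (p : ℤ → X →+ X)
    (h₁ : ∀ i x, x ∈ deg i → p i x = x) (h₂ : ∀ i j x, x ∈ deg i → i ≠ j → p j x = 0)
    (h₃ : ∀ x, x ∈ AddSubgroup.closure {y : X | ∃ i, y ∈ deg i}) :
    DirectSum.IsInternal deg := by
  classical
  constructor
  · rw [injective_iff_map_eq_zero]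
    intro x hx
    have key : ∀ (z : DirectSum ℤ fun i => deg i) (j : ℤ),
        p j (DirectSum.coeAddMonoidHom deg z) = (z j : X) := by
      intro z j
      induction z using DirectSum.induction_on with
      | zero => simp
      | of i x =>
        rw [DirectSum.coeAddMonoidHom_of]
        by_cases h : i = j
        · subst h
          rw [h₁ _ _ x.2, DirectSum.of_eq_same]
        · rw [h₂ _ _ _ x.2 h, DirectSum.of_eq_of_ne _ _ _ (Ne.symm h)]; rfl
      | add x y hx hy => rw [map_add, map_add, hx, hy]; rfl
    refine DFinsupp.ext fun j => Subtype.ext ?_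
    have := key x j
    rw [hx, map_zero] at this
    exact this.symm
  · intro x
    induction h₃ x using AddSubgroup.closure_induction with
    | mem y hy =>
      obtain ⟨i, hi⟩ := hy
      exact ⟨DirectSum.of (fun i => deg i) i ⟨y, hi⟩, by simp⟩
    | zero => exact ⟨0, map_zero _⟩
    | add y z _ _ hy hz =>
      obtain ⟨a, rfl⟩ := hy
      obtain ⟨b, rfl⟩ := hz
      exact ⟨a + b, map_add _ _ _⟩
    | neg y _ hy =>
      obtain ⟨a, rfl⟩ := hy
      exact ⟨-a, map_neg _ _⟩

/-- Morphisms of graded modules: `A`-linear maps of degree `0`. -/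
@[ext]
structure Hom (M N : GrMod 𝒜) where
  lin : M →ₗ[A] N
  map_deg : ∀ {i : ℤ} {x : M}, x ∈ M.deg i → lin x ∈ N.deg i

/-- The category `Gr(A)` of graded `A`-modules. -/
instance : Category (GrMod 𝒜) where
  Hom := Hom
  id M := ⟨LinearMap.id, fun h => h⟩
  comp f g := ⟨g.lin ∘ₗ f.lin, fun h => g.map_deg (f.map_deg h)⟩

@[ext]
lemma hom_ext {M N : GrMod 𝒜} {f g : M ⟶ N} (h : ∀ x, f.lin x = g.lin x) : f = g :=
  Hom.ext (LinearMap.ext h)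

@[simp] lemma id_lin (M : GrMod 𝒜) : Hom.lin (𝟙 M) = LinearMap.id := rfl

@[simp] lemma comp_lin {M N P : GrMod 𝒜} (f : M ⟶ N) (g : N ⟶ P) :
    Hom.lin (f ≫ g) = g.lin ∘ₗ f.lin := rfl

lemma lin_injective {M N : GrMod 𝒜} :
    Function.Injective (fun f : M ⟶ N => f.lin) := fun _ _ h => Hom.ext h

variable {M N P : GrMod 𝒜}

instance : Zero (M ⟶ N) := ⟨⟨0, fun _ => zero_mem _⟩⟩
instance : Add (M ⟶ N) :=
  ⟨fun f g => ⟨f.lin + g.lin, fun h => add_mem (f.map_deg h) (g.map_deg h)⟩⟩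
instance : Neg (M ⟶ N) := ⟨fun f => ⟨-f.lin, fun h => neg_mem (f.map_deg h)⟩⟩
instance : Sub (M ⟶ N) :=
  ⟨fun f g => ⟨f.lin - g.lin, fun h => sub_mem (f.map_deg h) (g.map_deg h)⟩⟩
instance : SMul ℕ (M ⟶ N) :=
  ⟨fun n f => ⟨n • f.lin, fun h => nsmul_mem (f.map_deg h) n⟩⟩
instance : SMul ℤ (M ⟶ N) :=
  ⟨fun n f => ⟨n • f.lin, fun h => zsmul_mem (f.map_deg h) n⟩⟩

instance : AddCommGroup (M ⟶ N) :=
  Function.Injective.addCommGroup (fun f : M ⟶ N => f.lin) lin_injective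
    rfl (fun _ _ => rfl) (fun _ => rfl) (fun _ _ => rfl) (fun _ _ => rfl) (fun _ _ => rfl)

@[simp] lemma zero_lin : Hom.lin (0 : M ⟶ N) = 0 := rfl
@[simp] lemma add_lin (f g : M ⟶ N) : Hom.lin (f + g) = f.lin + g.lin := rfl
@[simp] lemma neg_lin (f : M ⟶ N) : Hom.lin (-f) = -f.lin := rfl
@[simp] lemma sub_lin (f g : M ⟶ N) : Hom.lin (f - g) = f.lin - g.lin := rfl
@[simp] lemma zsmul_lin (n : ℤ) (f : M ⟶ N) : Hom.lin (n • f) = n • f.lin := rfl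

instance : Preadditive (GrMod 𝒜) where
  add_comp _ _ _ f f' g := by ext x; simp
  comp_add _ _ _ f g g' := by ext x; simp

lemma hom_proj (f : M ⟶ N) (i : ℤ) (x : M) : f.lin (M.proj i x) = N.proj i (f.lin x) := by
  induction M.mem_closure x using AddSubgroup.closure_induction with
  | mem y hy =>
    obtain ⟨j, hj⟩ := hy
    by_cases h : j = i
    · subst h
      rw [M.proj_of_mem hj, N.proj_of_mem (f.map_deg hj)]
    · rw [M.proj_of_mem_ne hj h, N.proj_of_mem_ne (f.map_deg hj) h, map_zero]
  | zero => simp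
  | add y z _ _ hy hz => simp only [map_add, hy, hz]
  | neg y _ hy => simp only [map_neg, hy]

/-- An isomorphism from a bijective morphism. -/
lemma isIso_of_bijective (f : M ⟶ N) (hf : Function.Bijective f.lin) : IsIso f := by
  let e := LinearEquiv.ofBijective f.lin hf
  refine ⟨⟨⟨e.symm.toLinearMap, fun {i x} hx => ?_⟩, ?_, ?_⟩⟩
  · have : e.symm x = M.proj i (e.symm x) := by
      apply hf.1
      rw [hom_proj]
      change e (e.symm x) = N.proj i (e (e.symm x))
      rw [e.apply_symm_apply, N.proj_of_mem hx]
    change e.symm x ∈ M.deg i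
    rw [this]
    exact M.proj_mem _ _
  · ext x; exact e.symm_apply_apply x
  · ext x; exact e.apply_symm_apply x

/-- The kernel of a morphism, as a graded module. -/
def ker (f : M ⟶ N) : GrMod 𝒜 where
  carrier := LinearMap.ker f.lin
  deg i := (M.deg i).comap (LinearMap.ker f.lin).subtype.toAddMonoidHom
  isInternal := by
    have hp : ∀ (i : ℤ) (x : LinearMap.ker f.lin), M.proj i x ∈ LinearMap.ker f.lin := by
      intro i x
      rw [LinearMap.mem_ker, hom_proj, x.2, map_zero]
    refine isInternal_of_proj _
      (fun i => AddMonoidHom.mk' (fun x => ⟨M.proj i x, hp i x⟩)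
        (fun x y => Subtype.ext (map_add _ _ _)))
      (fun i x hx => Subtype.ext (M.proj_of_mem hx))
      (fun i j x hx h => Subtype.ext (M.proj_of_mem_ne hx h)) ?_
    intro x
    let _ := M.isInternal.chooseDecomposition
    classical
    have hx : x = ∑ i ∈ (DirectSum.decompose M.deg (x : M)).support,
        (⟨M.proj i x, hp i x⟩ : LinearMap.ker f.lin) := by
      apply Subtype.ext
      rw [AddSubmonoidClass.coe_finsetSum]
      exact (DirectSum.sum_support_decompose M.deg (x : M)).symm
    rw [hx]
    exact sum_mem fun i _ => AddSubgroup.subset_closure ⟨i, M.proj_mem i x⟩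
  smul_mem ha hx := M.smul_mem ha hx

/-- The inclusion of the kernel. -/
def kerι (f : M ⟶ N) : ker f ⟶ M := ⟨(LinearMap.ker f.lin).subtype, fun h => h⟩

lemma kerι_comp (f : M ⟶ N) : kerι f ≫ f = 0 := by
  ext x; exact x.2

/-- `ker f` is a kernel of `f`. -/
def kerIsLimit (f : M ⟶ N) : IsLimit (KernelFork.ofι (kerι f) (kerι_comp f)) :=
  KernelFork.IsLimit.ofι _ _
    (fun g hg => ⟨LinearMap.codRestrict _ g.lin fun x => congrArg (fun k => Hom.lin k x) hg,
      fun h => g.map_deg h⟩)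
    (fun g hg => rfl)
    (fun g hg m hm => by
      subst hm
      rfl)

/-- The cokernel of a morphism, as a graded module. -/
def coker (f : M ⟶ N) : GrMod 𝒜 where
  carrier := N ⧸ LinearMap.range f.lin
  deg i := (N.deg i).map (LinearMap.range f.lin).mkQ.toAddMonoidHom
  isInternal := by
    refine isInternal_of_proj _
      (fun i => QuotientAddGroup.map _ _ (N.proj i) (by
        rintro _ ⟨x, rfl⟩
        exact ⟨M.proj i x, hom_proj _ _ _⟩)) ?_ ?_ ?_
    · rintro i _ ⟨x, hx, rfl⟩
      exact congrArg (LinearMap.range f.lin).mkQ (N.proj_of_mem hx)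
    · rintro i j _ ⟨x, hx, rfl⟩ h
      exact (congrArg (LinearMap.range f.lin).mkQ (N.proj_of_mem_ne hx h)).trans (map_zero _)
    · intro x
      obtain ⟨x, rfl⟩ := (LinearMap.range f.lin).mkQ_surjective x
      induction N.mem_closure x using AddSubgroup.closure_induction with
      | mem y hy =>
        obtain ⟨j, hj⟩ := hy
        exact AddSubgroup.subset_closure ⟨j, y, hj, rfl⟩
      | zero => rw [map_zero]; exact zero_mem _
      | add y z _ _ hy hz => rw [map_add]; exact add_mem hy hz
      | neg y _ hy => rw [map_neg]; exact neg_mem hy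
  smul_mem := by
    rintro i j a _ ha ⟨x, hx, rfl⟩
    exact ⟨a • x, N.smul_mem ha hx, map_smul (LinearMap.range f.lin).mkQ a x⟩

/-- The projection onto the cokernel. -/
def cokerπ (f : M ⟶ N) : N ⟶ coker f :=
  ⟨(LinearMap.range f.lin).mkQ, fun {_ x} h => ⟨x, h, rfl⟩⟩

lemma cokerπ_surjective (f : M ⟶ N) : Function.Surjective (cokerπ f).lin :=
  (LinearMap.range f.lin).mkQ_surjective

lemma comp_cokerπ (f : M ⟶ N) : f ≫ cokerπ f = 0 := by
  ext x
  exact (Submodule.Quotient.mk_eq_zero _).2 ⟨x, rfl⟩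

/-- `coker f` is a cokernel of `f`. -/
def cokerIsColimit (f : M ⟶ N) : IsColimit (CokernelCofork.ofπ (cokerπ f) (comp_cokerπ f)) :=
  CokernelCofork.IsColimit.ofπ _ _
    (fun g hg => ⟨(LinearMap.range f.lin).liftQ g.lin (by
        rintro _ ⟨x, rfl⟩
        exact congrArg (fun k => Hom.lin k x) hg), by
        rintro i _ ⟨x, hx, rfl⟩
        exact g.map_deg hx⟩)
    (fun g hg => rfl)
    (fun g hg m hm => by
      subst hm
      ext x
      obtain ⟨x, rfl⟩ := cokerπ_surjective f x
      rfl)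

/-- The product of a finite family of graded modules. -/
def pi {ι : Type} [Finite ι] (M : ι → GrMod 𝒜) : GrMod 𝒜 where
  carrier := ∀ i, M i
  deg j := AddSubgroup.pi Set.univ fun i => (M i).deg j
  isInternal := by
    classical
    have := Fintype.ofFinite ι
    refine isInternal_of_proj _
      (fun j => AddMonoidHom.mk' (fun x i => (M i).proj j (x i))
        (fun x y => funext fun i => map_add _ _ _))
      (fun j x hx => funext fun i => (M i).proj_of_mem (hx i trivial))
      (fun j k x hx h => funext fun i => (M i).proj_of_mem_ne (hx i trivial) h) ?_
    intro x
    rw [← Finset.univ_sum_single x]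
    refine sum_mem fun i _ => ?_
    generalize x i = y
    induction (M i).mem_closure y using AddSubgroup.closure_induction with
    | mem y hy =>
      obtain ⟨j, hj⟩ := hy
      refine AddSubgroup.subset_closure ⟨j, fun k _ => ?_⟩
      by_cases h : k = i
      · subst h
        simpa using hj
      · simp only [Pi.single_eq_of_ne h]
        exact ((M k).deg j).zero_mem
    | zero => rw [Pi.single_zero]; exact zero_mem _
    | add y z _ _ hy hz => rw [Pi.single_add]; exact add_mem hy hz
    | neg y _ hy => rw [Pi.single_neg]; exact neg_mem hy
  smul_mem ha hx := fun i hi => (M i).smul_mem ha (hx i hi)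

/-- The projections of a finite product. -/
def piπ {ι : Type} [Finite ι] (M : ι → GrMod 𝒜) (i : ι) : pi M ⟶ M i :=
  ⟨LinearMap.proj i, fun h => h i trivial⟩

/-- `pi M` is a product. -/
def piIsLimit {ι : Type} [Finite ι] (M : ι → GrMod 𝒜) : IsLimit (Fan.mk (pi M) (piπ M)) :=
  Fan.IsLimit.mk _
    (fun s => ⟨LinearMap.pi fun i => (s.proj i).lin, fun h i _ => (s.proj i).map_deg h⟩)
    (fun s i => rfl)
    (fun s m hm => by
      ext x
      funext i
      exact congrArg (fun k => Hom.lin k x) (hm i))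

instance : HasKernels (GrMod 𝒜) := ⟨fun f => ⟨_, kerIsLimit f⟩⟩
instance : HasCokernels (GrMod 𝒜) := ⟨fun f => ⟨_, cokerIsColimit f⟩⟩
instance : HasFiniteProducts (GrMod 𝒜) where
  out n :=
    ⟨fun F => by
      have : HasLimit (Discrete.functor (F.obj ∘ Discrete.mk)) := ⟨_, piIsLimit _⟩
      exact hasLimit_of_iso (Discrete.natIsoFunctor (F := F)).symm⟩

lemma mono_iff_injective (f : M ⟶ N) : Mono f ↔ Function.Injective f.lin := by
  constructor
  · intro h
    rw [← LinearMap.ker_eq_bot, LinearMap.ker_eq_bot']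
    intro x hx
    have : kerι f = 0 := by rw [← cancel_mono f, kerι_comp, zero_comp]
    exact congrArg (fun k => Hom.lin k (⟨x, hx⟩ : LinearMap.ker f.lin)) this
  · intro h
    refine ⟨fun a b hab => ?_⟩
    ext x
    exact h (congrArg (fun k => Hom.lin k x) hab)

lemma epi_iff_surjective (f : M ⟶ N) : Epi f ↔ Function.Surjective f.lin := by
  constructor
  · intro h
    rw [← LinearMap.range_eq_top, eq_top_iff]
    intro x _
    have : cokerπ f = 0 := by rw [← cancel_epi f, comp_cokerπ, comp_zero]
    exact (Submodule.Quotient.mk_eq_zero _).1 (congrArg (fun k => Hom.lin k x) this)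
  · intro h
    refine ⟨fun a b hab => ?_⟩
    ext x
    obtain ⟨x, rfl⟩ := h x
    exact congrArg (fun k => Hom.lin k x) hab

/-- `Gr(A)` is an abelian category. -/
instance : Abelian (GrMod 𝒜) where
  normalMonoOfMono {M N} f hf := ⟨{
    Z := coker f
    g := cokerπ f
    w := comp_cokerπ f
    isLimit :=
      have hf := (mono_iff_injective f).1 hf
      have hr : ∀ {P : GrMod 𝒜} (g : P ⟶ N), g ≫ cokerπ f = 0 →
          ∀ x, g.lin x ∈ LinearMap.range f.lin := fun g hg x =>
        (Submodule.Quotient.mk_eq_zero _).1 (congrArg (fun k => Hom.lin k x) hg)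
      let e := LinearEquiv.ofInjective f.lin hf
      have he : ∀ y, f.lin (e.symm y) = y := fun y => congrArg Subtype.val (e.apply_symm_apply y)
      KernelFork.IsLimit.ofι _ _
        (fun g hg => ⟨e.symm.toLinearMap ∘ₗ LinearMap.codRestrict _ g.lin (hr g hg), by
          intro i x hx
          have h : M.proj i (e.symm ⟨g.lin x, hr g hg x⟩) = e.symm ⟨g.lin x, hr g hg x⟩ := by
            apply hf
            rw [hom_proj, he, N.proj_of_mem (g.map_deg hx)]
          change e.symm ⟨g.lin x, hr g hg x⟩ ∈ M.deg i
          rw [← h]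
          exact M.proj_mem _ _⟩)
        (fun g hg => by
          ext x
          exact he ⟨g.lin x, hr g hg x⟩)
        (fun g hg m hm => by
          subst hm
          ext x
          apply hf
          exact (he ⟨f.lin (m.lin x), _⟩).symm) }⟩
  normalEpiOfEpi {M N} f hf := ⟨{
    W := ker f
    g := kerι f
    w := kerι_comp f
    isColimit :=
      have hf := (epi_iff_surjective f).1 hf
      let e := LinearMap.quotKerEquivOfSurjective f.lin hf
      have he : ∀ x, e.symm (f.lin x) = Submodule.Quotient.mk x := fun x => by
        rw [LinearEquiv.symm_apply_eq]; rfl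
      have hk : ∀ {P : GrMod 𝒜} (g : M ⟶ P), kerι f ≫ g = 0 →
          LinearMap.ker f.lin ≤ LinearMap.ker g.lin := fun g hg x hx => by
        have := congrArg (fun k : ker f ⟶ _ => k.lin (⟨x, hx⟩ : LinearMap.ker f.lin)) hg
        exact this
      have hd : ∀ {P : GrMod 𝒜} (g : M ⟶ P) (hg : kerι f ≫ g = 0) (x : M),
          ((LinearMap.ker f.lin).liftQ g.lin (hk g hg)) (e.symm (f.lin x)) = g.lin x :=
        fun g hg x => by rw [he]; rfl
      CokernelCofork.IsColimit.ofπ _ _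
        (fun g hg => ⟨(LinearMap.ker f.lin).liftQ g.lin (hk g hg) ∘ₗ e.symm.toLinearMap, by
          intro i y hy
          obtain ⟨x, rfl⟩ := hf y
          rw [← N.proj_of_mem hy, ← hom_proj]
          change ((LinearMap.ker f.lin).liftQ g.lin (hk g hg)) (e.symm (f.lin _)) ∈ _
          rw [hd g hg]
          exact g.map_deg (M.proj_mem _ _)⟩)
        (fun g hg => by
          ext x
          exact hd g hg x)
        (fun g hg m hm => by
          ext y
          obtain ⟨x, rfl⟩ := hf y
          exact (congrArg (fun k => Hom.lin k x) hm).trans (hd g hg x).symm) }⟩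

end GrMod

namespace GrMod

variable {A : Type u} [CommRing A] {𝒜 : ℤ → AddSubgroup A}

/-! ### Exactness in terms of elements -/

lemma exact_iff (S : ShortComplex (GrMod 𝒜)) :
    S.Exact ↔ ∀ x : S.X₂, S.g.lin x = 0 → ∃ y : S.X₁, S.f.lin y = x := by
  have hι : Function.Injective (kernel.ι S.g).lin := (mono_iff_injective _).1 inferInstance
  have hk : ∀ y, (kernel.ι S.g).lin ((kernel.lift S.g S.f S.zero).lin y) = S.f.lin y := fun y =>
    congrArg (fun k => Hom.lin k y) (kernel.lift_ι S.g S.f S.zero)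
  rw [ShortComplex.exact_iff_epi_kernel_lift, epi_iff_surjective]
  constructor
  · intro h x hx
    have e : (kernel.ι S.g).lin ((kernel.lift S.g (kerι S.g) (kerι_comp _)).lin
        (⟨x, hx⟩ : LinearMap.ker S.g.lin)) = x :=
      congrArg (fun k : ker S.g ⟶ _ => k.lin (⟨x, hx⟩ : LinearMap.ker S.g.lin))
        (kernel.lift_ι S.g (kerι S.g) (kerι_comp _))
    obtain ⟨y, hy⟩ := h ((kernel.lift S.g (kerι S.g) (kerι_comp _)).lin
        (⟨x, hx⟩ : LinearMap.ker S.g.lin))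
    exact ⟨y, by rw [← hk, hy, e]⟩
  · intro h x
    obtain ⟨y, hy⟩ := h ((kernel.ι S.g).lin x)
      (congrArg (fun k => Hom.lin k x) (kernel.condition S.g))
    exact ⟨y, hι (by rw [hk, hy])⟩

lemma comp_apply_zero {M N P : GrMod 𝒜} {f : M ⟶ N} {g : N ⟶ P} (h : f ≫ g = 0) (x : M) :
    g.lin (f.lin x) = 0 :=
  congrArg (fun k => Hom.lin k x) h

lemma proj_smul (M : GrMod 𝒜) {e : ℤ} {a : A} (ha : a ∈ 𝒜 e) (j : ℤ) (x : M) :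
    M.proj (e + j) (a • x) = a • M.proj j x := by
  induction M.mem_closure x using AddSubgroup.closure_induction with
  | mem y hy =>
    obtain ⟨i, hi⟩ := hy
    by_cases h : i = j
    · subst h
      rw [M.proj_of_mem hi, M.proj_of_mem (M.smul_mem ha hi)]
    · rw [M.proj_of_mem_ne hi h, M.proj_of_mem_ne (M.smul_mem ha hi) (by omega), smul_zero]
  | zero => simp
  | add y z _ _ hy hz => simp only [map_add, smul_add, hy, hz]
  | neg y _ hy => simp only [map_neg, smul_neg, hy]

/-! ### Positively torsion modules -/

end GrMod

section Torsion

variable {A : Type u} [CommRing A]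

/-- An element `x` of a module is `I^∞`-torsion if every `f ∈ I` has a positive power
annihilating `x`. -/
def IsPowTorsion (I : Ideal A) {X : Type*} [AddCommGroup X] [Module A X] (x : X) : Prop :=
  ∀ f ∈ I, ∃ n : ℕ, 0 < n ∧ f ^ n • x = 0

lemma IsPowTorsion.add {I : Ideal A} {X : Type*} [AddCommGroup X] [Module A X] {x y : X}
    (hx : IsPowTorsion I x) (hy : IsPowTorsion I y) : IsPowTorsion I (x + y) := by
  intro f hf
  obtain ⟨n, hn, h⟩ := hx f hf
  obtain ⟨m, hm, h'⟩ := hy f hf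
  refine ⟨n + m, by omega, ?_⟩
  rw [smul_add, pow_add, mul_smul, mul_smul, h', smul_zero, add_zero, smul_comm, h, smul_zero]

/-- The graded ideal `I⁺ = A_{>0} · A` generated by the elements of positive degree. -/
def idealPos (𝒜 : ℤ → AddSubgroup A) : Ideal A := Ideal.span {a | ∃ i : ℤ, 0 < i ∧ a ∈ 𝒜 i}

/-- The full subcategory `Tor⁺ ⊆ Gr(A)` of positively torsion graded modules: every homogeneous
element is `(I⁺)^∞`-torsion. -/
def torPos (𝒜 : ℤ → AddSubgroup A) : ObjectProperty (GrMod 𝒜) :=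
  fun M => ∀ (i : ℤ) (x : M), x ∈ M.deg i → IsPowTorsion (idealPos 𝒜) x

variable {𝒜 : ℤ → AddSubgroup A}

lemma torPos_iff (M : GrMod 𝒜) : torPos 𝒜 M ↔ ∀ x : M, IsPowTorsion (idealPos 𝒜) x := by
  refine ⟨fun h x => ?_, fun h i x _ => h x⟩
  induction M.mem_closure x using AddSubgroup.closure_induction with
  | mem y hy =>
    obtain ⟨i, hi⟩ := hy
    exact h i y hi
  | zero => exact fun f _ => ⟨1, one_pos, smul_zero _⟩
  | add y z _ _ hy hz => exact hy.add hz
  | neg y _ hy =>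
    intro f hf
    obtain ⟨n, hn, h⟩ := hy f hf
    exact ⟨n, hn, by rw [smul_neg, h, neg_zero]⟩

/-- `Tor⁺` is a Serre subcategory of `Gr(A)`. -/
instance : (torPos 𝒜).IsSerreClass where
  exists_zero := ⟨_, isZero_zero (GrMod 𝒜), fun i x _ f _ => ⟨1, one_pos, by
    have : x = 0 := congrArg (fun k => GrMod.Hom.lin k x)
      ((isZero_zero (GrMod 𝒜)).eq_of_src (𝟙 _) 0)
    rw [this, smul_zero]⟩⟩
  prop_of_mono {M N} g _ hN := by
    rw [torPos_iff] at hN ⊢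
    intro x f hf
    obtain ⟨n, hn, h⟩ := hN (g.lin x) f hf
    refine ⟨n, hn, (GrMod.mono_iff_injective g).1 inferInstance ?_⟩
    rw [map_smul, h, map_zero]
  prop_of_epi {M N} g _ hM := by
    rw [torPos_iff] at hM ⊢
    intro y f hf
    obtain ⟨x, rfl⟩ := (GrMod.epi_iff_surjective g).1 inferInstance y
    obtain ⟨n, hn, h⟩ := hM x f hf
    exact ⟨n, hn, by rw [← map_smul, h, map_zero]⟩
  prop_X₂_of_shortExact {S} hS h₁ h₃ := by
    rw [torPos_iff] at h₁ h₃ ⊢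
    intro x f hf
    obtain ⟨n, hn, h⟩ := h₃ (S.g.lin x) f hf
    obtain ⟨y, hy⟩ := (GrMod.exact_iff S).1 hS.exact (f ^ n • x) (by rw [map_smul, h])
    obtain ⟨m, hm, h'⟩ := h₁ y f hf
    exact ⟨m + n, by omega, by rw [pow_add, mul_smul, ← hy, ← map_smul, h', map_zero]⟩

end Torsion

/-! ### Localization of graded modules at a homogeneous element -/

namespace GrMod

variable {A : Type u} [CommRing A] {𝒜 : ℤ → AddSubgroup A}

open LocalizedModule (mk_eq mk_add_mk mk_neg zero_mk smul'_mk)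

/-- The fraction `x / f ^ n` in `M_f`. -/
abbrev frac {f : A} {X : Type*} [AddCommGroup X] [Module A X] (x : X) (n : ℕ) :
    LocalizedModule (Submonoid.powers f) X :=
  LocalizedModule.mk x ⟨f ^ n, n, rfl⟩

lemma exists_frac {f : A} {X : Type*} [AddCommGroup X] [Module A X]
    (y : LocalizedModule (Submonoid.powers f) X) : ∃ (x : X) (n : ℕ), y = frac x n := by
  induction y using LocalizedModule.induction_on with
  | _ x s =>
    obtain ⟨_, n, rfl⟩ := s
    exact ⟨x, n, rfl⟩

lemma frac_add {f : A} {X : Type*} [AddCommGroup X] [Module A X] (x y : X) (n m : ℕ) :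
    (frac x n : LocalizedModule (Submonoid.powers f) X) + frac y m =
      frac (f ^ m • x + f ^ n • y) (n + m) := by
  rw [mk_add_mk]
  congr 1
  exact Subtype.ext (pow_add f n m).symm

lemma frac_add_same {f : A} {X : Type*} [AddCommGroup X] [Module A X] (x y : X) (n : ℕ) :
    (frac (x + y) n : LocalizedModule (Submonoid.powers f) X) = frac x n + frac y n := by
  rw [mk_add_mk, ← smul_add, LocalizedModule.mk_cancel_common_left]

variable [SetLike.GradedMonoid 𝒜] {f : A} {e : ℤ}

lemma pow_mem_deg (hf : f ∈ 𝒜 e) (n : ℕ) : f ^ n ∈ 𝒜 (n * e) := by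
  simpa using SetLike.pow_mem_graded n hf

lemma frac_proj_eq (M : GrMod 𝒜) (hf : f ∈ 𝒜 e) (i : ℤ)
    {x y : M} {s t : Submonoid.powers f} (h : LocalizedModule.mk x s = LocalizedModule.mk y t)
    {n m : ℕ} (hn : f ^ n = s) (hm : f ^ m = t) :
    LocalizedModule.mk (M.proj (n * e + i) x) s = LocalizedModule.mk (M.proj (m * e + i) y) t := by
  rw [mk_eq] at h ⊢
  obtain ⟨⟨_, k, rfl⟩, h⟩ := h
  refine ⟨⟨f ^ k, k, rfl⟩, ?_⟩
  obtain ⟨_, hs⟩ := s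
  obtain ⟨_, ht⟩ := t
  dsimp only at hn hm
  subst hn hm
  simp only [Submonoid.smul_def] at h ⊢
  have hp := fun l => pow_mem_deg hf l
  rw [← M.proj_smul (hp m), ← M.proj_smul (hp n), ← M.proj_smul (hp k), ← M.proj_smul (hp k), h]
  congr 2
  ring

/-- The subgroup of `M_f` of the elements of degree `i`: the fractions `m / f ^ n` with
`m ∈ M_{i + n e}`, where `e` is the degree of `f`. -/
def locDeg (hf : f ∈ 𝒜 e) (M : GrMod 𝒜) (i : ℤ) :
    AddSubgroup (LocalizedModule (Submonoid.powers f) M) where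
  carrier := {x | ∃ (n : ℕ) (m : M), m ∈ M.deg (n * e + i) ∧ x = frac m n}
  zero_mem' := ⟨0, 0, zero_mem _, (zero_mk _).symm⟩
  neg_mem' := by
    rintro _ ⟨n, m, hm, rfl⟩
    exact ⟨n, -m, neg_mem hm, mk_neg.symm⟩
  add_mem' := by
    rintro _ _ ⟨n, m, hm, rfl⟩ ⟨n', m', hm', rfl⟩
    refine ⟨n + n', f ^ n' • m + f ^ n • m', add_mem ?_ ?_, frac_add _ _ _ _⟩
    · have := M.smul_mem (pow_mem_deg hf n') hm
      rwa [show (n' : ℤ) * e + (n * e + i) = (n + n' : ℕ) * e + i by push_cast; ring] at this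
    · have := M.smul_mem (pow_mem_deg hf n) hm'
      rwa [show (n : ℤ) * e + (n' * e + i) = (n + n' : ℕ) * e + i by push_cast; ring] at this

/-- The underlying function of the projection of `M_f` onto its component of degree `i`. -/
def locProjFun (hf : f ∈ 𝒜 e) (M : GrMod 𝒜) (i : ℤ)
    (x : LocalizedModule (Submonoid.powers f) M) : LocalizedModule (Submonoid.powers f) M :=
  x.liftOn (fun p => LocalizedModule.mk (M.proj (p.2.2.choose * e + i) p.1) p.2)
    (fun p q h => M.frac_proj_eq hf i (mk_eq.2 h) p.2.2.choose_spec q.2.2.choose_spec)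

lemma locProjFun_frac (hf : f ∈ 𝒜 e) (M : GrMod 𝒜) (i : ℤ) (x : M) (n : ℕ) :
    locProjFun hf M i (frac x n) = frac (M.proj (n * e + i) x) n :=
  M.frac_proj_eq hf i (x := x) (s := ⟨f ^ n, n, rfl⟩) rfl
    (⟨f ^ n, n, rfl⟩ : Submonoid.powers f).2.choose_spec rfl

/-- The projection of `M_f` onto its component of degree `i`. -/
def locProj (hf : f ∈ 𝒜 e) (M : GrMod 𝒜) (i : ℤ) :
    LocalizedModule (Submonoid.powers f) M →+ LocalizedModule (Submonoid.powers f) M :=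
  AddMonoidHom.mk' (locProjFun hf M i) (by
    intro x y
    obtain ⟨x, n, rfl⟩ := exists_frac x
    obtain ⟨y, m, rfl⟩ := exists_frac y
    rw [frac_add, locProjFun_frac, locProjFun_frac, locProjFun_frac, frac_add, map_add,
      ← M.proj_smul (pow_mem_deg hf n), ← M.proj_smul (pow_mem_deg hf m)]
    congr 4 <;> · push_cast; ring)

lemma locProj_frac (hf : f ∈ 𝒜 e) (M : GrMod 𝒜) (i : ℤ) (x : M) (n : ℕ) :
    locProj hf M i (frac x n) = frac (M.proj (n * e + i) x) n :=
  locProjFun_frac hf M i x n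

/-- The localization `M_f` of a graded module at a homogeneous element `f` of degree `e`. -/
def locObj (hf : f ∈ 𝒜 e) (M : GrMod 𝒜) : GrMod 𝒜 where
  carrier := LocalizedModule (Submonoid.powers f) M
  deg := locDeg hf M
  isInternal := by
    refine isInternal_of_proj _ (locProj hf M) ?_ ?_ ?_
    · rintro i _ ⟨n, m, hm, rfl⟩
      rw [locProj_frac, M.proj_of_mem hm]
    · rintro i j _ ⟨n, m, hm, rfl⟩ h
      rw [locProj_frac, M.proj_of_mem_ne hm (by omega)]
      exact zero_mk _
    · intro x
      obtain ⟨x, n, rfl⟩ := exists_frac x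
      induction M.mem_closure x using AddSubgroup.closure_induction with
      | mem y hy =>
        obtain ⟨j, hj⟩ := hy
        refine AddSubgroup.subset_closure ⟨j - n * e, n, y, ?_, rfl⟩
        rwa [add_sub_cancel]
      | zero => rw [frac, zero_mk]; exact zero_mem _
      | add y z _ _ hy hz =>
        rw [frac_add_same]
        exact add_mem hy hz
      | neg y _ hy =>
        have : (frac (-y) n : LocalizedModule (Submonoid.powers f) M) = -frac y n := mk_neg
        rw [this]
        exact neg_mem hy
  smul_mem := by
    rintro i j a _ ha ⟨n, m, hm, rfl⟩
    refine ⟨n, a • m, ?_, smul'_mk _ _ _⟩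
    have := M.smul_mem ha hm
    rwa [show i + (n * e + j) = n * e + (i + j) by ring] at this

/-- The map `M_f ⟶ N_f` induced by a morphism of graded modules. -/
def locMap (hf : f ∈ 𝒜 e) {M N : GrMod 𝒜} (g : M ⟶ N) : locObj hf M ⟶ locObj hf N where
  lin := IsLocalizedModule.map (Submonoid.powers f)
    (LocalizedModule.mkLinearMap (Submonoid.powers f) M)
    (LocalizedModule.mkLinearMap (Submonoid.powers f) N) g.lin
  map_deg := by
    rintro i _ ⟨n, m, hm, rfl⟩
    exact ⟨n, g.lin m, g.map_deg hm, IsLocalizedModule.map_LocalizedModules _ _ _ _⟩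

lemma locMap_frac (hf : f ∈ 𝒜 e) {M N : GrMod 𝒜} (g : M ⟶ N) (x : M) (n : ℕ) :
    (locMap hf g).lin (frac x n) = frac (g.lin x) n :=
  IsLocalizedModule.map_LocalizedModules _ _ _ _

lemma loc_hom_ext (hf : f ∈ 𝒜 e) {M N : GrMod 𝒜} {g h : locObj hf M ⟶ N}
    (H : ∀ (x : M) (n : ℕ), g.lin (frac x n) = h.lin (frac x n)) : g = h := by
  ext y
  obtain ⟨x, n, rfl⟩ := exists_frac (f := f) y
  exact H x n

/-- Localization at a homogeneous element, as a functor. -/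
def loc (hf : f ∈ 𝒜 e) : GrMod 𝒜 ⥤ GrMod 𝒜 where
  obj := locObj hf
  map g := locMap hf g
  map_id M := loc_hom_ext hf fun x n => locMap_frac hf _ x n
  map_comp g h := loc_hom_ext hf fun x n => by
    refine (locMap_frac hf (g ≫ h) x n).trans ?_
    refine ((locMap_frac hf h _ n).symm.trans ?_)
    exact congrArg (locMap hf h).lin (locMap_frac hf g x n).symm

lemma loc_map_frac (hf : f ∈ 𝒜 e) {M N : GrMod 𝒜} (g : M ⟶ N) (x : M) (n : ℕ) :
    ((loc hf).map g).lin (frac x n) = frac (g.lin x) n :=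
  locMap_frac hf g x n

instance (hf : f ∈ 𝒜 e) : (loc hf).Additive where
  map_add {_ _ g h} := loc_hom_ext hf fun x n =>
    (locMap_frac hf (g + h) x n).trans ((frac_add_same _ _ n).trans
      (congrArg₂ (· + ·) (locMap_frac hf g x n) (locMap_frac hf h x n)).symm)

variable {f' : A} {e' : ℤ}

lemma isUnit_of_dvd (h : f ∣ f') (X : Type*) [AddCommGroup X] [Module A X]
    (s : Submonoid.powers f) :
    IsUnit (algebraMap A (Module.End A (LocalizedModule (Submonoid.powers f') X)) s) := by
  obtain ⟨_, n, rfl⟩ := s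
  obtain ⟨g, rfl⟩ := h
  have := IsLocalizedModule.map_units (LocalizedModule.mkLinearMap (Submonoid.powers (f * g)) X)
    (⟨(f * g) ^ n, n, rfl⟩ : Submonoid.powers (f * g))
  change IsUnit (algebraMap A (Module.End A _) ((f * g) ^ n)) at this
  rw [mul_pow, map_mul] at this
  exact (((Commute.all (f ^ n) (g ^ n)).map (algebraMap A _)).isUnit_mul_iff.1 this).1

lemma lift_frac (g : A) (h : f * g = f') (X : Type*) [AddCommGroup X] [Module A X] (x : X) (n : ℕ) :
    LocalizedModule.lift (Submonoid.powers f)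
      (LocalizedModule.mkLinearMap (Submonoid.powers f') X) (isUnit_of_dvd ⟨g, h.symm⟩ X)
      (frac x n) = frac (g ^ n • x) n := by
  subst h
  rw [LocalizedModule.lift_mk, Module.End.algebraMap_isUnit_inv_apply_eq_iff,
    LocalizedModule.mkLinearMap_apply, smul'_mk, mk_eq]
  refine ⟨1, ?_⟩
  simp only [one_smul, Submonoid.smul_def, smul_smul, mul_pow]

/-- For `f' = f g`, the canonical map `M_f ⟶ M_{f'}`, `x / f ^ n ↦ g ^ n x / f' ^ n`. -/
def locTransApp (hf : f ∈ 𝒜 e) (hf' : f' ∈ 𝒜 e') {g : A} {eg : ℤ} (hg : g ∈ 𝒜 eg)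
    (h : f * g = f') (he : e + eg = e') (M : GrMod 𝒜) : locObj hf M ⟶ locObj hf' M where
  lin := LocalizedModule.lift (Submonoid.powers f)
    (LocalizedModule.mkLinearMap (Submonoid.powers f') M) (isUnit_of_dvd ⟨g, h.symm⟩ M)
  map_deg := by
    rintro i _ ⟨n, m, hm, rfl⟩
    refine ⟨n, g ^ n • m, ?_, lift_frac g h _ _ _⟩
    have := M.smul_mem (pow_mem_deg hg n) hm
    rwa [show (n : ℤ) * eg + (n * e + i) = n * e' + i by rw [← he]; ring] at this

lemma locTransApp_frac (hf : f ∈ 𝒜 e) (hf' : f' ∈ 𝒜 e') {g : A} {eg : ℤ} (hg : g ∈ 𝒜 eg)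
    (h : f * g = f') (he : e + eg = e') (M : GrMod 𝒜) (x : M) (n : ℕ) :
    (locTransApp hf hf' hg h he M).lin (frac x n) = frac (g ^ n • x) n :=
  lift_frac g h _ _ _

/-- The maps `M_f ⟶ M_{f'}` as a natural transformation. -/
def locTrans (hf : f ∈ 𝒜 e) (hf' : f' ∈ 𝒜 e') {g : A} {eg : ℤ} (hg : g ∈ 𝒜 eg)
    (h : f * g = f') (he : e + eg = e') : loc hf ⟶ loc hf' where
  app M := locTransApp hf hf' hg h he M
  naturality M N k := loc_hom_ext hf fun x n => by
    change (locTransApp hf hf' hg h he N).lin ((locMap hf k).lin (frac x n)) =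
      (locMap hf' k).lin ((locTransApp hf hf' hg h he M).lin (frac x n))
    refine (congrArg _ (locMap_frac hf k x n)).trans ?_
    refine (locTransApp_frac hf hf' hg h he N _ n).trans ?_
    refine Eq.trans ?_ (congrArg _ (locTransApp_frac hf hf' hg h he M x n).symm)
    refine Eq.trans ?_ (locMap_frac hf' k _ n).symm
    rw [map_smul]

lemma locTrans_frac (hf : f ∈ 𝒜 e) (hf' : f' ∈ 𝒜 e') {g : A} {eg : ℤ} (hg : g ∈ 𝒜 eg)
    (h : f * g = f') (he : e + eg = e') (M : GrMod 𝒜) (x : M) (n : ℕ) :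
    ((locTrans hf hf' hg h he).app M).lin (frac x n) = frac (g ^ n • x) n :=
  lift_frac g h _ _ _

/-- Localization preserves exactness. -/
lemma loc_exact (hf : f ∈ 𝒜 e) (S : ShortComplex (GrMod 𝒜)) (hS : S.Exact) :
    (S.map (loc hf)).Exact := by
  rw [exact_iff] at hS ⊢
  have : Function.Exact S.f.lin S.g.lin := fun x =>
    ⟨hS x, by rintro ⟨y, rfl⟩; exact comp_apply_zero S.zero y⟩
  exact fun x hx => (LocalizedModule.map_exact (Submonoid.powers f) _ _ this x).1 hx

end GrMod

/-! ### Čech complexes -/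

/-- The functor to cochain complexes given by a cochain complex of functors. -/
def complexOfFunctors {C D : Type*} [Category C] [Category D] [Preadditive D]
    (T : ℕ → C ⥤ D) (δ : ∀ m, T m ⟶ T (m + 1)) (h : ∀ m, δ m ≫ δ (m + 1) = 0) :
    C ⥤ CochainComplex D ℕ where
  obj X := CochainComplex.of (fun m => (T m).obj X) (fun m => (δ m).app X)
    (fun m => congrArg (fun k => NatTrans.app k X) (h m))
  map g := CochainComplex.ofHom (fun m => (T m).map g) (fun m => by simp)

section Cech

variable {A : Type u} [CommRing A] {𝒜 : ℤ → AddSubgroup A} [SetLike.GradedMonoid 𝒜]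
  {r : ℕ} {f : Fin r → A} {d : Fin r → ℤ} (hf : ∀ i, f i ∈ 𝒜 (d i))

namespace Cech

open GrMod

/-- The product `f_{i₀} ⋯ f_{i_{m-1}}` for a strictly increasing sequence `i₀ < ⋯ < i_{m-1}`. -/
def prodF (f : Fin r → A) {m : ℕ} (s : Fin m ↪o Fin r) : A := ∏ j, f (s j)

lemma prodF_mem (hf : ∀ i, f i ∈ 𝒜 (d i)) {m : ℕ} (s : Fin m ↪o Fin r) : prodF f s ∈ 𝒜 (∑ j, d (s j)) :=
  SetLike.prod_mem_graded _ _ _ fun j _ => hf (s j)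

/-- The term `M ↦ ∏_{i₀ < ⋯ < i_{m-1}} M_{f_{i₀} ⋯ f_{i_{m-1}}}` of the extended Čech complex. For `m = 0`
it is the localization `M_1` of `M` at the empty product, which is `M` itself up to the canonical
isomorphism. -/
def term (m : ℕ) : GrMod 𝒜 ⥤ GrMod 𝒜 where
  obj M := GrMod.pi fun s : Fin m ↪o Fin r => (loc (prodF_mem hf s)).obj M
  map g := 
    { lin := LinearMap.pi fun s => ((loc (prodF_mem hf s)).map g).lin ∘ₗ LinearMap.proj s
      map_deg := fun hx s _ => ((loc (prodF_mem hf s)).map g).map_deg (hx s trivial) }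
  map_id M := by
    ext x
    funext s
    exact congrArg (fun k => Hom.lin k (x s)) ((loc (prodF_mem hf s)).map_id M)
  map_comp g h := by
    ext x
    funext s
    exact congrArg (fun k => Hom.lin k (x s)) ((loc (prodF_mem hf s)).map_comp g h)

instance (m : ℕ) : (term hf m).Additive where
  map_add {M N g h} := by
    ext x
    funext s
    exact congrArg (fun k => Hom.lin k (x s)) ((loc (prodF_mem hf s)).map_add)

lemma term_exact (m : ℕ) (S : ShortComplex (GrMod 𝒜)) (hS : S.Exact) :
    (S.map (term hf m)).Exact := by
  rw [exact_iff]
  intro x hx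
  have := fun s => (exact_iff _).1 (loc_exact (prodF_mem hf s) S hS) (x s) (congrFun hx s)
  choose y hy using this
  exact ⟨y, funext hy⟩

/-- The strictly increasing sequence `i₀ < ⋯ < î_j < ⋯ < i_m`. -/
def face {m : ℕ} (s : Fin (m + 1) ↪o Fin r) (j : Fin (m + 1)) : Fin m ↪o Fin r :=
  (Fin.succAboveOrderEmb j).trans s

lemma prodF_face {m : ℕ} (s : Fin (m + 1) ↪o Fin r) (j : Fin (m + 1)) :
    prodF f (face s j) * f (s j) = prodF f s := by
  rw [prodF, prodF, Fin.prod_univ_succAbove _ j, mul_comm]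
  rfl

lemma sum_face (d : Fin r → ℤ) {m : ℕ} (s : Fin (m + 1) ↪o Fin r) (j : Fin (m + 1)) :
    (∑ k, d (face s j k)) + d (s j) = ∑ k, d (s k) := by
  rw [Fin.sum_univ_succAbove _ j, add_comm]
  rfl

/-- The localization map `M_{f_{i₀} ⋯ f̂_{i_j} ⋯ f_{i_m}} ⟶ M_{f_{i₀} ⋯ f_{i_m}}`. -/
def faceMap {m : ℕ} (s : Fin (m + 1) ↪o Fin r) (j : Fin (m + 1)) :
    loc (prodF_mem hf (face s j)) ⟶ loc (prodF_mem hf s) :=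
  locTrans _ _ (hf (s j)) (prodF_face s j) (sum_face d s j)

/-- The components of the differential of the extended Čech complex. -/
def diffApp (m : ℕ) (M : GrMod 𝒜) : (term hf m).obj M ⟶ (term hf (m + 1)).obj M where
  lin := LinearMap.pi fun s : Fin (m + 1) ↪o Fin r => ∑ j : Fin (m + 1),
    (-1 : ℤ) ^ (j : ℕ) • (((faceMap hf s j).app M).lin ∘ₗ LinearMap.proj (face s j))
  map_deg := by
    intro i x hx s _
    change (∑ j : Fin (m + 1), _ : _ →ₗ[A] _) x ∈ _
    rw [LinearMap.sum_apply]
    exact sum_mem fun j _ => zsmul_mem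
      (((faceMap hf s j).app M).map_deg (hx (face s j) trivial)) _

lemma diffApp_apply {m : ℕ} (M : GrMod 𝒜) (x : (term hf m).obj M) (s : Fin (m + 1) ↪o Fin r) :
    (diffApp hf m M).lin x s =
      ∑ j : Fin (m + 1), (-1 : ℤ) ^ (j : ℕ) • ((faceMap hf s j).app M).lin (x (face s j)) := by
  refine (LinearMap.sum_apply _ _ _).trans ?_
  rfl

/-- The differential `d^m = ∑_j (-1)^j d_j^m` of the extended Čech complex, where `d_j^m` is made up
of the localization maps that adjoin `f_{i_j}`. -/
def diff (m : ℕ) : term hf m ⟶ term hf (m + 1) where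
  app M := diffApp hf m M
  naturality M N g := by
    ext x
    funext s
    refine (diffApp_apply hf N _ s).trans ?_
    refine Eq.trans ?_ (congrArg (locMap (prodF_mem hf s) g).lin (diffApp_apply hf M x s)).symm
    refine Eq.trans ?_ (map_sum (locMap (prodF_mem hf s) g).lin _ _).symm
    refine Finset.sum_congr rfl fun j _ => ?_
    refine Eq.trans ?_ (map_zsmul (locMap (prodF_mem hf s) g).lin _ _).symm
    exact congrArg (fun k => (-1 : ℤ) ^ (j : ℕ) • Hom.lin k (x (face s j)))
      ((faceMap hf s j).naturality g)

lemma diff_app {m : ℕ} (M : GrMod 𝒜) (x : (term hf m).obj M) (s : Fin (m + 1) ↪o Fin r) :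
    ((diff hf m).app M).lin x s =
      ∑ j : Fin (m + 1), (-1 : ℤ) ^ (j : ℕ) • ((faceMap hf s j).app M).lin (x (face s j)) :=
  diffApp_apply hf M x s

/-- The localization map from the factor of index `t` to the factor of index `s`. -/
def transLin {m n : ℕ} (s : Fin n ↪o Fin r) (t : Fin m ↪o Fin r) (h : prodF f t ∣ prodF f s)
    (M : GrMod 𝒜) : (loc (prodF_mem hf t)).obj M →ₗ[A] (loc (prodF_mem hf s)).obj M :=
  LocalizedModule.lift (Submonoid.powers (prodF f t))
    (LocalizedModule.mkLinearMap (Submonoid.powers (prodF f s)) M) (isUnit_of_dvd h M)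

lemma transLin_congr {m n : ℕ} {s : Fin n ↪o Fin r} {t t' : Fin m ↪o Fin r} (e : t = t')
    (h : prodF f t ∣ prodF f s) (h' : prodF f t' ∣ prodF f s) (M : GrMod 𝒜)
    (x : (term hf m).obj M) :
    transLin hf s t h M (x t) = transLin hf s t' h' M (x t') := by
  subst e
  rfl

lemma faceMap_faceMap {m : ℕ} (s : Fin (m + 2) ↪o Fin r) (j : Fin (m + 2)) (k : Fin (m + 1))
    (h : prodF f (face (face s j) k) ∣ prodF f s)
    (M : GrMod 𝒜) (x : (loc (prodF_mem hf (face (face s j) k))).obj M) :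
    ((faceMap hf s j).app M).lin (((faceMap hf (face s j) k).app M).lin x) =
      transLin hf s (face (face s j) k) h M x := by
  obtain ⟨x, n, rfl⟩ := exists_frac (f := prodF f (face (face s j) k)) x
  refine (congrArg _ (locTrans_frac _ _ _ _ _ M x n)).trans ?_
  refine (locTrans_frac _ _ _ _ _ M _ n).trans ?_
  refine Eq.trans ?_ (lift_frac (f (face s j k) * f (s j)) ?_ M x n).symm
  · rw [mul_comm, mul_pow, mul_smul]
  · rw [← mul_assoc, prodF_face, prodF_face]

lemma diff_comp (m : ℕ) : diff hf m ≫ diff hf (m + 1) = 0 := by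
  ext M x
  funext s
  have hdvd : ∀ j k, prodF f (face (face s j) k) ∣ prodF f s := fun j k =>
    ⟨f (face s j k) * f (s j), by rw [← mul_assoc, prodF_face, prodF_face]⟩
  let V : Fin (m + 2) × Fin (m + 1) → (loc (prodF_mem hf s)).obj M := fun p =>
    (-1 : ℤ) ^ ((p.1 : ℕ) + (p.2 : ℕ)) •
      transLin hf s (face (face s p.1) p.2) (hdvd p.1 p.2) M (x (face (face s p.1) p.2))
  have h₁ : ((diff hf (m + 1)).app M).lin (((diff hf m).app M).lin x) s = ∑ p, V p := by
    rw [diff_app, Fintype.sum_prod_type]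
    refine Finset.sum_congr rfl fun j _ => ?_
    rw [diff_app, map_sum, Finset.smul_sum]
    refine Finset.sum_congr rfl fun k _ => ?_
    rw [map_zsmul, faceMap_faceMap hf s j k (hdvd j k), smul_smul, ← pow_add]
  refine h₁.trans ?_
  refine Finset.sum_involution (fun p _ => (p.1.succAbove p.2, p.2.predAbove p.1)) ?_ ?_ ?_ ?_
  · rintro ⟨j, k⟩ -
    have e : face (face s (j.succAbove k)) (k.predAbove j) = face (face s j) k := by
      ext l
      exact congrArg (fun i => (s i : ℕ)) (Fin.succAbove_succAbove_succAbove_predAbove j k l)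
    change (-1 : ℤ) ^ _ • _ + (-1 : ℤ) ^ _ • _ = 0
    rw [transLin_congr hf e _ (hdvd j k), ← add_smul, Fin.neg_one_pow_succAbove_add_predAbove]
    simp
  · rintro ⟨j, k⟩ - -
    exact fun h => Fin.succAbove_ne j k (congrArg Prod.fst h)
  · intros; exact Finset.mem_univ _
  · rintro ⟨j, k⟩ -
    exact Prod.ext (Fin.succAbove_succAbove_predAbove j k) (Fin.predAbove_predAbove_succAbove j k)

/-- The functor `M ↦ RΓ_{(f)}(M) = [M ⟶ ∏ M_{f_{i₀}} ⟶ ∏_{i₀ < i₁} M_{f_{i₀} f_{i₁}} ⟶ ⋯]`, the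
extended Čech complex, with `M` in degree `0`. -/
def ext : GrMod 𝒜 ⥤ CochainComplex (GrMod 𝒜) ℕ :=
  complexOfFunctors (term hf) (diff hf) (diff_comp hf)

/-- The functor `M ↦ Č_{(f)}(M) = [∏ M_{f_{i₀}} ⟶ ∏_{i₀ < i₁} M_{f_{i₀} f_{i₁}} ⟶ ⋯]`, the Čech
complex, with `∏ M_{f_{i₀}}` in degree `0`. It is the part of positive degree of the extended Čech
complex, shifted by one; in particular its differential is the negative of that one. -/
def cech : GrMod 𝒜 ⥤ CochainComplex (GrMod 𝒜) ℕ :=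
  complexOfFunctors (fun q => term hf (q + 1)) (fun q => -diff hf (q + 1)) (fun q => by
    rw [Preadditive.neg_comp, Preadditive.comp_neg, neg_neg, diff_comp])

instance : (ext hf).Additive where
  map_add := by
    intros
    ext m : 1
    exact (term hf m).map_add

instance : (cech hf).Additive where
  map_add := by
    intros
    ext m : 1
    exact (term hf (m + 1)).map_add

lemma ext_exact (q : ℕ) (S : ShortComplex (GrMod 𝒜)) (hS : S.Exact) :
    (S.map (ext hf ⋙ HomologicalComplex.eval _ _ q)).Exact :=
  term_exact hf q S hS

lemma cech_exact (q : ℕ) (S : ShortComplex (GrMod 𝒜)) (hS : S.Exact) :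
    (S.map (cech hf ⋙ HomologicalComplex.eval _ _ q)).Exact :=
  term_exact hf (q + 1) S hS

end Cech

end Cech

/-! ### Total complexes -/

namespace Tot

attribute [local instance] Abelian.hasFiniteBiproducts

variable {C D : Type*} [Category C] [Category D] [Abelian C] [Abelian D]
  (N : ℕ) (F : C ⥤ CochainComplex D ℕ)

/-- The pairs `(p, q)` with `p + q = n` and `0 ≤ q ≤ N`. -/
abbrev Idx (N : ℕ) (n : ℤ) : Type := {i : ℤ × Fin (N + 1) // i.1 + ((i.2 : ℕ) : ℤ) = n}

instance (n : ℤ) : Finite (Idx N n) :=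
  Finite.of_injective (fun i : Idx N n => i.1.2) (by
    rintro ⟨⟨p, q⟩, h⟩ ⟨⟨p', q'⟩, h'⟩ (e : q = q')
    subst e
    dsimp only at h h'
    obtain rfl : p = p' := by omega
    rfl)

/-- The term `⨁_{p + q = n} F(K^p)^q`. -/
abbrev X (K : CochainComplex C ℤ) (n : ℤ) : D := ⨁ fun i : Idx N n => (F.obj (K.X i.1.1)).X i.1.2

/-- The projection to the summand `F(K^p)^q`; it is zero if there is no such summand. -/
def proj (K : CochainComplex C ℤ) (n p : ℤ) (q : ℕ) : X N F K n ⟶ (F.obj (K.X p)).X q :=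
  if h : q < N + 1 ∧ p + q = n then
    biproduct.π (fun i : Idx N n => (F.obj (K.X i.1.1)).X i.1.2) ⟨(p, ⟨q, h.1⟩), h.2⟩
  else 0

/-- The morphism with given components. -/
def lift (K : CochainComplex C ℤ) (n : ℤ) {T : D} (g : ∀ p q, T ⟶ (F.obj (K.X p)).X q) :
    T ⟶ X N F K n :=
  biproduct.lift fun i => g i.1.1 i.1.2

/-- The inclusion of the summand `F(K^p)^q`; it is zero if there is no such summand. -/
def incl (K : CochainComplex C ℤ) (n p : ℤ) (q : ℕ) : (F.obj (K.X p)).X q ⟶ X N F K n :=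
  if h : q < N + 1 ∧ p + q = n then
    biproduct.ι (fun i : Idx N n => (F.obj (K.X i.1.1)).X i.1.2) ⟨(p, ⟨q, h.1⟩), h.2⟩
  else 0

variable {N F} {K : CochainComplex C ℤ} {n p : ℤ} {q : ℕ}

lemma proj_eq_π (hq : q < N + 1) (h : p + q = n) : proj N F K n p q =
    biproduct.π (fun i : Idx N n => (F.obj (K.X i.1.1)).X i.1.2) ⟨(p, ⟨q, hq⟩), h⟩ :=
  dif_pos ⟨hq, h⟩

lemma incl_eq_ι (hq : q < N + 1) (h : p + q = n) : incl N F K n p q =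
    biproduct.ι (fun i : Idx N n => (F.obj (K.X i.1.1)).X i.1.2) ⟨(p, ⟨q, hq⟩), h⟩ :=
  dif_pos ⟨hq, h⟩

lemma proj_eq_zero (h : ¬(q < N + 1 ∧ p + q = n)) : proj N F K n p q = 0 := dif_neg h

lemma incl_eq_zero (h : ¬(q < N + 1 ∧ p + q = n)) : incl N F K n p q = 0 := dif_neg h

lemma lift_proj {T : D} (g : ∀ p q, T ⟶ (F.obj (K.X p)).X q) (hq : q < N + 1) (h : p + q = n) :
    lift N F K n g ≫ proj N F K n p q = g p q :=
  (congrArg (lift N F K n g ≫ ·) (proj_eq_π hq h)).trans (biproduct.lift_π _ _)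

lemma hom_ext {T : D} {g g' : T ⟶ X N F K n}
    (h : ∀ p q, q < N + 1 → p + q = n → g ≫ proj N F K n p q = g' ≫ proj N F K n p q) :
    g = g' := by
  refine biproduct.hom_ext _ _ ?_
  rintro ⟨⟨p, q⟩, hi⟩
  have e := proj_eq_π (N := N) (F := F) (K := K) q.2 hi
  exact (congrArg (g ≫ ·) e).symm.trans ((h p q q.2 hi).trans (congrArg (g' ≫ ·) e))

lemma incl_proj_self (hq : q < N + 1) (h : p + q = n) :
    incl N F K n p q ≫ proj N F K n p q = 𝟙 _ :=
  (congrArg₂ (· ≫ ·) (incl_eq_ι hq h) (proj_eq_π hq h)).trans (biproduct.ι_π_self _ _)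

lemma incl_proj_ne {p' : ℤ} {q' : ℕ} (h : q ≠ q') :
    incl N F K n p q ≫ proj N F K n p' q' = 0 := by
  by_cases h₁ : q < N + 1 ∧ p + q = n
  · by_cases h₂ : q' < N + 1 ∧ p' + q' = n
    · exact (congrArg₂ (· ≫ ·) (incl_eq_ι h₁.1 h₁.2) (proj_eq_π h₂.1 h₂.2)).trans
        (biproduct.ι_π_ne _ fun e => h (congrArg (fun i : Idx N n => (i.1.2 : ℕ)) e))
    · rw [proj_eq_zero h₂, comp_zero]
  · rw [incl_eq_zero h₁, zero_comp]

variable (N F)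

/-- The differential of the total complex: `d_h + (-1)^p d_v` on `F(K^p)^q`. -/
def d (K : CochainComplex C ℤ) (n n' : ℤ) : X N F K n ⟶ X N F K n' :=
  lift N F K n' fun p q =>
    proj N F K n (p - 1) q ≫ (F.map (K.d (p - 1) p)).f q +
      (p.negOnePow : ℤ) • proj N F K n p (q - 1) ≫ (F.obj (K.X p)).d (q - 1) q

variable {N F}

lemma d_proj {n' : ℤ} (hq : q < N + 1) (h : p + q = n') :
    d N F K n n' ≫ proj N F K n' p q =
      proj N F K n (p - 1) q ≫ (F.map (K.d (p - 1) p)).f q +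
        (p.negOnePow : ℤ) • proj N F K n p (q - 1) ≫ (F.obj (K.X p)).d (q - 1) q :=
  lift_proj _ hq h

variable (N F)

variable {N F} in
lemma d_proj_assoc {K : CochainComplex C ℤ} {n n' p : ℤ} {q : ℕ} (hq : q < N + 1)
    (h : p + q = n') {T : D} (g : (F.obj (K.X p)).X q ⟶ T) :
    d N F K n n' ≫ proj N F K n' p q ≫ g =
      (proj N F K n (p - 1) q ≫ (F.map (K.d (p - 1) p)).f q +
        (p.negOnePow : ℤ) • proj N F K n p (q - 1) ≫ (F.obj (K.X p)).d (q - 1) q) ≫ g := by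
  rw [← d_proj hq h, Category.assoc]

/-- The components of the map of total complexes induced by a map of complexes. -/
def mapX {K L : CochainComplex C ℤ} (φ : K ⟶ L) (n : ℤ) : X N F K n ⟶ X N F L n :=
  lift N F L n fun p q => proj N F K n p q ≫ (F.map (φ.f p)).f q

variable {N F} in
lemma mapX_proj {K L : CochainComplex C ℤ} (φ : K ⟶ L) (n p : ℤ) (q : ℕ) :
    mapX N F φ n ≫ proj N F L n p q = proj N F K n p q ≫ (F.map (φ.f p)).f q := by
  by_cases h : q < N + 1 ∧ p + q = n
  · exact lift_proj _ h.1 h.2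
  · rw [proj_eq_zero h, proj_eq_zero h, comp_zero, zero_comp]

variable {N F} in
lemma mapX_proj_assoc {K L : CochainComplex C ℤ} (φ : K ⟶ L) (n p : ℤ) (q : ℕ) {T : D}
    (g : (F.obj (L.X p)).X q ⟶ T) :
    mapX N F φ n ≫ proj N F L n p q ≫ g =
      proj N F K n p q ≫ (F.map (φ.f p)).f q ≫ g := by
  rw [← Category.assoc, mapX_proj, Category.assoc]

variable {N F} in
lemma comp_d_proj_of_forall_lt {K : CochainComplex C ℤ} {T : D} {n n' p p' : ℤ} {j : ℕ}
    (g : T ⟶ X N F K n) (hg : ∀ q < j, ∀ p, g ≫ proj N F K n p q = 0) (hj : j < N + 1)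
    (hp : p + j = n') (hp' : p' + 1 = p) :
    g ≫ d N F K n n' ≫ proj N F K n' p j =
      g ≫ proj N F K n p' j ≫ (F.map (K.d p' p)).f j := by
  obtain rfl : p' = p - 1 := by omega
  rw [d_proj hj hp, Preadditive.comp_add, Preadditive.comp_zsmul]
  suffices g ≫ proj N F K n p (j - 1) ≫ (F.obj (K.X p)).d (j - 1) j = 0 by
    rw [this, smul_zero, add_zero]
  cases j with
  | zero => simp
  | succ j => rw [reassoc_of% (hg (j + 1 - 1) (by omega) p), zero_comp]

/-- The columns of the map of double complexes induced by `φ` have acyclic mapping cones. -/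
def ColAcyclic {K L : CochainComplex C ℤ} (φ : K ⟶ L) : Prop :=
  ∀ (q : ℕ) ⦃T : D⦄ (l m n o : ℤ), l + 1 = m → m + 1 = n → n + 1 = o →
    ∀ (x : T ⟶ (F.obj (K.X n)).X q) (y : T ⟶ (F.obj (L.X m)).X q),
      x ≫ (F.map (K.d n o)).f q = 0 → x ≫ (F.map (φ.f n)).f q = y ≫ (F.map (L.d m n)).f q →
      ∃ (T' : D) (π : T' ⟶ T) (_ : Epi π) (x' : T' ⟶ (F.obj (K.X m)).X q)
        (y' : T' ⟶ (F.obj (L.X l)).X q),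
        π ≫ x = x' ≫ (F.map (K.d m n)).f q ∧
        π ≫ y = x' ≫ (F.map (φ.f m)).f q + y' ≫ (F.map (L.d l m)).f q

variable {N F} in
lemma exists_incl {K : CochainComplex C ℤ} {T : D} (n p : ℤ) (j : ℕ) (hj : j < N + 1)
    (hp : p + j = n) (x : T ⟶ (F.obj (K.X p)).X j) :
    ∃ x' : T ⟶ X N F K n, (∀ q < j, ∀ p', x' ≫ proj N F K n p' q = 0) ∧
      x' ≫ proj N F K n p j = x :=
  ⟨x ≫ incl N F K n p j, fun q hq p => by rw [Category.assoc, incl_proj_ne hq.ne', comp_zero],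
    by rw [Category.assoc, incl_proj_self hj hp, Category.comp_id]⟩

variable {N F} in
lemma exists_refinement_step {K L : CochainComplex C ℤ} (φ : K ⟶ L) (hcol : ColAcyclic F φ)
    {l m n o : ℤ} (hlm : l + 1 = m) (hmn : m + 1 = n) (hno : n + 1 = o)
    {T : D} (x : T ⟶ X N F K n) (y : T ⟶ X N F L m)
    (hx : x ≫ d N F K n o = 0) (hxy : x ≫ mapX N F φ n = y ≫ d N F L m n) {j : ℕ}
    (hj : j < N + 1) (hx₀ : ∀ q < j, ∀ p, x ≫ proj N F K n p q = 0)
    (hy₀ : ∀ q < j, ∀ p, y ≫ proj N F L m p q = 0) :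
    ∃ (T' : D) (π : T' ⟶ T) (_ : Epi π) (x' : T' ⟶ X N F K m) (y' : T' ⟶ X N F L l),
      ∀ q < j + 1, ∀ p, (π ≫ x - x' ≫ d N F K m n) ≫ proj N F K n p q = 0 ∧
        (π ≫ y - x' ≫ mapX N F φ m - y' ≫ d N F L l m) ≫ proj N F L m p q = 0 := by
  obtain ⟨T', π, hπ, x', y', e, e'⟩ := hcol j (l - j) (m - j) (n - j) (o - j) (by omega) (by omega)
    (by omega) (x ≫ proj N F K n (n - j) j) (y ≫ proj N F L m (m - j) j)
    (by
      rw [Category.assoc, ← comp_d_proj_of_forall_lt x hx₀ hj (n' := o) (by omega) (by omega),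
        reassoc_of% hx, zero_comp])
    (by
      rw [Category.assoc, ← mapX_proj, reassoc_of% hxy,
        comp_d_proj_of_forall_lt y hy₀ hj (p' := m - j) (by omega) (by omega), Category.assoc])
  obtain ⟨x', hx', rfl⟩ := exists_incl m (m - j) j hj (by omega) x'
  obtain ⟨y', hy', rfl⟩ := exists_incl l (l - j) j hj (by omega) y'
  refine ⟨T', π, hπ, x', y', fun q hq p => ⟨?_, ?_⟩⟩
  · by_cases hp : q < N + 1 ∧ p + q = n
    · rw [Preadditive.sub_comp, Category.assoc, Category.assoc]
      rcases (show q < j ∨ q = j by omega) with h | h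
      · rw [comp_d_proj_of_forall_lt x' (fun q' h' => hx' q' (by omega)) hp.1 hp.2 (p' := p - 1)
          (by omega), hx₀ q h, comp_zero, reassoc_of% (hx' q h (p - 1)), zero_comp, sub_zero]
      · subst h
        obtain rfl : p = n - q := by omega
        rw [comp_d_proj_of_forall_lt x' hx' hj (p' := m - q) (by omega) (by omega), e,
          Category.assoc, sub_self]
    · rw [proj_eq_zero hp, comp_zero]
  · by_cases hp : q < N + 1 ∧ p + q = m
    · rw [Preadditive.sub_comp, Preadditive.sub_comp, Category.assoc, Category.assoc,
        Category.assoc, mapX_proj]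
      rcases (show q < j ∨ q = j by omega) with h | h
      · rw [comp_d_proj_of_forall_lt y' (fun q' h' => hy' q' (by omega)) hp.1 hp.2 (p' := p - 1)
          (by omega), hy₀ q h, comp_zero, reassoc_of% (hy' q h (p - 1)),
          reassoc_of% (hx' q h p), zero_comp, zero_comp, sub_zero, sub_zero]
      · subst h
        obtain rfl : p = m - q := by omega
        rw [comp_d_proj_of_forall_lt y' hy' hj (p' := l - q) (by omega) (by omega), e',
          Category.assoc, Category.assoc, add_sub_cancel_left, sub_self]
    · rw [proj_eq_zero hp, comp_zero]

variable [F.Additive]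

/-- The total complex of the double complex with terms `F(K^p)^q` for `0 ≤ q ≤ N`. -/
def obj (K : CochainComplex C ℤ) : CochainComplex D ℤ where
  X n := X N F K n
  d n n' := d N F K n n'
  shape n n' h := by
    refine hom_ext fun p q hq hn => ?_
    have h' : n + 1 ≠ n' := h
    rw [d_proj hq hn, proj_eq_zero (by omega), zero_comp, zero_comp, zero_add]
    cases q with
    | zero => rw [(F.obj (K.X p)).shape _ _ (by simp), comp_zero, smul_zero]
    | succ q =>
      rw [proj_eq_zero (by push_cast at hn; simp only [Nat.add_sub_cancel]; omega), zero_comp,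
        smul_zero]
  d_comp_d' n n' n'' h' h'' := by
    have h' : n + 1 = n' := h'
    have h'' : n' + 1 = n'' := h''
    refine hom_ext fun p q hq hn => ?_
    rw [zero_comp, Category.assoc, d_proj hq hn, Preadditive.comp_add, Preadditive.comp_zsmul,
      d_proj_assoc hq (by omega), Preadditive.add_comp, Category.assoc, ← HomologicalComplex.comp_f,
      ← F.map_comp, K.d_comp_d, F.map_zero, HomologicalComplex.zero_f, comp_zero, zero_add]
    cases q with
    | zero => simp
    | succ q =>
      rw [Nat.add_sub_cancel, d_proj_assoc (by omega) (by push_cast at hn; omega)]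
      simp only [Preadditive.add_comp, Preadditive.zsmul_comp, Category.assoc,
        HomologicalComplex.d_comp_d, comp_zero, smul_zero, add_zero,
        HomologicalComplex.Hom.comm, Int.negOnePow_sub, Int.negOnePow_one]
      simp

/-- The map of total complexes induced by a map of complexes. -/
def map {K L : CochainComplex C ℤ} (φ : K ⟶ L) : obj N F K ⟶ obj N F L where
  f n := mapX N F φ n
  comm' n n' _ := by
    refine hom_ext fun p q hq hn => ?_
    change (mapX N F φ n ≫ d N F L n n') ≫ _ = (d N F K n n' ≫ mapX N F φ n') ≫ _
    rw [Category.assoc, Category.assoc, d_proj hq hn, mapX_proj, d_proj_assoc hq hn]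
    simp only [Preadditive.comp_add, Preadditive.add_comp, Preadditive.comp_zsmul,
      Preadditive.zsmul_comp, mapX_proj_assoc, Category.assoc, ← HomologicalComplex.comp_f,
      ← F.map_comp, HomologicalComplex.Hom.comm]

/-- The functor sending a complex `K` in `C` to the total complex of the double complex
`F(K^p)^q`, `0 ≤ q ≤ N`. -/
def functor : CochainComplex C ℤ ⥤ CochainComplex D ℤ where
  obj K := obj N F K
  map φ := map N F φ
  map_id K := by
    ext n : 1
    refine hom_ext fun p q hq hn => ?_
    change mapX N F (𝟙 K) n ≫ _ = 𝟙 _ ≫ _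
    rw [mapX_proj]
    simp
  map_comp {K L M} φ ψ := by
    ext n : 1
    refine hom_ext fun p q hq hn => ?_
    change mapX N F (φ ≫ ψ) n ≫ _ = (mapX N F φ n ≫ mapX N F ψ n) ≫ _
    rw [Category.assoc, mapX_proj, mapX_proj, mapX_proj_assoc]
    simp

/-! The total complex preserves quasi-isomorphisms if `F` is exact in every degree. -/

/-- A form of the acyclicity of the mapping cone of `ψ`. -/
def ConeAcyclic {K L : CochainComplex D ℤ} (ψ : K ⟶ L) : Prop :=
  ∀ ⦃T : D⦄ (l m n o : ℤ), l + 1 = m → m + 1 = n → n + 1 = o →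
    ∀ (x : T ⟶ K.X n) (y : T ⟶ L.X m), x ≫ K.d n o = 0 → x ≫ ψ.f n = y ≫ L.d m n →
      ∃ (T' : D) (π : T' ⟶ T) (_ : Epi π) (x' : T' ⟶ K.X m) (y' : T' ⟶ L.X l),
        π ≫ x = x' ≫ K.d m n ∧ π ≫ y = x' ≫ ψ.f m + y' ≫ L.d l m

lemma quasiIso_iff_coneAcyclic {K L : CochainComplex D ℤ} (ψ : K ⟶ L) :
    QuasiIso ψ ↔ ConeAcyclic ψ := by
  have hp : ∀ i j : ℤ, i + 1 = j → (ComplexShape.up ℤ).prev j = i := fun i j h =>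
    (ComplexShape.up ℤ).prev_eq' h
  have hn : ∀ i j : ℤ, i + 1 = j → (ComplexShape.up ℤ).next i = j := fun i j h =>
    (ComplexShape.up ℤ).next_eq' h
  constructor
  · intro h T l m n o hlm hmn hno x y hx hxy
    have h₁ : Mono (HomologicalComplex.homologyMap ψ n) := inferInstance
    have h₂ : Epi (HomologicalComplex.homologyMap ψ m) := inferInstance
    rw [HomologicalComplex.mono_homologyMap_iff_up_to_refinements ψ m n o (hp _ _ hmn)
      (hn _ _ hno)] at h₁
    rw [HomologicalComplex.epi_homologyMap_iff_up_to_refinements ψ l m n (hp _ _ hlm)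
      (hn _ _ hmn)] at h₂
    obtain ⟨T₁, π₁, _, x₁, e₁⟩ := h₁ x hx y hxy
    obtain ⟨T₂, π₂, _, x₂, hx₂, y₂, e₂⟩ := h₂ (π₁ ≫ y - x₁ ≫ ψ.f m) (by
      rw [Preadditive.sub_comp, Category.assoc, ← hxy, reassoc_of% e₁, Category.assoc,
        HomologicalComplex.Hom.comm, sub_self])
    refine ⟨T₂, π₂ ≫ π₁, inferInstance, π₂ ≫ x₁ + x₂, y₂, ?_, ?_⟩
    · rw [Preadditive.add_comp, hx₂, add_zero, Category.assoc, e₁, Category.assoc]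
    · rw [Preadditive.add_comp, add_assoc, ← e₂, Preadditive.comp_sub]
      simp
  · intro h
    rw [quasiIso_iff]
    intro n
    rw [quasiIsoAt_iff_isIso_homologyMap]
    have h₁ : Mono (HomologicalComplex.homologyMap ψ n) := by
      rw [HomologicalComplex.mono_homologyMap_iff_up_to_refinements ψ (n - 1) n (n + 1)
        (hp _ _ (by omega)) (hn _ _ rfl)]
      intro T x hx y hxy
      obtain ⟨T', π, hπ, x', y', e, -⟩ := h (n - 1 - 1) (n - 1) n (n + 1) (by omega) (by omega) rfl
        x y hx hxy
      exact ⟨T', π, hπ, x', e⟩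
    have h₂ : Epi (HomologicalComplex.homologyMap ψ n) := by
      rw [HomologicalComplex.epi_homologyMap_iff_up_to_refinements ψ (n - 1) n (n + 1)
        (hp _ _ (by omega)) (hn _ _ rfl)]
      intro T y hy
      obtain ⟨T', π, hπ, x', y', e, e'⟩ := h (n - 1) n (n + 1) (n + 1 + 1) (by omega) rfl rfl
        (0 : T ⟶ K.X (n + 1)) y zero_comp (by rw [hy, zero_comp])
      exact ⟨T', π, hπ, x', by rw [← e, comp_zero], y', e'⟩
    exact isIso_of_mono_of_epi _

variable {N F} in
lemma exists_refinement {K L : CochainComplex C ℤ} (φ : K ⟶ L) (hcol : ColAcyclic F φ)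
    {l m n o : ℤ} (hlm : l + 1 = m) (hmn : m + 1 = n) (hno : n + 1 = o)
    {T : D} (x : T ⟶ X N F K n) (y : T ⟶ X N F L m)
    (hx : x ≫ d N F K n o = 0) (hxy : x ≫ mapX N F φ n = y ≫ d N F L m n) (j : ℕ)
    (hj : j ≤ N + 1) :
    ∃ (T' : D) (π : T' ⟶ T) (_ : Epi π) (x' : T' ⟶ X N F K m) (y' : T' ⟶ X N F L l),
      ∀ q < j, ∀ p, (π ≫ x - x' ≫ d N F K m n) ≫ proj N F K n p q = 0 ∧
        (π ≫ y - x' ≫ mapX N F φ m - y' ≫ d N F L l m) ≫ proj N F L m p q = 0 := by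
  have dd : ∀ (M : CochainComplex C ℤ) (a b c : ℤ), d N F M a b ≫ d N F M b c = 0 :=
    fun M a b c => (obj N F M).d_comp_d a b c
  have dm : ∀ (a b : ℤ), mapX N F φ a ≫ d N F L a b = d N F K a b ≫ mapX N F φ b :=
    fun a b => (map N F φ).comm a b
  induction j with
  | zero => exact ⟨T, 𝟙 T, inferInstance, 0, 0, fun q hq => by omega⟩
  | succ j ih =>
    obtain ⟨T₁, π₁, _, x₁, y₁, h₁⟩ := ih (by omega)
    obtain ⟨T₂, π₂, _, x₂, y₂, h₂⟩ := exists_refinement_step φ hcol hlm hmn hno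
      (π₁ ≫ x - x₁ ≫ d N F K m n) (π₁ ≫ y - x₁ ≫ mapX N F φ m - y₁ ≫ d N F L l m)
      (by simp only [Preadditive.sub_comp, Category.assoc, hx, dd, comp_zero, sub_zero])
      (by simp only [Preadditive.sub_comp, Category.assoc, hxy, dd, dm, comp_zero, sub_zero])
      (by omega : j < N + 1) (fun q hq p => (h₁ q hq p).1) (fun q hq p => (h₁ q hq p).2)
    refine ⟨T₂, π₂ ≫ π₁, inferInstance, π₂ ≫ x₁ + x₂, π₂ ≫ y₁ + y₂, fun q hq p => ⟨?_, ?_⟩⟩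
    · convert (h₂ q hq p).1 using 2
      simp only [Preadditive.comp_sub, Preadditive.add_comp, Category.assoc]
      abel
    · convert (h₂ q hq p).2 using 2
      simp only [Preadditive.comp_sub, Preadditive.add_comp, Category.assoc]
      abel

lemma map_quasiIso (hF : ∀ q (S : ShortComplex C), S.Exact →
      (S.map (F ⋙ HomologicalComplex.eval D (ComplexShape.up ℕ) q)).Exact)
    {K L : CochainComplex C ℤ} (φ : K ⟶ L) (hφ : QuasiIso φ) : QuasiIso (map N F φ) := by
  have hcol : ∀ q, ConeAcyclic
      (((F ⋙ HomologicalComplex.eval D (ComplexShape.up ℕ) q).mapHomologicalComplex _).map φ) := by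
    intro q
    rw [← quasiIso_iff_coneAcyclic]
    have : (F ⋙ HomologicalComplex.eval D (ComplexShape.up ℕ) q).PreservesHomology :=
      ((F ⋙ HomologicalComplex.eval D (ComplexShape.up ℕ) q).exact_tfae.out 1 2).1 (hF q)
    exact HomologicalComplex.quasiIso_map_of_preservesHomology _ _
  rw [quasiIso_iff_coneAcyclic]
  intro T l m n o hlm hmn hno x y hx hxy
  obtain ⟨T', π, hπ, x', y', h⟩ := exists_refinement φ hcol hlm hmn hno x y hx hxy (N + 1) le_rfl
  refine ⟨T', π, hπ, x', y', ?_, ?_⟩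
  · exact sub_eq_zero.1 (hom_ext fun p q hq _ => (h q hq p).1.trans zero_comp.symm)
  · rw [← sub_eq_iff_eq_add', ← sub_eq_zero]
    exact hom_ext fun p q hq _ => (h q hq p).2.trans zero_comp.symm

end Tot

/-! ### Serre quotients -/

section SerreQuotient

variable {C : Type*} [Category C] [Abelian C] (P : ObjectProperty C) [P.IsSerreClass]

/-- The Serre quotient `C/S`, as the localization of `C` at the morphisms with kernel and cokernel
in `S`. -/
def SerreQuotient : Type _ := P.isoModSerre.Localization

instance : Category (SerreQuotient P) := inferInstanceAs (Category P.isoModSerre.Localization)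

/-- The quotient functor `φ^* : C ⥤ C/S`. -/
def SerreQuotient.functor : C ⥤ SerreQuotient P := P.isoModSerre.Q

instance : (SerreQuotient.functor P).IsLocalization P.isoModSerre :=
  inferInstanceAs (P.isoModSerre.Q.IsLocalization P.isoModSerre)

instance : Preadditive (SerreQuotient P) :=
  inferInstanceAs (Preadditive P.isoModSerre.Localization)

instance : (SerreQuotient.functor P).Additive :=
  inferInstanceAs P.isoModSerre.Q.Additive

instance : Abelian (SerreQuotient P) :=
  ObjectProperty.SerreClassLocalization.abelian (SerreQuotient.functor P) P

instance : PreservesFiniteLimits (SerreQuotient.functor P) :=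
  ObjectProperty.SerreClassLocalization.preservesFiniteLimits _ P

instance : PreservesFiniteColimits (SerreQuotient.functor P) :=
  ObjectProperty.SerreClassLocalization.preservesFiniteColimits _ P

end SerreQuotient

/-! ### The derived categories `D^♠` for `♠ ∈ {∅, +, -, b}` -/

/-- The four symbols `∅`, `+`, `-`, `b`. -/
inductive Spade
  | none
  | plus
  | minus
  | bounded

section DerivedCategories

variable (C : Type*) [Category C] [Abelian C] [HasDerivedCategory.{w} C]

/-- The objects of `D^♠(C)`: all complexes, respectively those with cohomology bounded below,
bounded above, bounded on both sides. -/
def dProp : Spade → ObjectProperty (DerivedCategory C)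
  | .none => ⊤
  | .plus => DerivedCategory.TStructure.t.plus
  | .minus => DerivedCategory.TStructure.t.minus
  | .bounded => DerivedCategory.TStructure.t.bounded

instance (b : Spade) : (dProp C b).IsTriangulated := by
  cases b with
  | none =>
    exact
      { exists_zero := ⟨_, isZero_zero (DerivedCategory C), trivial⟩
        isStableUnderShiftBy := fun _ => ⟨fun _ _ => trivial⟩
        ext₂' := fun _ _ _ _ => ⟨_, trivial, ⟨Iso.refl _⟩⟩ }
  | plus => exact inferInstanceAs (DerivedCategory.TStructure.t.plus.IsTriangulated)
  | minus => exact inferInstanceAs (DerivedCategory.TStructure.t.minus.IsTriangulated)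
  | bounded => exact inferInstanceAs (DerivedCategory.TStructure.t.bounded.IsTriangulated)

/-- The triangulated category `D^♠(C)`. -/
abbrev DCat (b : Spade) : Type _ := (dProp C b).FullSubcategory

variable {C}

/-- The full subcategory `D^♠_S(C) ⊆ D^♠(C)` of the complexes with cohomology in `S`. -/
def dCohomologyIn (S : ObjectProperty C) (b : Spade) : ObjectProperty (DCat C b) :=
  fun X => ∀ n : ℤ, S ((DerivedCategory.homologyFunctor C n).obj X.obj)

variable {C' : Type*} [Category C'] [Abelian C'] [HasDerivedCategory.{w'} C'] (F : C ⥤ C')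
  [F.Additive] [PreservesFiniteLimits F] [PreservesFiniteColimits F]

lemma isGE_mapDerivedCategory (X : DerivedCategory C) (n : ℤ) (h : X.IsGE n) :
    (F.mapDerivedCategory.obj X).IsGE n := by
  obtain ⟨K, _, ⟨e⟩⟩ := X.exists_iso_Q_obj_of_isGE n
  have h₁ : CochainComplex.IsStrictlyGE ((F.mapHomologicalComplex (ComplexShape.up ℤ)).obj K) n :=
    K.map_isStrictlySupported F _
  have : ((F.mapHomologicalComplex (ComplexShape.up ℤ) ⋙ DerivedCategory.Q).obj K).IsGE n :=
    (DerivedCategory.isGE_Q_obj_iff _ n).2 inferInstance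
  exact DerivedCategory.TStructure.t.isGE_of_iso ((F.mapDerivedCategoryFactors.app K).symm ≪≫
    F.mapDerivedCategory.mapIso e.symm) n

lemma isLE_mapDerivedCategory (X : DerivedCategory C) (n : ℤ) (h : X.IsLE n) :
    (F.mapDerivedCategory.obj X).IsLE n := by
  obtain ⟨K, _, ⟨e⟩⟩ := X.exists_iso_Q_obj_of_isLE n
  have h₁ : CochainComplex.IsStrictlyLE ((F.mapHomologicalComplex (ComplexShape.up ℤ)).obj K) n :=
    K.map_isStrictlySupported F _
  have : ((F.mapHomologicalComplex (ComplexShape.up ℤ) ⋙ DerivedCategory.Q).obj K).IsLE n :=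
    (DerivedCategory.isLE_Q_obj_iff _ n).2 inferInstance
  exact DerivedCategory.TStructure.t.isLE_of_iso ((F.mapDerivedCategoryFactors.app K).symm ≪≫
    F.mapDerivedCategory.mapIso e.symm) n

lemma dProp_mapDerivedCategory (b : Spade) (X : DerivedCategory C) (h : dProp C b X) :
    dProp C' b (F.mapDerivedCategory.obj X) := by
  cases b with
  | none => trivial
  | plus =>
    obtain ⟨n, h⟩ := h
    exact ⟨n, isGE_mapDerivedCategory F X n h⟩
  | minus =>
    obtain ⟨n, h⟩ := h
    exact ⟨n, isLE_mapDerivedCategory F X n h⟩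
  | bounded =>
    obtain ⟨⟨n, h⟩, ⟨m, h'⟩⟩ := h
    exact ⟨⟨n, isGE_mapDerivedCategory F X n h⟩, ⟨m, isLE_mapDerivedCategory F X m h'⟩⟩

/-- The functor `D^♠(C) ⥤ D^♠(C')` induced by an exact functor `C ⥤ C'`. -/
abbrev mapD (b : Spade) : DCat C b ⥤ DCat C' b :=
  (dProp C' b).lift ((dProp C b).ι ⋙ F.mapDerivedCategory)
    (fun X => dProp_mapDerivedCategory F b X.obj X.property)

end DerivedCategories

section Localizing

variable {C : Type*} [Category C] [Abelian C] (S : ObjectProperty C) [S.IsSerreClass]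
  [HasDerivedCategory.{w} C] [HasDerivedCategory.{w'} (SerreQuotient S)]

/-- The functor `φ^* : D(C) ⥤ D(C/S)`. -/
abbrev phiStar : DerivedCategory C ⥤ DerivedCategory (SerreQuotient S) :=
  (SerreQuotient.functor S).mapDerivedCategory

/-- The functor `φ^* : D^♠(C) ⥤ D^♠(C/S)`. -/
abbrev phiStarD (b : Spade) : DCat C b ⥤ DCat (SerreQuotient S) b :=
  mapD (SerreQuotient.functor S) b

/-- The Serre subcategory `S` is `D^♠`-localizing: `φ^* : D^♠(C) ⥤ D^♠(C/S)` has a right adjoint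
`Rφ_*` such that the counit `φ^* Rφ_* ⟶ 𝟙` is an isomorphism. -/
def IsDLocalizing (b : Spade) : Prop :=
  ∃ (R : DCat (SerreQuotient S) b ⥤ DCat C b) (adj : phiStarD S b ⊣ R), IsIso adj.counit

end Localizing

/-- The sequence `(E₁, E₂)` of full subcategories of the triangulated category `T` is a
semi-orthogonal decomposition `T = ⟨E₁, E₂⟩`: both are triangulated, `Hom(E₂, E₁) = 0`, and each
object `X` sits in an exact triangle `X₂ ⟶ X ⟶ X₁ ⟶ X₂[1]` with `X₁ ∈ E₁` and `X₂ ∈ E₂`. -/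
structure IsSemiorthogonalDecomposition {T : Type*} [Category T] [Preadditive T]
    [HasZeroObject T] [HasShift T ℤ] [∀ n : ℤ, (shiftFunctor T n).Additive] [Pretriangulated T]
    (E₁ E₂ : ObjectProperty T) : Prop where
  isTriangulated₁ : E₁.IsTriangulated
  isTriangulated₂ : E₂.IsTriangulated
  hom_eq_zero : ∀ ⦃X Y : T⦄ (f : X ⟶ Y), E₂ X → E₁ Y → f = 0
  exists_triangle : ∀ X : T, ∃ (X₁ X₂ : T) (f : X₂ ⟶ X) (g : X ⟶ X₁)
    (h : X₁ ⟶ (shiftFunctor T (1 : ℤ)).obj X₂), E₁ X₁ ∧ E₂ X₂ ∧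
      Pretriangulated.Triangle.mk f g h ∈ Pretriangulated.distinguishedTriangles

/-! ### Local cohomology and Čech complexes on the derived category -/

section LocalCohomology

variable {A : Type u} [CommRing A] {𝒜 : ℤ → AddSubgroup A} [SetLike.GradedMonoid 𝒜]
  {r : ℕ} {f : Fin r → A} {d : Fin r → ℤ}

/-- The functor `K ↦ RΓ_{(f)}(K)` on cochain complexes: the total complex of the double complex
`RΓ_{(f)}(K^p)^q`, which vanishes for `q > r`. -/
def rGammaComplex (hf : ∀ i, f i ∈ 𝒜 (d i)) :
    CochainComplex (GrMod 𝒜) ℤ ⥤ CochainComplex (GrMod 𝒜) ℤ :=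
  Tot.functor r (Cech.ext hf)

/-- The functor `K ↦ Č_{(f)}(K)` on cochain complexes: the total complex of the double complex
`Č_{(f)}(K^p)^q`, which vanishes for `q ≥ r`. -/
def cechComplex (hf : ∀ i, f i ∈ 𝒜 (d i)) :
    CochainComplex (GrMod 𝒜) ℤ ⥤ CochainComplex (GrMod 𝒜) ℤ :=
  Tot.functor r (Cech.cech hf)

variable [HasDerivedCategory.{w} (GrMod 𝒜)]

/-- The functor `RΓ_I : D(Gr(A)) ⥤ D(Gr(A))`, where `I` is generated by the `f i`. -/
def rGamma (hf : ∀ i, f i ∈ 𝒜 (d i)) : DerivedCategory (GrMod 𝒜) ⥤ DerivedCategory (GrMod 𝒜) :=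
  Localization.lift (rGammaComplex hf ⋙ DerivedCategory.Q)
    (W := HomologicalComplex.quasiIso (GrMod 𝒜) (ComplexShape.up ℤ))
    (fun _ _ φ hφ => by
      have := Tot.map_quasiIso r (Cech.ext hf) (Cech.ext_exact hf) φ hφ
      exact inferInstanceAs (IsIso (DerivedCategory.Q.map (Tot.map r (Cech.ext hf) φ))))
    DerivedCategory.Q

/-- The functor `Č_I : D(Gr(A)) ⥤ D(Gr(A))`, where `I` is generated by the `f i`. -/
def cechD (hf : ∀ i, f i ∈ 𝒜 (d i)) : DerivedCategory (GrMod 𝒜) ⥤ DerivedCategory (GrMod 𝒜) :=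
  Localization.lift (cechComplex hf ⋙ DerivedCategory.Q)
    (W := HomologicalComplex.quasiIso (GrMod 𝒜) (ComplexShape.up ℤ))
    (fun _ _ φ hφ => by
      have := Tot.map_quasiIso r (Cech.cech hf) (Cech.cech_exact hf) φ hφ
      exact inferInstanceAs (IsIso (DerivedCategory.Q.map (Tot.map r (Cech.cech hf) φ))))
    DerivedCategory.Q

/-- The full subcategory `D^♠_{I-triv}(Gr(A)) ⊆ D^♠(Gr(A))` of the `I`-trivial complexes:
`RΓ_I(M) ≃ 0`. -/
def trivD (hf : ∀ i, f i ∈ 𝒜 (d i)) (b : Spade) : ObjectProperty (DCat (GrMod 𝒜) b) :=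
  fun X => IsZero ((rGamma hf).obj X.obj)

end LocalCohomology

/-- The category `Q⁺Gr(A) = Gr(A)/Tor⁺`. -/
abbrev QGr {A : Type u} [CommRing A] (𝒜 : ℤ → AddSubgroup A) : Type _ := SerreQuotient (torPos 𝒜)

end

/-!
The Čech complex kills `Tor⁺`, since inverting any `f i` kills a torsion module. It is therefore
induced by a functor `E` on `Q⁺Gr(A)` with values in complexes of length `r`, and `Y ↦ Tot E(Y)` is
right adjoint to `φ^*` on derived categories. Two facts make this work: the extended Čech complex
of any `M` has torsion cohomology, so that `M ⟶ Tot E(φ M)` becomes invertible after applying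
`φ^*`; and the extended Čech complex of a localization `M_{f_{i_0} ⋯ f_{i_q}}` is acyclic, so that
the same map is already invertible for `M = Tot E(Y)`. As `E` has bounded length, the adjunction
restricts to each `D^♠`. Any adjunction with invertible counit whose left adjoint is exact yields a
semi-orthogonal decomposition, and `RΓ_{I⁺}` is a shifted cone of the unit, so it vanishes exactly
where the unit is invertible.
-/

noncomputable section

/-! ### Total complexes -/

namespace Tot

attribute [local instance] Abelian.hasFiniteBiproducts

lemma negOnePow_smul_negOnePow_smul {M : Type*} [AddCommGroup M] (p : ℤ) (x : M) :
    (p.negOnePow : ℤ) • (p.negOnePow : ℤ) • x = x := by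
  rw [smul_smul, ← Units.val_mul, Int.units_mul_self, Units.val_one, one_smul]

section AcyclicRows

variable {C D : Type*} [Category C] [Category D] [Abelian C] [Abelian D]
  {N : ℕ} {F : C ⥤ CochainComplex D ℕ} {K : CochainComplex C ℤ} {T : D}

lemma comp_d_proj_of_forall_ne {n n' p : ℤ} {j q : ℕ} (x : T ⟶ X N F K n)
    (hx : ∀ q ≠ j, ∀ p, x ≫ proj N F K n p q = 0) (hj : j < q) (hq : q < N + 1)
    (hp : p + q = n') :
    x ≫ d N F K n n' ≫ proj N F K n' p q =
      (p.negOnePow : ℤ) • (x ≫ proj N F K n p (q - 1)) ≫ (F.obj (K.X p)).d (q - 1) q := by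
  rw [d_proj hq hp, Preadditive.comp_add, reassoc_of% (hx q hj.ne'), zero_comp, zero_add,
    Preadditive.comp_zsmul, Category.assoc]

lemma comp_proj_d_eq_zero_of_forall_gt (hN : ∀ p, IsZero ((F.obj (K.X p)).X (N + 1)))
    {n o p : ℤ} (hno : n + 1 = o) (x : T ⟶ X N F K n) (hx : x ≫ d N F K n o = 0) {j : ℕ}
    (hj : j < N + 1) (hp : p + j = n) (hgt : ∀ q, j < q → ∀ p, x ≫ proj N F K n p q = 0) :
    (x ≫ proj N F K n p j) ≫ (F.obj (K.X p)).d j (j + 1) = 0 := by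
  rcases (show j = N ∨ j + 1 < N + 1 by omega) with rfl | hj'
  · exact (hN p).eq_of_tgt _ _
  · have h := congrArg (· ≫ proj N F K o p (j + 1)) hx
    simp only [Category.assoc, zero_comp] at h
    rw [d_proj hj' (by push_cast; omega), Preadditive.comp_add,
      reassoc_of% (hgt (j + 1) j.lt_succ_self), zero_comp, zero_add, Preadditive.comp_zsmul,
      ← Units.smul_def, smul_eq_zero_iff_eq] at h
    rwa [Category.assoc]

lemma exists_refinement_proj_eq (hrow : ∀ p, (F.obj (K.X p)).Acyclic) {m n p : ℤ}
    (hmn : m + 1 = n) (x : T ⟶ X N F K n) {j : ℕ} (hj : j < N + 1) (hp : p + j = n)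
    (hx : (x ≫ proj N F K n p j) ≫ (F.obj (K.X p)).d j (j + 1) = 0) :
    ∃ (T' : D) (π : T' ⟶ T) (_ : Epi π) (x' : T' ⟶ X N F K m),
      (∀ q, j < q → ∀ p, (x' ≫ d N F K m n) ≫ proj N F K n p q = 0) ∧
      (x' ≫ d N F K m n) ≫ proj N F K n p j = π ≫ x ≫ proj N F K n p j := by
  have hrow := ((F.obj (K.X p)).exactAt_iff_exact_up_to_refinements (j - 1) j (j + 1)
    (by cases j <;> simp) (by simp)).1 (hrow p j)
  obtain ⟨T', π, hπ, y, hy⟩ := hrow (x ≫ proj N F K n p j) hx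
  cases j with
  | zero =>
    have h0 : (F.obj (K.X p)).d (0 - 1) 0 = 0 := (F.obj (K.X p)).shape _ _ (by simp)
    exact ⟨T', π, hπ, 0, by simp, by rw [hy, h0]; simp⟩
  | succ j =>
    obtain ⟨x', hx', hx'j⟩ : ∃ x' : T' ⟶ X N F K m,
        (∀ q ≠ j, ∀ p', x' ≫ proj N F K m p' q = 0) ∧
          x' ≫ proj N F K m p j = (p.negOnePow : ℤ) • y :=
      ⟨((p.negOnePow : ℤ) • y) ≫ incl N F K m p j,
        fun q hq p' => by rw [Category.assoc, incl_proj_ne hq.symm, comp_zero],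
        by rw [Category.assoc, incl_proj_self (by omega) (by push_cast at hp; omega)]
           exact Category.comp_id _⟩
    refine ⟨T', π, hπ, x', fun q hq p' => ?_, ?_⟩
    · by_cases h : q < N + 1 ∧ p' + q = n
      · rw [Category.assoc, comp_d_proj_of_forall_ne _ hx' (by omega) h.1 h.2,
          hx' (q - 1) (by omega), zero_comp, smul_zero]
      · rw [proj_eq_zero h, comp_zero]
    · rw [Category.assoc, comp_d_proj_of_forall_ne _ hx' j.lt_succ_self hj hp,
        show j + 1 - 1 = j from rfl, hx'j, hy, Preadditive.zsmul_comp,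
        negOnePow_smul_negOnePow_smul]
      rfl

variable [F.Additive]

lemma exists_refinement_of_acyclic_rows (hrow : ∀ p, (F.obj (K.X p)).Acyclic)
    (hN : ∀ p, IsZero ((F.obj (K.X p)).X (N + 1))) {m n o : ℤ} (hmn : m + 1 = n) (hno : n + 1 = o)
    (x : T ⟶ X N F K n) (hx : x ≫ d N F K n o = 0) {j : ℕ} (hj : j ≤ N + 1) :
    ∃ (T' : D) (π : T' ⟶ T) (_ : Epi π) (x' : T' ⟶ X N F K m),
      ∀ q, j ≤ q → ∀ p, (π ≫ x - x' ≫ d N F K m n) ≫ proj N F K n p q = 0 := by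
  induction hj using Nat.decreasingInduction with
  | self => exact ⟨T, 𝟙 T, inferInstance, 0, fun q hq p => by
      rw [proj_eq_zero (by omega), comp_zero]⟩
  | of_succ j hj ih =>
    obtain ⟨T₁, π₁, _, x₁, h₁⟩ := ih
    have hd : (π₁ ≫ x - x₁ ≫ d N F K m n) ≫ d N F K n o = 0 := by
      rw [Preadditive.sub_comp, Category.assoc, Category.assoc, hx,
        show d N F K m n ≫ d N F K n o = 0 from (obj N F K).d_comp_d m n o, comp_zero, comp_zero,
        sub_zero]
    obtain ⟨T₂, π₂, _, x₂, h₂, h₂'⟩ := exists_refinement_proj_eq hrow hmn _ hj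
      (sub_add_cancel n (j : ℤ)) (comp_proj_d_eq_zero_of_forall_gt hN hno _ hd hj (by omega) h₁)
    refine ⟨T₂, π₂ ≫ π₁, inferInstance, π₂ ≫ x₁ + x₂, fun q hq p => ?_⟩
    have hsub : (π₂ ≫ π₁) ≫ x - (π₂ ≫ x₁ + x₂) ≫ d N F K m n =
        π₂ ≫ (π₁ ≫ x - x₁ ≫ d N F K m n) - x₂ ≫ d N F K m n := by
      simp only [Preadditive.comp_sub, Preadditive.add_comp, Category.assoc]
      abel
    rw [hsub, Preadditive.sub_comp, Category.assoc]
    rcases hq.eq_or_lt with rfl | hq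
    · by_cases hp : j < N + 1 ∧ p + j = n
      · obtain rfl : p = n - j := by omega
        rw [h₂', sub_self]
      · rw [proj_eq_zero hp, comp_zero, comp_zero, comp_zero, sub_zero]
    · rw [h₁ q hq, h₂ q hq, comp_zero, sub_zero]

lemma acyclic_of_acyclic_rows (hrow : ∀ p, (F.obj (K.X p)).Acyclic)
    (hN : ∀ p, IsZero ((F.obj (K.X p)).X (N + 1))) : (obj N F K).Acyclic := fun n => by
  rw [(obj N F K).exactAt_iff_exact_up_to_refinements (n - 1) n (n + 1) (by simp) (by simp)]
  intro T x hx
  obtain ⟨T', π, hπ, x', h⟩ := exists_refinement_of_acyclic_rows hrow hN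
    (sub_add_cancel n 1) rfl x hx (Nat.zero_le _)
  refine ⟨T', π, hπ, x', sub_eq_zero.1 (hom_ext fun p q _ _ => ?_)⟩
  exact (h q (Nat.zero_le _) p).trans zero_comp.symm

end AcyclicRows

section Functoriality

variable {B C D : Type*} [Category B] [Category C] [Category D] [Abelian B] [Abelian C] [Abelian D]
  (N : ℕ)

section NatTrans

variable {F G H : C ⥤ CochainComplex D ℕ}

/-- The map of the terms of total complexes induced by a natural transformation. -/
def natTransX (τ : F ⟶ G) (K : CochainComplex C ℤ) (n : ℤ) : X N F K n ⟶ X N G K n :=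
  lift N G K n fun p q => proj N F K n p q ≫ (τ.app (K.X p)).f q

variable {N} in
lemma natTransX_proj (τ : F ⟶ G) (K : CochainComplex C ℤ) (n p : ℤ) (q : ℕ) :
    natTransX N τ K n ≫ proj N G K n p q = proj N F K n p q ≫ (τ.app (K.X p)).f q := by
  by_cases h : q < N + 1 ∧ p + q = n
  · exact lift_proj _ h.1 h.2
  · rw [proj_eq_zero h, proj_eq_zero h, comp_zero, zero_comp]

variable [F.Additive] [G.Additive] [H.Additive]

/-- The map of total complexes induced by a natural transformation. -/
def natTrans (τ : F ⟶ G) : functor N F ⟶ functor N G where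
  app K :=
    { f := natTransX N τ K
      comm' := fun n n' _ => by
        refine hom_ext fun p q hq hn => ?_
        change (natTransX N τ K n ≫ d N G K n n') ≫ _ = (d N F K n n' ≫ natTransX N τ K n') ≫ _
        rw [Category.assoc, Category.assoc, d_proj hq hn, natTransX_proj, d_proj_assoc hq hn,
          Preadditive.comp_add, Preadditive.comp_zsmul, reassoc_of% natTransX_proj τ K n (p - 1) q,
          reassoc_of% natTransX_proj τ K n p (q - 1)]
        simp only [Preadditive.add_comp, Preadditive.zsmul_comp, Category.assoc,
          ← HomologicalComplex.comp_f, NatTrans.naturality, HomologicalComplex.Hom.comm] }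
  naturality K L φ := by
    ext n : 1
    refine hom_ext fun p q _ _ => ?_
    change (mapX N F φ n ≫ natTransX N τ L n) ≫ _ = (natTransX N τ K n ≫ mapX N G φ n) ≫ _
    rw [Category.assoc, Category.assoc, mapX_proj, natTransX_proj, mapX_proj_assoc,
      reassoc_of% natTransX_proj τ K n p q]
    simp only [← HomologicalComplex.comp_f, NatTrans.naturality]

lemma natTrans_comp (τ : F ⟶ G) (σ : G ⟶ H) :
    natTrans N (τ ≫ σ) = natTrans N τ ≫ natTrans N σ := by
  ext K n : 4
  refine hom_ext fun p q _ _ => ?_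
  change natTransX N (τ ≫ σ) K n ≫ _ = (natTransX N τ K n ≫ natTransX N σ K n) ≫ _
  rw [Category.assoc, natTransX_proj, natTransX_proj, reassoc_of% natTransX_proj τ K n p q]
  rfl

variable (F) in
lemma natTrans_id : natTrans N (𝟙 F) = 𝟙 _ := by
  ext K n : 4
  refine hom_ext fun p q _ _ => ?_
  change natTransX N (𝟙 F) K n ≫ _ = 𝟙 (X N F K n) ≫ _
  rw [natTransX_proj, Category.id_comp]
  exact Category.comp_id _

/-- The isomorphism of total complexes induced by an isomorphism of functors. -/
def natIso (e : F ≅ G) : functor N F ≅ functor N G where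
  hom := natTrans N e.hom
  inv := natTrans N e.inv
  hom_inv_id := by rw [← natTrans_comp, e.hom_inv_id, natTrans_id]
  inv_hom_id := by rw [← natTrans_comp, e.inv_hom_id, natTrans_id]

end NatTrans

/-- The total complex of `F(G(K))`. -/
def precompIso (G : B ⥤ C) [G.Additive] (F : C ⥤ CochainComplex D ℕ) [F.Additive] :
    G.mapHomologicalComplex (ComplexShape.up ℤ) ⋙ functor N F ≅ functor N (G ⋙ F) :=
  NatIso.ofComponents (fun _ => Iso.refl _) (fun _ =>
    (Category.comp_id _).trans (Category.id_comp _).symm)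

section Postcomp

variable {N} (F : B ⥤ CochainComplex C ℕ) (G : C ⥤ D) [G.Additive]

/-- The comparison of `G(Tot F(K))` with `Tot G(F(K))` in degree `n`. -/
def postcompX (K : CochainComplex B ℤ) (n : ℤ) :
    G.obj (X N F K n) ⟶ X N (F ⋙ G.mapHomologicalComplex _) K n :=
  lift N (F ⋙ G.mapHomologicalComplex _) K n fun p q => G.map (proj N F K n p q)

lemma postcompX_proj (K : CochainComplex B ℤ) (n p : ℤ) (q : ℕ) :
    postcompX F G K n ≫ proj N (F ⋙ G.mapHomologicalComplex _) K n p q =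
      G.map (proj N F K n p q) := by
  by_cases h : q < N + 1 ∧ p + q = n
  · exact lift_proj _ h.1 h.2
  · rw [proj_eq_zero h, proj_eq_zero h, comp_zero, G.map_zero]
    rfl

lemma isIso_postcompX (K : CochainComplex B ℤ) (n : ℤ) : IsIso (postcompX (N := N) F G K n) := by
  let Y : Idx N n → C := fun i => (F.obj (K.X i.1.1)).X i.1.2
  have h : (postcompX F G K n : G.obj (⨁ Y) ⟶ ⨁ G.obj ∘ Y) = (G.mapBiproduct Y).hom := by
    rw [Functor.mapBiproduct_hom]
    exact congrArg biproduct.lift (funext fun i => congrArg G.map (proj_eq_π i.1.2.2 i.2))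
  have hiso : IsIso (postcompX F G K n : G.obj (⨁ Y) ⟶ ⨁ G.obj ∘ Y) :=
    h ▸ (G.mapBiproduct Y).isIso_hom
  exact hiso

lemma postcompX_d (K : CochainComplex B ℤ) (n n' : ℤ) :
    postcompX F G K n ≫ d N (F ⋙ G.mapHomologicalComplex _) K n n' =
      G.map (d N F K n n') ≫ postcompX F G K n' := by
  refine hom_ext fun p q hq hn => ?_
  rw [Category.assoc, Category.assoc, postcompX_proj, d_proj hq hn, Preadditive.comp_add,
    Preadditive.comp_zsmul, reassoc_of% postcompX_proj F G K n (p - 1) q,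
    reassoc_of% postcompX_proj F G K n p (q - 1)]
  have h := congrArg G.map (d_proj (N := N) (F := F) (K := K) (n := n) hq hn)
  rw [G.map_comp, G.map_add, G.map_zsmul, G.map_comp, G.map_comp] at h
  exact h.symm

lemma postcompX_naturality {K L : CochainComplex B ℤ} (φ : K ⟶ L) (n : ℤ) :
    G.map (mapX N F φ n) ≫ postcompX F G L n =
      postcompX F G K n ≫ mapX N (F ⋙ G.mapHomologicalComplex _) φ n := by
  refine hom_ext fun p q _ _ => ?_
  rw [Category.assoc, Category.assoc, postcompX_proj, mapX_proj,
    reassoc_of% postcompX_proj F G K n p q]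
  have h := congrArg G.map (mapX_proj (N := N) (F := F) φ n p q)
  rw [G.map_comp, G.map_comp] at h
  exact h

variable (N)

/-- The total complex commutes with additive functors. -/
def postcompIso [F.Additive] :
    functor N F ⋙ G.mapHomologicalComplex (ComplexShape.up ℤ) ≅
      functor N (F ⋙ G.mapHomologicalComplex (ComplexShape.up ℕ)) :=
  NatIso.ofComponents
    (fun K => HomologicalComplex.Hom.isoOfComponents (fun n =>
      @asIso _ _ _ _ (postcompX F G K n) (isIso_postcompX F G K n))
      (fun n n' _ => postcompX_d F G K n n'))
    (fun φ => HomologicalComplex.hom_ext _ _ fun n => postcompX_naturality F G φ n)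

end Postcomp

end Functoriality

/-- An augmentation of a functor `F` to cochain complexes in non-negative degrees: natural maps
`X ⟶ F(X)⁰` which make `X ⟶ F(X)⁰ ⟶ F(X)¹ ⟶ ⋯` a complex. -/
structure Augmentation {C : Type*} [Category C] [HasZeroMorphisms C]
    (F : C ⥤ CochainComplex C ℕ) where
  ι (X : C) : X ⟶ (F.obj X).X 0
  naturality {X Y : C} (f : X ⟶ Y) : f ≫ ι Y = ι X ≫ (F.map f).f 0
  ι_d (X : C) : ι X ≫ (F.obj X).d 0 1 = 0

namespace Augmentation

section Augmented

variable {C : Type*} [Category C] [Preadditive C] {F : C ⥤ CochainComplex C ℕ}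
  (a : Augmentation F)

/-- The components of the map of augmented complexes induced by a morphism. -/
def augmentedMap {X Y : C} (f : X ⟶ Y) : ∀ q : ℕ,
    ((F.obj X).augment (a.ι X) (a.ι_d X)).X q ⟶ ((F.obj Y).augment (a.ι Y) (a.ι_d Y)).X q
  | 0 => f
  | q + 1 => (F.map f).f q

/-- The functor sending `X` to the augmented complex `X ⟶ F(X)⁰ ⟶ F(X)¹ ⟶ ⋯`. -/
def augmented : C ⥤ CochainComplex C ℕ where
  obj X := (F.obj X).augment (a.ι X) (a.ι_d X)
  map {X Y} f :=
    { f := a.augmentedMap f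
      comm' := by
        rintro i _ rfl
        match i with
        | 0 => exact a.naturality f
        | i + 1 => exact (F.map f).comm i (i + 1) }
  map_id X := by
    ext q
    match q with
    | 0 => rfl
    | q + 1 => exact congrArg (fun k => HomologicalComplex.Hom.f k q) (F.map_id X)
  map_comp f g := by
    ext q
    match q with
    | 0 => rfl
    | q + 1 => exact congrArg (fun k => HomologicalComplex.Hom.f k q) (F.map_comp f g)

instance [F.Additive] : a.augmented.Additive where
  map_add {X Y f g} := by
    ext q
    match q with
    | 0 => rfl
    | q + 1 => exact congrArg (fun k => HomologicalComplex.Hom.f k q) (F.map_add (f := f) (g := g))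

/-- The term of degree `0` of the augmented complex. -/
def zeroIso (X : C) : X ≅ (a.augmented.obj X).X 0 := Iso.refl X

/-- The terms of positive degree of the augmented complex. -/
def succIso (X : C) (q : ℕ) : (F.obj X).X q ≅ (a.augmented.obj X).X (q + 1) :=
  Iso.refl ((F.obj X).X q)

lemma zeroIso_hom_naturality {X Y : C} (f : X ⟶ Y) :
    f ≫ (a.zeroIso Y).hom = (a.zeroIso X).hom ≫ (a.augmented.map f).f 0 :=
  (Category.comp_id f).trans (Category.id_comp f).symm

lemma succIso_hom_naturality {X Y : C} (f : X ⟶ Y) (q : ℕ) :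
    (F.map f).f q ≫ (a.succIso Y q).hom = (a.succIso X q).hom ≫ (a.augmented.map f).f (q + 1) :=
  (Category.comp_id ((F.map f).f q)).trans (Category.id_comp ((F.map f).f q)).symm

lemma zeroIso_hom_d (X : C) :
    (a.zeroIso X).hom ≫ (a.augmented.obj X).d 0 1 = a.ι X ≫ (a.succIso X 0).hom :=
  (Category.id_comp (a.ι X)).trans (Category.comp_id (a.ι X)).symm

lemma succIso_hom_d (X : C) (q : ℕ) :
    (a.succIso X q).hom ≫ (a.augmented.obj X).d (q + 1) (q + 2) =
      (F.obj X).d q (q + 1) ≫ (a.succIso X (q + 1)).hom :=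
  (Category.id_comp ((F.obj X).d q (q + 1))).trans (Category.comp_id ((F.obj X).d q (q + 1))).symm

end Augmented

variable {C : Type*} [Category C] [Abelian C] {F : C ⥤ CochainComplex C ℕ}
  (a : Augmentation F) (N : ℕ) {K : CochainComplex C ℤ}

section Unit

variable (K) in
/-- The map `K ⟶ Tot F(K)` in degree `n`. -/
def unitX (n : ℤ) : K.X n ⟶ X N F K n := a.ι (K.X n) ≫ incl N F K n n 0

variable {N}

lemma unitX_proj_zero (n : ℤ) : a.unitX N K n ≫ proj N F K n n 0 = a.ι (K.X n) := by
  rw [unitX, Category.assoc, incl_proj_self (Nat.succ_pos N) (by simp), Category.comp_id]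

lemma unitX_proj_succ (n p : ℤ) (q : ℕ) : a.unitX N K n ≫ proj N F K n p (q + 1) = 0 := by
  rw [unitX, Category.assoc, incl_proj_ne q.succ_ne_zero.symm, comp_zero]

lemma unitX_naturality {L : CochainComplex C ℤ} (φ : K ⟶ L) (n : ℤ) :
    φ.f n ≫ a.unitX N L n = a.unitX N K n ≫ mapX N F φ n := by
  refine hom_ext fun p q _ hn => ?_
  rw [Category.assoc, Category.assoc, mapX_proj]
  cases q with
  | zero =>
    obtain rfl : p = n := by simpa using hn
    rw [unitX_proj_zero, reassoc_of% a.unitX_proj_zero p, a.naturality]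
  | succ q => rw [unitX_proj_succ, comp_zero, reassoc_of% a.unitX_proj_succ n p q, zero_comp]

lemma unitX_d {n n' : ℤ} (h : n + 1 = n') :
    a.unitX N K n ≫ d N F K n n' = K.d n n' ≫ a.unitX N K n' := by
  refine hom_ext fun p q hq hn => ?_
  rw [Category.assoc, Category.assoc, d_proj hq hn, Preadditive.comp_add,
    Preadditive.comp_zsmul]
  match q with
  | 0 =>
    obtain rfl : p = n' := by simpa using hn
    obtain rfl : n = p - 1 := by omega
    rw [unitX_proj_zero, reassoc_of% a.unitX_proj_zero, (F.obj (K.X p)).shape _ _ (by simp),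
      comp_zero, comp_zero, smul_zero, add_zero, a.naturality]
  | 1 =>
    obtain rfl : p = n := by push_cast at hn; omega
    rw [unitX_proj_succ, comp_zero, reassoc_of% a.unitX_proj_succ, zero_comp, zero_add,
      reassoc_of% a.unitX_proj_zero, a.ι_d, smul_zero]
  | q + 2 =>
    rw [unitX_proj_succ, comp_zero, reassoc_of% a.unitX_proj_succ, zero_comp, zero_add,
      show q + 2 - 1 = q + 1 from rfl, reassoc_of% a.unitX_proj_succ, zero_comp, smul_zero]

variable (N) [F.Additive]

/-- The natural map `K ⟶ Tot F(K)`. -/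
def unit : 𝟭 (CochainComplex C ℤ) ⟶ functor N F where
  app K :=
    { f := a.unitX N K
      comm' := fun _ _ h => a.unitX_d h }
  naturality _ _ φ := by
    ext n : 1
    exact a.unitX_naturality φ n

end Unit

section Cone

variable (K) in
/-- The inclusion of `K^n` in the total complex of the augmented complexes. -/
def inl (n : ℤ) : K.X n ⟶ X N a.augmented K n :=
  (a.zeroIso (K.X n)).hom ≫ incl N a.augmented K n n 0

variable (K) in
/-- The components of `Augmentation.inr`. -/
def inrAux (m p : ℤ) : ∀ q : ℕ, X N F K m ⟶ (a.augmented.obj (K.X p)).X q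
  | 0 => 0
  | q + 1 => (m.negOnePow : ℤ) • proj N F K m p q ≫ (a.succIso (K.X p) q).hom

variable (K) in
/-- The map from `Tot F(K)` to the total complex of the augmented complexes, of degree `1`. The sign
makes it anticommute with the differentials. -/
def inr (m n : ℤ) : X N F K m ⟶ X N a.augmented K n :=
  lift N a.augmented K n (a.inrAux N K m)

variable {N}

lemma inl_proj_zero (n : ℤ) :
    a.inl N K n ≫ proj N a.augmented K n n 0 = (a.zeroIso (K.X n)).hom := by
  rw [inl, Category.assoc, incl_proj_self (Nat.succ_pos N) (by simp), Category.comp_id]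

lemma inl_proj_succ (n p : ℤ) (q : ℕ) :
    a.inl N K n ≫ proj N a.augmented K n p (q + 1) = 0 := by
  rw [inl, Category.assoc, incl_proj_ne q.succ_ne_zero.symm, comp_zero]

lemma inr_proj_zero (m n p : ℤ) : a.inr N K m n ≫ proj N a.augmented K n p 0 = 0 := by
  by_cases h : 0 < N + 1 ∧ p + (0 : ℕ) = n
  · exact lift_proj _ h.1 h.2
  · rw [proj_eq_zero h, comp_zero]

lemma inr_proj_succ (m : ℤ) {n p : ℤ} {q : ℕ} (hq : q + 1 < N + 1) (h : p + (q + 1 : ℕ) = n) :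
    a.inr N K m n ≫ proj N a.augmented K n p (q + 1) =
      (m.negOnePow : ℤ) • proj N F K m p q ≫ (a.succIso (K.X p) q).hom :=
  lift_proj _ hq h

lemma exists_eq_inl_add_inr {T : C} {m n : ℤ} (hmn : m + 1 = n) (z : T ⟶ X N a.augmented K n) :
    ∃ (x : T ⟶ K.X n) (y : T ⟶ X N F K m), z = x ≫ a.inl N K n + y ≫ a.inr N K m n := by
  refine ⟨z ≫ proj N a.augmented K n n 0 ≫ (a.zeroIso (K.X n)).inv,
    lift N F K m fun p q => (m.negOnePow : ℤ) •
      z ≫ proj N a.augmented K n p (q + 1) ≫ (a.succIso (K.X p) q).inv,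
    hom_ext fun p q hq hn => ?_⟩
  rw [Preadditive.add_comp, Category.assoc, Category.assoc _ (a.inr N K m n)]
  cases q with
  | zero =>
    obtain rfl : p = n := by simpa using hn
    rw [inr_proj_zero, comp_zero, add_zero, inl_proj_zero, Category.assoc, Category.assoc,
      Iso.inv_hom_id, Category.comp_id]
  | succ q =>
    rw [inl_proj_succ, comp_zero, zero_add, inr_proj_succ a m hq hn, Preadditive.comp_zsmul,
      ← Category.assoc, lift_proj _ (by omega) (by push_cast at hn; omega),
      Preadditive.zsmul_comp, negOnePow_smul_negOnePow_smul, Category.assoc, Category.assoc,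
      Iso.inv_hom_id, Category.comp_id]

lemma inl_add_inr_injective (hN : ∀ p, IsZero ((F.obj (K.X p)).X N)) {T : C} {m n : ℤ}
    (hmn : m + 1 = n) {x x' : T ⟶ K.X n} {y y' : T ⟶ X N F K m}
    (h : x ≫ a.inl N K n + y ≫ a.inr N K m n = x' ≫ a.inl N K n + y' ≫ a.inr N K m n) :
    x = x' ∧ y = y' := by
  have hproj := fun p q => congrArg (· ≫ proj N a.augmented K n p q) h
  simp only [Preadditive.add_comp, Category.assoc] at hproj
  refine ⟨?_, hom_ext fun p q hq hm => ?_⟩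
  · simpa only [inl_proj_zero, inr_proj_zero, comp_zero, add_zero, cancel_mono] using hproj n 0
  · by_cases hqN : q = N
    · subst hqN
      exact (hN p).eq_of_tgt _ _
    · have := hproj p (q + 1)
      rw [inl_proj_succ, inr_proj_succ a m (by omega) (by push_cast; omega), comp_zero, zero_add,
        comp_zero, zero_add, Preadditive.comp_zsmul, Preadditive.comp_zsmul] at this
      simpa only [negOnePow_smul_negOnePow_smul, ← Category.assoc, cancel_mono] using
        congrArg ((m.negOnePow : ℤ) • ·) this

lemma inl_d {n o : ℤ} (hno : n + 1 = o) :
    a.inl N K n ≫ d N a.augmented K n o =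
      K.d n o ≫ a.inl N K o + a.unitX N K n ≫ a.inr N K n o := by
  refine hom_ext fun p q hq hn => ?_
  rw [Category.assoc, d_proj hq hn, Preadditive.comp_add, Preadditive.add_comp, Category.assoc,
    Category.assoc, Preadditive.comp_zsmul]
  match q with
  | 0 =>
    obtain rfl : p = o := by simpa using hn
    obtain rfl : n = p - 1 := by omega
    rw [inr_proj_zero, comp_zero, add_zero, (a.augmented.obj (K.X p)).shape _ _ (by simp),
      comp_zero, comp_zero, smul_zero, add_zero, reassoc_of% a.inl_proj_zero, inl_proj_zero,
      a.zeroIso_hom_naturality]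
  | 1 =>
    obtain rfl : p = n := by push_cast at hn; omega
    rw [inr_proj_succ (q := 0) a p hq hn, inl_proj_succ, comp_zero, zero_add,
      reassoc_of% a.inl_proj_succ, zero_comp, zero_add, Preadditive.comp_zsmul,
      reassoc_of% a.unitX_proj_zero, ← a.zeroIso_hom_d, reassoc_of% a.inl_proj_zero]
  | q + 2 =>
    rw [inr_proj_succ (q := q + 1) a n hq hn, inl_proj_succ, comp_zero, zero_add,
      reassoc_of% a.inl_proj_succ, zero_comp, zero_add, Preadditive.comp_zsmul,
      reassoc_of% a.unitX_proj_succ, show q + 2 - 1 = q + 1 from rfl,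
      reassoc_of% a.inl_proj_succ, zero_comp, smul_zero, zero_comp, smul_zero]

lemma inr_d {m n o : ℤ} (hmn : m + 1 = n) (hno : n + 1 = o) :
    a.inr N K m n ≫ d N a.augmented K n o = -(d N F K m n ≫ a.inr N K n o) := by
  refine hom_ext fun p q hq hn => ?_
  rw [Category.assoc, d_proj hq hn, Preadditive.comp_add, Preadditive.neg_comp, Category.assoc,
    Preadditive.comp_zsmul]
  cases q with
  | zero =>
    rw [inr_proj_zero, comp_zero, neg_zero, (a.augmented.obj (K.X p)).shape _ _ (by simp),
      comp_zero, comp_zero, smul_zero, add_zero, reassoc_of% a.inr_proj_zero, zero_comp]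
  | succ q =>
    have hsign : (n.negOnePow : ℤ) = -(m.negOnePow : ℤ) := by
      rw [← hmn, Int.negOnePow_add, Int.negOnePow_one]; simp
    rw [inr_proj_succ a n hq hn, Preadditive.comp_zsmul,
      d_proj_assoc (by omega) (by push_cast at hn; omega), ← Category.assoc,
      inr_proj_succ a m hq (by push_cast at hn ⊢; omega), hsign, neg_smul, neg_neg,
      Preadditive.add_comp, smul_add, Preadditive.zsmul_comp, Preadditive.zsmul_comp,
      Category.assoc, Category.assoc, a.succIso_hom_naturality, smul_comm (m.negOnePow : ℤ)]
    refine congrArg₂ (· + ·) rfl (congrArg _ ?_)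
    cases q with
    | zero =>
      rw [Nat.sub_self, reassoc_of% a.inr_proj_zero, zero_comp,
        (F.obj (K.X p)).shape _ _ (by simp), comp_zero, zero_comp, smul_zero]
    | succ q =>
      rw [Nat.add_sub_cancel, Nat.add_sub_cancel, ← Category.assoc,
        inr_proj_succ a m (by omega) (by push_cast at hn ⊢; omega), Preadditive.zsmul_comp,
        Category.assoc, Category.assoc, a.succIso_hom_d]

lemma inl_add_inr_comp_d {T : C} {m n o : ℤ} (hmn : m + 1 = n) (hno : n + 1 = o) (x : T ⟶ K.X n)
    (y : T ⟶ X N F K m) :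
    (x ≫ a.inl N K n + y ≫ a.inr N K m n) ≫ d N a.augmented K n o =
      (x ≫ K.d n o) ≫ a.inl N K o +
        (x ≫ a.unitX N K n - y ≫ d N F K m n) ≫ a.inr N K n o := by
  rw [Preadditive.add_comp, Category.assoc, Category.assoc, a.inl_d hno, a.inr_d hmn hno]
  simp only [Preadditive.comp_add, Preadditive.comp_neg, Preadditive.sub_comp, Category.assoc]
  abel

variable (N) [F.Additive]

lemma acyclic_of_quasiIso_unit (hN : ∀ p, IsZero ((F.obj (K.X p)).X N))
    (h : QuasiIso ((a.unit N).app K)) : (obj N a.augmented K).Acyclic := fun n => by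
  rw [(obj N a.augmented K).exactAt_iff_exact_up_to_refinements (n - 1) n (n + 1)
    (by simp) (by simp)]
  intro T z hz
  obtain ⟨x, y, rfl⟩ := a.exists_eq_inl_add_inr (sub_add_cancel n 1) z
  obtain ⟨hx, hxy⟩ : x ≫ K.d n (n + 1) = 0 ∧
      x ≫ a.unitX N K n - y ≫ d N F K (n - 1) n = 0 :=
    a.inl_add_inr_injective hN rfl
      (((a.inl_add_inr_comp_d (sub_add_cancel n 1) rfl x y).symm.trans hz).trans
        (by simp only [zero_comp, add_zero]; rfl))
  obtain ⟨T', π, hπ, x', y', ex, ey⟩ := (quasiIso_iff_coneAcyclic _).1 h (n - 1 - 1) (n - 1) n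
    (n + 1) (by omega) (by omega) rfl x y hx (sub_eq_zero.1 hxy)
  refine ⟨T', π, hπ, x' ≫ a.inl N K (n - 1) + (-y') ≫ a.inr N K (n - 1 - 1) (n - 1), ?_⟩
  change T' ⟶ K.X (n - 1) at x'
  change T' ⟶ X N F K (n - 1 - 1) at y'
  have ex : π ≫ x = x' ≫ K.d (n - 1) n := ex
  have ey : π ≫ y = x' ≫ a.unitX N K (n - 1) + y' ≫ d N F K (n - 1 - 1) (n - 1) := ey
  have e := a.inl_add_inr_comp_d (sub_add_cancel (n - 1) 1) (sub_add_cancel n 1) x' (-y')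
  rw [← ex, Preadditive.neg_comp y' (d N F K _ _), sub_neg_eq_add, ← ey, Category.assoc,
    Category.assoc, ← Preadditive.comp_add] at e
  exact e.symm

lemma quasiIso_unit_of_acyclic (hN : ∀ p, IsZero ((F.obj (K.X p)).X N))
    (h : (obj N a.augmented K).Acyclic) : QuasiIso ((a.unit N).app K) := by
  rw [quasiIso_iff_coneAcyclic]
  intro T l m n o hlm hmn hno x y hx hxy
  change T ⟶ K.X n at x
  change T ⟶ X N F K m at y
  have hz : (x ≫ a.inl N K n + y ≫ a.inr N K m n) ≫ d N a.augmented K n o = 0 := by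
    have hx : x ≫ K.d n o = 0 := hx
    have hxy : x ≫ a.unitX N K n = y ≫ d N F K m n := hxy
    rw [a.inl_add_inr_comp_d hmn hno, hx, hxy, sub_self, zero_comp, zero_comp, add_zero]
  obtain ⟨T', π, hπ, z', e⟩ := ((obj N a.augmented K).exactAt_iff_exact_up_to_refinements m n o
    ((ComplexShape.up ℤ).prev_eq' hmn) ((ComplexShape.up ℤ).next_eq' hno)).1 (h n) _ hz
  obtain ⟨x', y', rfl⟩ := a.exists_eq_inl_add_inr hlm z'
  have e : (π ≫ x) ≫ a.inl N K n + (π ≫ y) ≫ a.inr N K m n =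
      (x' ≫ K.d m n) ≫ a.inl N K n +
        (x' ≫ a.unitX N K m - y' ≫ d N F K l m) ≫ a.inr N K m n := by
    rw [Category.assoc, Category.assoc, ← Preadditive.comp_add]
    exact e.trans (a.inl_add_inr_comp_d hlm hmn x' y')
  obtain ⟨ex, ey⟩ := a.inl_add_inr_injective hN hmn e
  refine ⟨T', π, hπ, x', -y', ex, ey.trans ?_⟩
  rw [sub_eq_add_neg, ← Preadditive.neg_comp]
  rfl

lemma quasiIso_unit_app_iff (hN : ∀ p, IsZero ((F.obj (K.X p)).X N)) :
    QuasiIso ((a.unit N).app K) ↔ (obj N a.augmented K).Acyclic :=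
  ⟨a.acyclic_of_quasiIso_unit N hN, a.quasiIso_unit_of_acyclic N hN⟩

lemma quasiIso_unit_app_of_acyclic_rows (hN : ∀ p, IsZero ((F.obj (K.X p)).X N))
    (hrow : ∀ p, (a.augmented.obj (K.X p)).Acyclic) : QuasiIso ((a.unit N).app K) :=
  a.quasiIso_unit_of_acyclic N hN
    (acyclic_of_acyclic_rows hrow fun p => (hN p).of_iso (a.succIso _ _).symm)

end Cone

end Augmentation

lemma isZero_obj_biproduct {C D : Type*} [Category C] [Category D] [Preadditive C] [Preadditive D]
    (H : C ⥤ D) [H.Additive] {J : Type} [Finite J] (f : J → C) [HasBiproduct f]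
    (h : ∀ j, IsZero (H.obj (f j))) : IsZero (H.obj (⨁ f)) := by
  classical
  have := Fintype.ofFinite J
  rw [IsZero.iff_id_eq_zero, ← H.map_id, ← biproduct.total (f := f), H.map_sum]
  refine Finset.sum_eq_zero fun j _ => ?_
  rw [H.map_comp, (h j).eq_of_tgt (H.map (biproduct.π f j)) 0, zero_comp]

variable {C Q : Type*} [Category C] [Category Q] [Abelian C] [Abelian Q]

/-- A functorial finite resolution `Y ⟶ φ(E(Y)⁰) ⟶ φ(E(Y)¹) ⟶ ⋯` of the objects of `Q` by
objects `φ(M)` where `M` is such that the natural complex `M ⟶ E(φ(M))⁰ ⟶ E(φ(M))¹ ⟶ ⋯` is exact.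
The functor `Y ↦ Tot E(Y)` is then right adjoint to `φ` on derived categories. -/
structure Resolution (φ : C ⥤ Q) [φ.Additive] (N : ℕ) where
  E : Q ⥤ CochainComplex C ℕ
  [additive_E : E.Additive]
  exact_E (q : ℕ) (S : ShortComplex Q) : S.Exact →
    (S.map (E ⋙ HomologicalComplex.eval C (ComplexShape.up ℕ) q)).Exact
  isZero_E (Y : Q) : IsZero ((E.obj Y).X N)
  ε : Augmentation (φ ⋙ E)
  acyclic_ε (Y : Q) (q : ℕ) : (ε.augmented.obj ((E.obj Y).X q)).Acyclic
  θ : Augmentation (E ⋙ φ.mapHomologicalComplex (ComplexShape.up ℕ))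
  θ_obj (M : C) : θ.ι (φ.obj M) = φ.map (ε.ι M)
  acyclic_θ (Y : Q) : (θ.augmented.obj Y).Acyclic

namespace Resolution

variable {φ : C ⥤ Q} [φ.Additive] {N : ℕ} (ρ : Resolution φ N)

instance : ρ.E.Additive := ρ.additive_E

/-- The natural map `K ⟶ Tot E(φ(K))` for complexes in `C`. -/
def unit : 𝟭 (CochainComplex C ℤ) ⟶
    φ.mapHomologicalComplex (ComplexShape.up ℤ) ⋙ functor N ρ.E :=
  ρ.ε.unit N ≫ (precompIso N φ ρ.E).inv

/-- The natural map `Z ⟶ φ(Tot E(Z))` for complexes in `Q`. It induces the inverse of the counit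
on derived categories. -/
def counitInv : 𝟭 (CochainComplex Q ℤ) ⟶
    functor N ρ.E ⋙ φ.mapHomologicalComplex (ComplexShape.up ℤ) :=
  ρ.θ.unit N ≫ (postcompIso N ρ.E φ).inv

lemma quasiIso_unit_app_iff (K : CochainComplex C ℤ) :
    QuasiIso (ρ.unit.app K) ↔ (obj N ρ.ε.augmented K).Acyclic := by
  rw [← ρ.ε.quasiIso_unit_app_iff N fun p => ρ.isZero_E _]
  exact quasiIso_iff_comp_right ((ρ.ε.unit N).app K) ((precompIso N φ ρ.E).inv.app K)

lemma quasiIso_counitInv_app (Z : CochainComplex Q ℤ) : QuasiIso (ρ.counitInv.app Z) := by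
  have : QuasiIso ((ρ.θ.unit N).app Z) := ρ.θ.quasiIso_unit_app_of_acyclic_rows N
    (fun p => φ.map_isZero (ρ.isZero_E _)) fun p => ρ.acyclic_θ _
  exact quasiIso_comp ((ρ.θ.unit N).app Z) ((postcompIso N ρ.E φ).inv.app Z)

lemma acyclic_augmented_obj_X (Z : CochainComplex Q ℤ) (n : ℤ) :
    (ρ.ε.augmented.obj ((obj N ρ.E Z).X n)).Acyclic := by
  intro q
  rw [HomologicalComplex.exactAt_iff_isZero_homology]
  refine isZero_obj_biproduct (ρ.ε.augmented ⋙ HomologicalComplex.homologyFunctor C _ q)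
    (fun i : Idx N n => (ρ.E.obj (Z.X i.1.1)).X i.1.2) fun i => ?_
  exact (HomologicalComplex.exactAt_iff_isZero_homology _ _).1 (ρ.acyclic_ε (Z.X i.1.1) i.1.2 q)

lemma quasiIso_unit_app_obj (Z : CochainComplex Q ℤ) :
    QuasiIso (ρ.unit.app ((functor N ρ.E).obj Z)) :=
  (ρ.quasiIso_unit_app_iff _).2 (acyclic_of_acyclic_rows (ρ.acyclic_augmented_obj_X Z)
    fun _ => (ρ.isZero_E _).of_iso (ρ.ε.succIso _ N).symm)

lemma map_unitX_postcompX (K : CochainComplex C ℤ) (n : ℤ) :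
    φ.map (ρ.ε.unitX N K n) ≫
        postcompX ρ.E φ ((φ.mapHomologicalComplex (ComplexShape.up ℤ)).obj K) n =
      ρ.θ.unitX N ((φ.mapHomologicalComplex (ComplexShape.up ℤ)).obj K) n := by
  let L := (φ.mapHomologicalComplex (ComplexShape.up ℤ)).obj K
  refine hom_ext fun p q _ hn => ?_
  refine (Category.assoc _ _ _).trans ?_
  refine (congrArg (φ.map (ρ.ε.unitX N K n) ≫ ·) (postcompX_proj ρ.E φ L n p q)).trans ?_
  refine (φ.map_comp (ρ.ε.unitX N K n) (proj N (φ ⋙ ρ.E) K n p q)).symm.trans ?_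
  match q with
  | 0 =>
    obtain rfl : p = n := by simpa using hn
    rw [ρ.ε.unitX_proj_zero]
    exact (ρ.θ_obj (K.X p)).symm.trans (ρ.θ.unitX_proj_zero (K := L) p).symm
  | q + 1 =>
    rw [ρ.ε.unitX_proj_succ, φ.map_zero]
    exact (ρ.θ.unitX_proj_succ (K := L) n p q).symm

lemma map_unit_app (K : CochainComplex C ℤ) :
    (φ.mapHomologicalComplex (ComplexShape.up ℤ)).map (ρ.unit.app K) =
      ρ.counitInv.app ((φ.mapHomologicalComplex (ComplexShape.up ℤ)).obj K) := by
  refine (Iso.eq_comp_inv ((postcompIso N ρ.E φ).app _)).2 ?_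
  ext n : 1
  refine Eq.trans ?_ (ρ.map_unitX_postcompX K n)
  exact congrArg (φ.map · ≫ _) (Category.comp_id (ρ.ε.unitX N K n))

end Resolution

end Tot

/-! ### Adjunctions between derived categories -/

section Adjunction

variable {C D : Type*} [Category C] [Category D] {L : C ⥤ D} {R : D ⥤ C} (η : 𝟭 C ⟶ L ⋙ R)
  (θ : 𝟭 D ⟶ R ⋙ L) [IsIso θ]

lemma app_comp_map_inv_app (h₁ : ∀ X, L.map (η.app X) = θ.app (L.obj X))
    (h₂ : ∀ Y, IsIso (η.app (R.obj Y))) (Y : D) :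
    η.app (R.obj Y) ≫ R.map ((inv θ).app Y) = 𝟙 (R.obj Y) := by
  have := h₂ Y
  have h : L.map (η.app (R.obj Y) ≫ R.map ((inv θ).app Y)) = 𝟙 (L.obj (R.obj Y)) := by
    rw [L.map_comp, h₁]
    exact (θ.naturality ((inv θ).app Y)).symm.trans ((asIso θ).inv_hom_id_app Y)
  refine (cancel_mono (η.app (R.obj Y))).1 (Eq.trans ?_ (Category.id_comp _).symm)
  refine (η.naturality (η.app (R.obj Y) ≫ R.map ((inv θ).app Y))).trans ?_
  refine (congrArg (fun k => η.app (R.obj Y) ≫ R.map k) h).trans ?_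
  exact (congrArg (η.app (R.obj Y) ≫ ·) (R.map_id _)).trans (Category.comp_id _)

/-- The adjunction `L ⊣ R` with unit `η` and counit `θ⁻¹`. -/
def adjunctionOfIsIso (h₁ : ∀ X, L.map (η.app X) = θ.app (L.obj X))
    (h₂ : ∀ Y, IsIso (η.app (R.obj Y))) : L ⊣ R :=
  Adjunction.mkOfUnitCounit
    { unit := η
      counit := inv θ
      left_triangle := by
        ext X
        change L.map (η.app X) ≫ 𝟙 _ ≫ (inv θ).app (L.obj X) = 𝟙 _
        rw [Category.id_comp, h₁]
        exact (asIso θ).hom_inv_id_app _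
      right_triangle := by
        ext Y
        change η.app (R.obj Y) ≫ 𝟙 _ ≫ R.map ((inv θ).app Y) = 𝟙 _
        rw [Category.id_comp]
        exact app_comp_map_inv_app η θ h₁ h₂ Y }

lemma isIso_adjunctionOfIsIso_counit (h₁ : ∀ X, L.map (η.app X) = θ.app (L.obj X))
    (h₂ : ∀ Y, IsIso (η.app (R.obj Y))) : IsIso (adjunctionOfIsIso η θ h₁ h₂).counit :=
  inferInstanceAs (IsIso (inv θ))

end Adjunction

section LocalizedAdjunction

section LocalizedUnit

variable {A B A' B' : Type*} [Category A] [Category B] [Category A'] [Category B']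
  {L₁ : A ⥤ A'} (W : MorphismProperty A) [L₁.IsLocalization W] {L₂ : B ⥤ B'}
  {F : A ⥤ B} {G : B ⥤ A} {F' : A' ⥤ B'} {G' : B' ⥤ A'}
  (α : L₁ ⋙ F' ≅ F ⋙ L₂) (β : L₂ ⋙ G' ≅ G ⋙ L₁) (η : 𝟭 A ⟶ F ⋙ G)

/-- If `F` and `G` induce functors `F'` and `G'` between localizations, then so does `F ⋙ G`. -/
def compFactors : L₁ ⋙ F' ⋙ G' ≅ (F ⋙ G) ⋙ L₁ :=
  Functor.isoWhiskerRight α G' ≪≫ Functor.isoWhiskerLeft F β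

/-- The natural transformation between localizations induced by `η : 𝟭 A ⟶ F ⋙ G`. -/
def localizedUnit : 𝟭 A' ⟶ F' ⋙ G' :=
  letI : Localization.Lifting L₁ W ((F ⋙ G) ⋙ L₁) (F' ⋙ G') := ⟨compFactors α β⟩
  Localization.liftNatTrans L₁ W L₁ ((F ⋙ G) ⋙ L₁) _ _ (Functor.whiskerRight η L₁)

lemma localizedUnit_app (X : A) :
    (localizedUnit W α β η).app (L₁.obj X) =
      L₁.map (η.app X) ≫ β.inv.app (F.obj X) ≫ G'.map (α.inv.app X) := by
  let : Localization.Lifting L₁ W ((F ⋙ G) ⋙ L₁) (F' ⋙ G') := ⟨compFactors α β⟩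
  refine (Localization.liftNatTrans_app L₁ W L₁ ((F ⋙ G) ⋙ L₁) _ _ _ X).trans ?_
  exact Category.id_comp _

lemma isIso_localizedUnit_app_iff (X : A) :
    IsIso ((localizedUnit W α β η).app (L₁.obj X)) ↔ IsIso (L₁.map (η.app X)) := by
  rw [localizedUnit_app]
  exact isIso_comp_right_iff _ (β.inv.app (F.obj X) ≫ G'.map (α.inv.app X))

end LocalizedUnit

variable {A B A' B' : Type*} [Category A] [Category B] [Category A'] [Category B']
  {L₁ : A ⥤ A'} (W₁ : MorphismProperty A) [L₁.IsLocalization W₁]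
  {L₂ : B ⥤ B'} (W₂ : MorphismProperty B) [L₂.IsLocalization W₂]
  {F : A ⥤ B} {G : B ⥤ A} {F' : A' ⥤ B'} {G' : B' ⥤ A'}
  (α : L₁ ⋙ F' ≅ F ⋙ L₂) (β : L₂ ⋙ G' ≅ G ⋙ L₁) (η : 𝟭 A ⟶ F ⋙ G) (θ : 𝟭 B ⟶ G ⋙ F)

lemma map_localizedUnit_app (h : ∀ X, F.map (η.app X) = θ.app (F.obj X)) (X' : A') :
    F'.map ((localizedUnit W₁ α β η).app X') = (localizedUnit W₂ β α θ).app (F'.obj X') := by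
  suffices h : Functor.whiskerRight (localizedUnit W₁ α β η) F' =
      Functor.whiskerLeft F' (localizedUnit W₂ β α θ) from congrArg (NatTrans.app · X') h
  refine Localization.natTrans_ext L₁ W₁ fun X => ?_
  have hα := α.hom.naturality (η.app X)
  have hθ := (localizedUnit W₂ β α θ).naturality (α.hom.app X)
  simp only [Functor.comp_obj, Functor.comp_map, Functor.id_obj, Functor.id_map,
    localizedUnit_app, ← h] at hα hθ
  rw [← cancel_mono (F'.map (G'.map (α.hom.app X)))]
  simp only [Functor.whiskerRight_app, Functor.whiskerLeft_app, Functor.comp_obj, Functor.id_obj,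
    localizedUnit_app, Functor.map_comp, Category.assoc]
  rw [← hθ, ← reassoc_of% hα]
  simp [← Functor.map_comp]

lemma isIso_localizedUnit (h : ∀ X, IsIso (L₁.map (η.app X))) :
    IsIso (localizedUnit W₁ α β η) := by
  have := Localization.essSurj L₁ W₁
  rw [NatTrans.isIso_iff_isIso_app]
  intro X'
  exact (NatTrans.isIso_app_iff_of_iso _ (L₁.objObjPreimageIso X')).1
    ((isIso_localizedUnit_app_iff W₁ α β η _).2 (h _))

lemma isIso_localizedUnit_app_obj [L₂.EssSurj] (h : ∀ Y, IsIso (L₁.map (η.app (G.obj Y))))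
    (Y' : B') : IsIso ((localizedUnit W₁ α β η).app (G'.obj Y')) :=
  (NatTrans.isIso_app_iff_of_iso _
    ((β.app _).symm ≪≫ G'.mapIso (L₂.objObjPreimageIso Y'))).1
      ((isIso_localizedUnit_app_iff W₁ α β η _).2 (h _))

end LocalizedAdjunction

section DerivedCategory

variable {C : Type*} [Category C] [Abelian C] [HasDerivedCategory.{w} C]

lemma isZero_iff_isZero_homology (X : DerivedCategory C) :
    IsZero X ↔ ∀ n, IsZero ((DerivedCategory.homologyFunctor C n).obj X) := by
  refine ⟨fun h n => (DerivedCategory.homologyFunctor C n).map_isZero h, fun h => ?_⟩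
  have h₁ : X.IsLE 0 := (DerivedCategory.isLE_iff X 0).2 fun i _ => h i
  have h₂ : X.IsGE 1 := (DerivedCategory.isGE_iff X 1).2 fun i _ => h i
  exact DerivedCategory.TStructure.t.isZero X 0 1 (by omega)

lemma isZero_Q_obj_iff (K : CochainComplex C ℤ) :
    IsZero (DerivedCategory.Q.obj K) ↔ K.Acyclic := by
  rw [isZero_iff_isZero_homology]
  refine forall_congr' fun n => ?_
  rw [HomologicalComplex.exactAt_iff_isZero_homology]
  exact ((DerivedCategory.homologyFunctorFactors C n).app K).isZero_iff

end DerivedCategory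

namespace Tot.Resolution

variable {C Q : Type*} [Category C] [Category Q] [Abelian C] [Abelian Q] {φ : C ⥤ Q}
  [φ.Additive] [PreservesFiniteLimits φ] [PreservesFiniteColimits φ] {N : ℕ}
  (ρ : Resolution φ N) [HasDerivedCategory.{w} C] [HasDerivedCategory.{w'} Q]

/-- The functor `Z ↦ Tot E(Z)` on derived categories, right adjoint to `φ`. -/
def R : DerivedCategory Q ⥤ DerivedCategory C :=
  Localization.lift (functor N ρ.E ⋙ DerivedCategory.Q)
    (W := HomologicalComplex.quasiIso Q (ComplexShape.up ℤ))
    (fun _ _ f hf => by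
      have := map_quasiIso N ρ.E ρ.exact_E f hf
      exact inferInstanceAs (IsIso (DerivedCategory.Q.map (Tot.map N ρ.E f))))
    DerivedCategory.Q

/-- The functor `R` is computed by `Z ↦ Tot E(Z)`. -/
def facR : DerivedCategory.Q ⋙ ρ.R ≅ functor N ρ.E ⋙ DerivedCategory.Q :=
  Localization.fac _ _ _

/-- The unit `X ⟶ R(φ(X))` on derived categories. -/
def derivedUnit : 𝟭 (DerivedCategory C) ⟶ φ.mapDerivedCategory ⋙ ρ.R :=
  localizedUnit (HomologicalComplex.quasiIso C (ComplexShape.up ℤ)) φ.mapDerivedCategoryFactors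
    ρ.facR ρ.unit

/-- The inverse `Y ⟶ φ(R(Y))` of the counit on derived categories. -/
def derivedCounitInv : 𝟭 (DerivedCategory Q) ⟶ ρ.R ⋙ φ.mapDerivedCategory :=
  localizedUnit (HomologicalComplex.quasiIso Q (ComplexShape.up ℤ)) ρ.facR
    φ.mapDerivedCategoryFactors ρ.counitInv

instance : IsIso ρ.derivedCounitInv :=
  isIso_localizedUnit _ _ _ _ fun Z =>
    (DerivedCategory.isIso_Q_map_iff_quasiIso _ _).2 (ρ.quasiIso_counitInv_app Z)

lemma isIso_derivedUnit_app_R_obj (Y : DerivedCategory Q) :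
    IsIso (ρ.derivedUnit.app (ρ.R.obj Y)) :=
  isIso_localizedUnit_app_obj _ _ _ _ (fun Z =>
    (DerivedCategory.isIso_Q_map_iff_quasiIso _ _).2 (ρ.quasiIso_unit_app_obj Z)) Y

lemma map_derivedUnit_app (X : DerivedCategory C) :
    φ.mapDerivedCategory.map (ρ.derivedUnit.app X) =
      ρ.derivedCounitInv.app (φ.mapDerivedCategory.obj X) :=
  map_localizedUnit_app _ _ _ _ _ _ ρ.map_unit_app X

/-- The adjunction between `φ` and `R` on derived categories. -/
def adj : φ.mapDerivedCategory ⊣ ρ.R :=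
  adjunctionOfIsIso ρ.derivedUnit ρ.derivedCounitInv ρ.map_derivedUnit_app
    ρ.isIso_derivedUnit_app_R_obj

instance : IsIso ρ.adj.counit :=
  isIso_adjunctionOfIsIso_counit ρ.derivedUnit ρ.derivedCounitInv ρ.map_derivedUnit_app
    ρ.isIso_derivedUnit_app_R_obj

lemma isIso_adj_unit_app_iff (K : CochainComplex C ℤ) :
    IsIso (ρ.adj.unit.app (DerivedCategory.Q.obj K)) ↔ (obj N ρ.ε.augmented K).Acyclic := by
  rw [← ρ.quasiIso_unit_app_iff, ← DerivedCategory.isIso_Q_map_iff_quasiIso]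
  exact isIso_localizedUnit_app_iff _ _ _ _ K

/-- A functor computed by the total complexes of `F` is isomorphic to `R ∘ φ` as soon as `F` is
isomorphic to `E ∘ φ`. -/
def compRIso {F : C ⥤ CochainComplex C ℕ} [F.Additive] (e : φ ⋙ ρ.E ≅ F)
    {H : DerivedCategory C ⥤ DerivedCategory C}
    (fac : DerivedCategory.Q ⋙ H ≅ functor N F ⋙ DerivedCategory.Q) :
    φ.mapDerivedCategory ⋙ ρ.R ≅ H :=
  letI : Localization.Lifting DerivedCategory.Q
      (HomologicalComplex.quasiIso C (ComplexShape.up ℤ))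
      ((φ.mapHomologicalComplex (ComplexShape.up ℤ) ⋙ functor N ρ.E) ⋙ DerivedCategory.Q)
      (φ.mapDerivedCategory ⋙ ρ.R) := ⟨compFactors φ.mapDerivedCategoryFactors ρ.facR⟩
  letI : Localization.Lifting DerivedCategory.Q
      (HomologicalComplex.quasiIso C (ComplexShape.up ℤ)) (functor N F ⋙ DerivedCategory.Q) H :=
    ⟨fac⟩
  Localization.liftNatIso DerivedCategory.Q (HomologicalComplex.quasiIso C (ComplexShape.up ℤ))
    _ _ _ _ (Functor.isoWhiskerRight (precompIso N φ ρ.E ≪≫ natIso N e) DerivedCategory.Q)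

end Tot.Resolution

namespace Tot

variable {C D : Type*} [Category C] [Category D] [Abelian C] [Abelian D]
  (N : ℕ) (F : C ⥤ CochainComplex D ℕ) [F.Additive]

lemma isStrictlyGE_obj (K : CochainComplex C ℤ) (n : ℤ) [K.IsStrictlyGE n] :
    (obj N F K).IsStrictlyGE n := by
  rw [CochainComplex.isStrictlyGE_iff]
  intro i hi
  refine (IsZero.iff_id_eq_zero (X N F K i)).2 (hom_ext fun p q _ hp => ?_)
  have h : IsZero ((F.obj (K.X p)).X q) :=
    (F ⋙ HomologicalComplex.eval _ _ q).map_isZero (K.isZero_of_isStrictlyGE n p (by omega))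
  exact h.eq_of_tgt _ _

lemma isStrictlyLE_obj (K : CochainComplex C ℤ) (n : ℤ) [K.IsStrictlyLE n] :
    (obj N F K).IsStrictlyLE (n + N) := by
  rw [CochainComplex.isStrictlyLE_iff]
  intro i hi
  refine (IsZero.iff_id_eq_zero (X N F K i)).2 (hom_ext fun p q hq hp => ?_)
  have h : IsZero ((F.obj (K.X p)).X q) :=
    (F ⋙ HomologicalComplex.eval _ _ q).map_isZero (K.isZero_of_isStrictlyLE n p (by omega))
  exact h.eq_of_tgt _ _

variable {N F} [HasDerivedCategory.{w} C] [HasDerivedCategory.{w'} D]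
  {H : DerivedCategory C ⥤ DerivedCategory D}
  (fac : DerivedCategory.Q ⋙ H ≅ functor N F ⋙ DerivedCategory.Q)

include fac

lemma isGE_of_fac (X : DerivedCategory C) (n : ℤ) (h : X.IsGE n) : (H.obj X).IsGE n := by
  obtain ⟨K, _, ⟨e⟩⟩ := X.exists_iso_Q_obj_of_isGE n
  have := isStrictlyGE_obj N F K n
  have : ((functor N F ⋙ DerivedCategory.Q).obj K).IsGE n :=
    (DerivedCategory.isGE_Q_obj_iff (obj N F K) n).2 inferInstance
  exact DerivedCategory.TStructure.t.isGE_of_iso ((fac.app K).symm ≪≫ H.mapIso e.symm) n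

lemma isLE_of_fac (X : DerivedCategory C) (n : ℤ) (h : X.IsLE n) :
    (H.obj X).IsLE (n + N) := by
  obtain ⟨K, _, ⟨e⟩⟩ := X.exists_iso_Q_obj_of_isLE n
  have := isStrictlyLE_obj N F K n
  have : ((functor N F ⋙ DerivedCategory.Q).obj K).IsLE (n + N) :=
    (DerivedCategory.isLE_Q_obj_iff (obj N F K) _).2 inferInstance
  exact DerivedCategory.TStructure.t.isLE_of_iso ((fac.app K).symm ≪≫ H.mapIso e.symm) _

lemma dProp_of_fac (b : Spade) (X : DerivedCategory C) (h : dProp C b X) :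
    dProp D b (H.obj X) := by
  cases b with
  | none => trivial
  | plus =>
    obtain ⟨n, h⟩ := h
    exact ⟨n, isGE_of_fac fac X n h⟩
  | minus =>
    obtain ⟨n, h⟩ := h
    exact ⟨_, isLE_of_fac fac X n h⟩
  | bounded =>
    obtain ⟨⟨n, h⟩, ⟨m, h'⟩⟩ := h
    exact ⟨⟨n, isGE_of_fac fac X n h⟩, ⟨_, isLE_of_fac fac X m h'⟩⟩

end Tot

/-! ### Semi-orthogonal decompositions -/

section Semiorthogonal

open Pretriangulated

lemma hom_eq_zero_of_essImage {C D : Type*} [Category C] [Category D] [HasZeroMorphisms C]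
    {L : C ⥤ D} {R : D ⥤ C} (adj : L ⊣ R) {X Y : C} (f : X ⟶ Y) (hX : IsZero (L.obj X))
    (hY : R.essImage Y) : f = 0 := by
  obtain ⟨Z, ⟨e⟩⟩ := hY
  rw [← cancel_mono e.inv, zero_comp]
  exact (adj.homEquiv X Z).symm.injective (hX.eq_of_src _ _)

variable {T T' : Type*} [Category T] [Category T'] [Preadditive T] [Preadditive T']
  [HasZeroObject T] [HasZeroObject T'] [HasShift T ℤ] [HasShift T' ℤ]
  [∀ n : ℤ, (shiftFunctor T n).Additive] [∀ n : ℤ, (shiftFunctor T' n).Additive]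
  [Pretriangulated T] [Pretriangulated T'] {L : T ⥤ T'} [L.CommShift ℤ] [L.IsTriangulated]
  {R : T' ⥤ T} {P : ObjectProperty T} (hP : ∀ X, P X ↔ IsZero (L.obj X))
  (adj : L ⊣ R) [IsIso adj.counit]

include hP

lemma isTriangulated_of_iff_isZero : P.IsTriangulated where
  exists_zero := ⟨_, isZero_zero T, (hP _).2 (L.map_isZero (isZero_zero T))⟩
  isStableUnderShiftBy n := ⟨fun X hX => (hP _).2 (((shiftFunctor T' n).map_isZero
    ((hP X).1 hX)).of_iso ((L.commShiftIso n).app X))⟩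
  toIsTriangulatedClosed₂ :=
    have : P.IsClosedUnderIsomorphisms :=
      ⟨fun e hX => (hP _).2 (((hP _).1 hX).of_iso (L.mapIso e.symm))⟩
    .mk' fun S hS h₁ h₃ => (hP _).2
      (Triangle.isZero₂_of_isZero₁₃ _ (L.map_distinguished S hS) ((hP _).1 h₁) ((hP _).1 h₃))

include adj

lemma exists_distinguished_adj_unit (X : T) : ∃ (Y : T) (f : Y ⟶ X)
    (h : R.obj (L.obj X) ⟶ (shiftFunctor T (1 : ℤ)).obj Y), P Y ∧
      Triangle.mk f (adj.unit.app X) h ∈ distinguishedTriangles := by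
  have := adj.fullyFaithfulROfIsIsoCounit.full
  have := adj.fullyFaithfulROfIsIsoCounit.faithful
  obtain ⟨Y, f, h, hT⟩ := distinguished_cocone_triangle₁ (adj.unit.app X)
  have hi : IsIso (L.map (adj.unit.app X)) := inferInstance
  exact ⟨Y, f, h,
    (hP _).2 ((Triangle.isZero₁_iff_isIso₂ _ (L.map_distinguished _ hT)).2 hi), hT⟩

lemma essImage_eq_rightOrthogonal : R.essImage = P.rightOrthogonal := by
  have := isTriangulated_of_iff_isZero hP
  have hR {X : T} (hX : R.essImage X) : P.rightOrthogonal X := fun Y f hY =>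
    hom_eq_zero_of_essImage adj f ((hP Y).1 hY) hX
  ext X
  refine ⟨hR, fun hX => ?_⟩
  obtain ⟨Y, f, h, hY, hT⟩ := exists_distinguished_adj_unit hP adj X
  have hY' : P.rightOrthogonal Y :=
    P.rightOrthogonal.ext_of_isTriangulatedClosed₁ _ hT hX (hR (R.obj_mem_essImage _))
  have : IsIso (adj.unit.app X) :=
    (Triangle.isZero₁_iff_isIso₂ _ hT).1 ((IsZero.iff_id_eq_zero Y).2 (hY' _ hY))
  exact adj.mem_essImage_of_unit_isIso X

lemma isSemiorthogonalDecomposition_of_adjunction :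
    IsSemiorthogonalDecomposition R.essImage P where
  isTriangulated₁ := by
    have := isTriangulated_of_iff_isZero hP
    rw [essImage_eq_rightOrthogonal hP adj]
    infer_instance
  isTriangulated₂ := isTriangulated_of_iff_isZero hP
  hom_eq_zero _ _ f hX hY := hom_eq_zero_of_essImage adj f ((hP _).1 hX) hY
  exists_triangle X := by
    obtain ⟨Y, f, h, hY, hT⟩ := exists_distinguished_adj_unit hP adj X
    exact ⟨_, _, f, _, h, R.obj_mem_essImage _, hY, hT⟩

end Semiorthogonal

section Equivalence

variable {C D : Type*} [Category C] [Category D] {L : C ⥤ D} {R : D ⥤ C} (adj : L ⊣ R)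
  [IsIso adj.counit] {P : ObjectProperty C} (hP : ∀ X, P X ↔ IsIso (adj.unit.app X))

lemma isIso_unit_app_obj (Y : D) : IsIso (adj.unit.app (R.obj Y)) := by
  have := adj.fullyFaithfulROfIsIsoCounit.full
  have := adj.fullyFaithfulROfIsIsoCounit.faithful
  infer_instance

include hP in
lemma essImage_eq_of_isIso_unit : R.essImage = P := by
  have := adj.fullyFaithfulROfIsIsoCounit.full
  have := adj.fullyFaithfulROfIsIsoCounit.faithful
  ext X
  rw [hP, adj.isIso_unit_app_iff_mem_essImage]

/-- The equivalence of the full subcategory of the objects with invertible unit with the target of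
a left adjoint whose right adjoint is fully faithful. -/
def equivalenceOfIsIsoUnit : P.FullSubcategory ≌ D :=
  CategoryTheory.Equivalence.mk (P.ι ⋙ L)
    (P.lift R fun Y => (hP _).2 (isIso_unit_app_obj adj Y))
    (NatIso.ofComponents
      (fun X => P.fullyFaithfulι.preimageIso
        (have := (hP _).1 X.property; asIso (adj.unit.app X.obj)))
      (fun f => P.ι.map_injective (adj.unit.naturality f.hom)))
    (NatIso.ofComponents (fun Y => asIso (adj.counit.app Y))
      (fun f => adj.counit.naturality f))

end Equivalence

/-! ### Čech complexes -/

section Torsion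

variable {A : Type u} [CommRing A] {𝒜 : ℤ → AddSubgroup A}

lemma torPos_iff_of_span {r : ℕ} {f : Fin r → A} (hI : Ideal.span (Set.range f) = idealPos 𝒜)
    (M : GrMod 𝒜) : torPos 𝒜 M ↔ ∀ (i : Fin r) (x : M), ∃ n : ℕ, f i ^ n • x = 0 := by
  rw [torPos_iff]
  refine ⟨fun h i x => ?_, fun h x a ha => ?_⟩
  · obtain ⟨n, -, hn⟩ := h x (f i) (hI ▸ Ideal.subset_span ⟨i, rfl⟩)
    exact ⟨n, hn⟩
  · have hle : idealPos 𝒜 ≤ Ideal.radical (LinearMap.ker (LinearMap.toSpanSingleton A M x)) := by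
      rw [← hI, Ideal.span_le]
      rintro _ ⟨i, rfl⟩
      exact h i x
    obtain ⟨n, hn : a ^ n • x = 0⟩ := hle ha
    exact ⟨n + 1, n.succ_pos, by rw [pow_succ', mul_smul, hn, smul_zero]⟩

end Torsion

namespace Cech

open GrMod LocalizedModule

section Fractions

variable {A : Type u} [CommRing A] {g : A} {X : Type*} [AddCommGroup X] [Module A X]

lemma smul_frac (a : A) (x : X) (n : ℕ) :
    a • (frac x n : LocalizedModule (Submonoid.powers g) X) = frac (a • x) n :=
  smul'_mk _ _ _

lemma frac_eq_zero_iff (x : X) (n : ℕ) :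
    (frac x n : LocalizedModule (Submonoid.powers g) X) = 0 ↔ ∃ k : ℕ, g ^ k • x = 0 := by
  rw [frac, ← zero_mk 1, mk_eq]
  constructor
  · rintro ⟨⟨_, k, rfl⟩, h⟩
    exact ⟨k, by simpa [Submonoid.smul_def] using h⟩
  · rintro ⟨k, h⟩
    exact ⟨⟨g ^ k, k, rfl⟩, by simpa [Submonoid.smul_def] using h⟩

end Fractions

section Faces

variable {r m : ℕ}

lemma insert_range_face (s : Fin (m + 1) ↪o Fin r) (j : Fin (m + 1)) :
    insert (s j) (Set.range (face s j)) = Set.range s := by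
  have h : (face s j : Fin m → Fin r) = s ∘ j.succAbove := rfl
  rw [h, Set.range_comp, Fin.range_succAbove, ← Set.image_insert_eq, Set.insert_eq,
    Set.union_compl_self, Set.image_univ]

lemma notMem_range_face (s : Fin (m + 1) ↪o Fin r) (j : Fin (m + 1)) :
    s j ∉ Set.range (face s j) := by
  rintro ⟨l, hl⟩
  exact Fin.succAbove_ne j l (s.injective hl)

lemma mem_range_face_of_ne (s : Fin (m + 1) ↪o Fin r) {j l : Fin (m + 1)} (h : l ≠ j) :
    s j ∈ Set.range (face s l) := by
  obtain ⟨a, ha⟩ := Fin.exists_succAbove_eq h.symm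
  exact ⟨a, congrArg s ha⟩

lemma eq_of_range_eq {s t : Fin m ↪o Fin r} (h : Set.range s = Set.range t) : s = t :=
  DFunLike.coe_injective ((s.strictMono.range_inj t.strictMono).1 h)

lemma eq_of_face_eq {s s' : Fin (m + 1) ↪o Fin r} {j j' : Fin (m + 1)}
    (h : face s j = face s' j') (h' : s j = s' j') : s = s' ∧ j = j' := by
  obtain rfl : s = s' :=
    eq_of_range_eq (by rw [← insert_range_face s j, h, h', insert_range_face])
  exact ⟨rfl, s.injective h'⟩

lemma exists_face_eq (t : Fin m ↪o Fin r) {i : Fin r} (hi : i ∉ Set.range t) :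
    ∃ (s : Fin (m + 1) ↪o Fin r) (j : Fin (m + 1)), face s j = t ∧ s j = i := by
  let T : Finset (Fin r) := Finset.univ.map t.toEmbedding
  have hT : (insert i T).card = m + 1 := by
    rw [Finset.card_insert_of_notMem (by simpa [T] using hi), Finset.card_map, Finset.card_univ,
      Fintype.card_fin]
  let s := (insert i T).orderEmbOfFin hT
  have hs : Set.range s = insert i (Set.range t) := by
    rw [Finset.range_orderEmbOfFin]
    ext x
    simp [T]
  obtain ⟨j, hj⟩ : i ∈ Set.range s := hs ▸ Set.mem_insert _ _
  have hi' : i ∉ Set.range (face s j) := hj ▸ notMem_range_face s j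
  refine ⟨s, j, eq_of_range_eq ?_, hj⟩
  rw [← Set.insert_sdiff_self_of_notMem hi', ← Set.insert_sdiff_self_of_notMem hi, ← hs,
    ← insert_range_face s j, hj]

end Faces

variable {A : Type u} [CommRing A] {𝒜 : ℤ → AddSubgroup A} [SetLike.GradedMonoid 𝒜]
  {r m : ℕ} {f : Fin r → A} {d : Fin r → ℤ} (hf : ∀ i, f i ∈ 𝒜 (d i)) {M : GrMod 𝒜}

lemma faceMap_frac (s : Fin (m + 1) ↪o Fin r) (j : Fin (m + 1)) (x : M) (n : ℕ) :
    ((faceMap hf s j).app M).lin (frac x n) = frac (f (s j) ^ n • x) n :=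
  locTrans_frac _ _ _ _ _ M x n

lemma exists_faceMap_eq_pow_smul (s : Fin (m + 1) ↪o Fin r) (j : Fin (m + 1))
    (z : (loc (prodF_mem hf s)).obj M) : ∃ (k : ℕ) (w : (loc (prodF_mem hf (face s j))).obj M),
      ((faceMap hf s j).app M).lin w = f (s j) ^ k • z := by
  obtain ⟨x, n, rfl⟩ := exists_frac (f := prodF f s) z
  exact ⟨n, frac x n, (faceMap_frac hf s j x n).trans (smul_frac _ _ _).symm⟩

lemma exists_pow_smul_eq_zero_of_faceMap (s : Fin (m + 1) ↪o Fin r) (j : Fin (m + 1))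
    (z : (loc (prodF_mem hf (face s j))).obj M) (hz : ((faceMap hf s j).app M).lin z = 0) :
    ∃ k : ℕ, f (s j) ^ k • z = 0 := by
  obtain ⟨x, n, rfl⟩ := exists_frac (f := prodF f (face s j)) z
  obtain ⟨k, hk⟩ := (frac_eq_zero_iff _ _).1 ((faceMap_frac hf s j x n).symm.trans hz)
  refine ⟨k + n, (smul_frac _ _ _).trans ((frac_eq_zero_iff _ _).2 ⟨k, ?_⟩)⟩
  rw [← hk, ← prodF_face s j, smul_smul, smul_smul, mul_pow, pow_add, mul_assoc]

lemma exists_pow_smul_eq_zero_of_diff (z : (term hf m).obj M)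
    (hz : ((diff hf m).app M).lin z = 0) (i : Fin r)
    (h : ∀ s : Fin m ↪o Fin r, i ∈ Set.range s → z s = 0) : ∃ k : ℕ, f i ^ k • z = 0 := by
  have key (t : Fin m ↪o Fin r) : ∃ k : ℕ, f i ^ k • z t = 0 := by
    by_cases hi : i ∈ Set.range t
    · exact ⟨0, by rw [h t hi, smul_zero]⟩
    · obtain ⟨s, j, rfl, rfl⟩ := exists_face_eq t hi
      have hs : ((diff hf m).app M).lin z s = (0 : (loc (prodF_mem hf s)).obj M) := congrFun hz s
      rw [diff_app, Finset.sum_eq_single j] at hs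
      · exact exists_pow_smul_eq_zero_of_faceMap hf s j _
          ((IsUnit.smul_eq_zero ((isUnit_one.neg).pow _)).1 hs)
      · intro l _ hl
        rw [h _ (mem_range_face_of_ne s hl), map_zero, smul_zero]
      · exact fun hj => absurd (Finset.mem_univ j) hj
  choose k hk using key
  refine ⟨Finset.univ.sup k, funext fun t => ?_⟩
  change f i ^ Finset.univ.sup k • z t = 0
  rw [← Nat.sub_add_cancel (Finset.le_sup (f := k) (Finset.mem_univ t)), pow_add, mul_smul, hk,
    smul_zero]

lemma exists_faceMap_eq_neg_one_pow_smul (x : (term hf (m + 1)).obj M) (i : Fin r) :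
    ∃ (k : ℕ) (y : (term hf m).obj M),
      (∀ t : Fin m ↪o Fin r, i ∈ Set.range t → y t = 0) ∧
      ∀ (s : Fin (m + 1) ↪o Fin r) (j : Fin (m + 1)), s j = i →
        ((faceMap hf s j).app M).lin (y (face s j)) = (-1 : ℤ) ^ (j : ℕ) • f i ^ k • x s := by
  have key (t : Fin m ↪o Fin r) : ∃ k₀ : ℕ, ∀ k ≥ k₀, ∃ w : (loc (prodF_mem hf t)).obj M,
      (i ∈ Set.range t → w = 0) ∧ ∀ (s : Fin (m + 1) ↪o Fin r) (j : Fin (m + 1))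
        (h : face s j = t), s j = i →
          ((faceMap hf s j).app M).lin (h ▸ w) = (-1 : ℤ) ^ (j : ℕ) • f i ^ k • x s := by
    by_cases hi : i ∈ Set.range t
    · refine ⟨0, fun k _ => ⟨0, fun _ => rfl, ?_⟩⟩
      rintro s j rfl rfl
      exact absurd hi (notMem_range_face s j)
    · obtain ⟨s, j, rfl, rfl⟩ := exists_face_eq t hi
      obtain ⟨k₀, w, hw⟩ := exists_faceMap_eq_pow_smul hf s j (x s)
      refine ⟨k₀, fun k hk => ⟨(-1 : ℤ) ^ (j : ℕ) • f (s j) ^ (k - k₀) • w,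
        fun h => absurd h hi, fun s' j' h h' => ?_⟩⟩
      obtain ⟨rfl, rfl⟩ := eq_of_face_eq h h'
      rw [map_zsmul, map_smul, hw, smul_smul, ← pow_add, Nat.sub_add_cancel hk]
  choose k₀ hk₀ using key
  choose y hy hy' using fun t => hk₀ t (Finset.univ.sup k₀) (Finset.le_sup (Finset.mem_univ t))
  exact ⟨_, y, hy, fun s j h => hy' _ s j rfl h⟩

lemma exists_diff_eq_pow_smul_of_mem_range (x : (term hf (m + 1)).obj M) (i : Fin r) :
    ∃ (k : ℕ) (y : (term hf m).obj M), ∀ s : Fin (m + 1) ↪o Fin r, i ∈ Set.range s →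
      ((diff hf m).app M).lin y s = (f i ^ k • x : (term hf (m + 1)).obj M) s := by
  obtain ⟨k, y, hy, hy'⟩ := exists_faceMap_eq_neg_one_pow_smul hf x i
  refine ⟨k, y, ?_⟩
  rintro s ⟨j, hj⟩
  rw [diff_app, Finset.sum_eq_single j]
  · rw [hy' s j hj, smul_smul, ← mul_pow, neg_one_mul, neg_neg, one_pow, one_smul]
    rfl
  · intro l _ hl
    rw [hy _ (hj ▸ mem_range_face_of_ne s hl), map_zero, smul_zero]
  · exact fun h => absurd (Finset.mem_univ j) h

/-- Up to a power of `f i`, a cochain `x` is the differential of some `y` on the components whose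
indices involve `i`; the other components of `d y - f iᵏ x` are torsion, as it is a cocycle. -/
lemma exists_pow_smul_eq_diff (x : (term hf (m + 1)).obj M)
    (hx : ((diff hf (m + 1)).app M).lin x = 0) (i : Fin r) :
    ∃ (k : ℕ) (y : (term hf m).obj M), f i ^ k • x = ((diff hf m).app M).lin y := by
  obtain ⟨k, y, hy⟩ := exists_diff_eq_pow_smul_of_mem_range hf x i
  have hd : ((diff hf (m + 1)).app M).lin (((diff hf m).app M).lin y) = 0 :=
    comp_apply_zero (NatTrans.congr_app (diff_comp hf m) M) y
  obtain ⟨l, hl⟩ := exists_pow_smul_eq_zero_of_diff hf (((diff hf m).app M).lin y - f i ^ k • x)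
    (by rw [map_sub, map_smul, hd, hx, smul_zero, sub_zero]) i
    (fun s hs => sub_eq_zero.2 (hy s hs))
  refine ⟨l + k, f i ^ l • y, ?_⟩
  rw [map_smul, pow_add, mul_smul, eq_comm, ← sub_eq_zero, ← smul_sub, hl]

end Cech

namespace GrMod

section Torsion

variable {A : Type u} [CommRing A] {𝒜 : ℤ → AddSubgroup A} {r : ℕ} {f : Fin r → A}
  (hI : Ideal.span (Set.range f) = idealPos 𝒜) (S : ShortComplex (GrMod 𝒜))

include hI

lemma torPos_homology
    (h : ∀ x : S.X₂, S.g.lin x = 0 → ∀ i, ∃ (k : ℕ) (y : S.X₁), f i ^ k • x = S.f.lin y) :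
    torPos 𝒜 S.homology := by
  rw [torPos_iff_of_span hI]
  intro i z
  obtain ⟨c, rfl⟩ := (epi_iff_surjective S.homologyπ).1 inferInstance z
  obtain ⟨k, y, hk⟩ := h (S.iCycles.lin c) (comp_apply_zero S.iCycles_g c) i
  have hc : f i ^ k • c = S.toCycles.lin y := by
    apply (mono_iff_injective S.iCycles).1 inferInstance
    rw [map_smul, hk]
    exact (congrArg (fun g => Hom.lin g y) S.toCycles_i).symm
  refine ⟨k, ?_⟩
  rw [← map_smul, hc]
  exact comp_apply_zero S.toCycles_comp_homologyπ y

lemma exact_map_functor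
    (h : ∀ x : S.X₂, S.g.lin x = 0 → ∀ i, ∃ (k : ℕ) (y : S.X₁), f i ^ k • x = S.f.lin y) :
    (S.map (SerreQuotient.functor (torPos 𝒜))).Exact := by
  rw [ShortComplex.exact_iff_isZero_homology]
  refine IsZero.of_iso ?_ (S.mapHomologyIso (SerreQuotient.functor (torPos 𝒜)))
  exact (ObjectProperty.SerreClassLocalization.isZero_obj_iff _ (torPos 𝒜) _).2
    (torPos_homology hI S h)

end Torsion

section

variable {A : Type u} [CommRing A] {𝒜 : ℤ → AddSubgroup A}

/-- A finite product of graded modules is a biproduct. -/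
def piIsoBiproduct {ι : Type} [Finite ι] (M : ι → GrMod 𝒜) [HasBiproduct M] : pi M ≅ ⨁ M :=
  (piIsLimit M).conePointUniqueUpToIso (biproduct.isLimit M)

end

end GrMod

section Localization

variable {A : Type*} [CommRing A] {X : Type*} [AddCommGroup X] [Module A X]

lemma isUnit_algebraMap_end_localizedModule {a : A}
    (h : IsUnit (algebraMap A (Module.End A X) a)) (S : Submonoid A) :
    IsUnit (algebraMap A (Module.End A (LocalizedModule S X)) a) := by
  have hmap : ⇑(LocalizedModule.map S (algebraMap A (Module.End A X) a)) =
      algebraMap A (Module.End A (LocalizedModule S X)) a := by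
    funext z
    induction z using LocalizedModule.induction_on with
    | h x s => exact (LocalizedModule.map_mk S _ x s).trans (LocalizedModule.smul'_mk _ _ _).symm
  rw [Module.End.isUnit_iff] at h ⊢
  rw [← hmap]
  exact ⟨LocalizedModule.map_injective S _ h.1, LocalizedModule.map_surjective S _ h.2⟩

lemma bijective_mkLinearMap_of_isUnit (S : Submonoid A)
    (h : ∀ s : S, IsUnit (algebraMap A (Module.End A X) s)) :
    Function.Bijective (LocalizedModule.mkLinearMap S X) := by
  have : IsLocalizedModule S (LinearMap.id : X →ₗ[A] X) :=
    ⟨h, fun x => ⟨(x, 1), one_smul _ _⟩, fun e => ⟨1, congrArg _ e⟩⟩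
  have hid : (IsLocalizedModule.iso S (LinearMap.id : X →ₗ[A] X)).symm =
      LocalizedModule.mkLinearMap S X :=
    IsLocalizedModule.iso_symm_comp S LinearMap.id
  rw [← hid]
  exact LinearEquiv.bijective _

end Localization

namespace Cech

open GrMod LocalizedModule

variable {A : Type u} [CommRing A] {𝒜 : ℤ → AddSubgroup A} [SetLike.GradedMonoid 𝒜]
  {r : ℕ} {f : Fin r → A} {d : Fin r → ℤ} (hf : ∀ i, f i ∈ 𝒜 (d i))

lemma dvd_prodF {m : ℕ} (s : Fin m ↪o Fin r) (j : Fin m) : f (s j) ∣ prodF f s :=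
  Finset.dvd_prod_of_mem _ (Finset.mem_univ j)

lemma ext_d (M : GrMod 𝒜) (m : ℕ) : ((ext hf).obj M).d m (m + 1) = (diff hf m).app M :=
  CochainComplex.of_d (fun m => (term hf m).obj M) (fun m => (diff hf m).app M) m

lemma cech_d (M : GrMod 𝒜) (m : ℕ) :
    ((cech hf).obj M).d m (m + 1) = (-diff hf (m + 1)).app M :=
  CochainComplex.of_d (fun m => (term hf (m + 1)).obj M) (fun m => (-diff hf (m + 1)).app M) m

lemma exists_pow_smul_eq_ext_d (M : GrMod 𝒜) (m : ℕ) (x : ((ext hf).obj M).X m)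
    (hx : (((ext hf).obj M).d m (m + 1)).lin x = 0) (i : Fin r) :
    ∃ (k : ℕ) (y : ((ext hf).obj M).X ((ComplexShape.up ℕ).prev m)),
      f i ^ k • x = (((ext hf).obj M).d ((ComplexShape.up ℕ).prev m) m).lin y := by
  rw [ext_d] at hx
  match m with
  | 0 =>
    obtain ⟨k, hk⟩ := exists_pow_smul_eq_zero_of_diff hf x hx i fun _ ⟨j, _⟩ => j.elim0
    exact ⟨k, 0, hk.trans (map_zero _).symm⟩
  | m + 1 =>
    rw [CochainComplex.prev_nat_succ, ext_d]
    exact exists_pow_smul_eq_diff hf x hx i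

lemma acyclic_map_ext (hI : Ideal.span (Set.range f) = idealPos 𝒜) (M : GrMod 𝒜) :
    (((SerreQuotient.functor (torPos 𝒜)).mapHomologicalComplex (ComplexShape.up ℕ)).obj
      ((ext hf).obj M)).Acyclic := by
  intro m
  rw [HomologicalComplex.exactAt_iff' _ ((ComplexShape.up ℕ).prev m) m (m + 1) rfl
    (CochainComplex.next ℕ m)]
  exact exact_map_functor hI (((ext hf).obj M).sc' ((ComplexShape.up ℕ).prev m) m (m + 1))
    (exists_pow_smul_eq_ext_d hf M m)

lemma isUnit_algebraMap_end_term {M : GrMod 𝒜} {a : A}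
    (h : IsUnit (algebraMap A (Module.End A M) a)) (m : ℕ) :
    IsUnit (algebraMap A (Module.End A ((term hf m).obj M)) a) := by
  have h' := fun s : Fin m ↪o Fin r => (Module.End.isUnit_iff _).1
    (isUnit_algebraMap_end_localizedModule h (Submonoid.powers (prodF f s)))
  rw [Module.End.isUnit_iff]
  refine ⟨fun x y hxy => funext fun s => (h' s).1 (congrFun hxy s), fun x => ?_⟩
  choose y hy using fun s => (h' s).2 (x s)
  exact ⟨y, funext hy⟩

lemma acyclic_ext_of_isUnit {M : GrMod 𝒜} {i : Fin r}
    (h : IsUnit (algebraMap A (Module.End A M) (f i))) : ((ext hf).obj M).Acyclic := by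
  intro m
  rw [HomologicalComplex.exactAt_iff' _ ((ComplexShape.up ℕ).prev m) m (m + 1) rfl
    (CochainComplex.next ℕ m), exact_iff]
  intro x hx
  obtain ⟨k, y, hk⟩ := exists_pow_smul_eq_ext_d hf M m x hx i
  have hbij (q : ℕ) : Function.Bijective fun x : (term hf q).obj M => f i ^ k • x := by
    have hq := (isUnit_algebraMap_end_term hf h q).pow k
    rw [← map_pow] at hq
    exact (Module.End.isUnit_iff _).1 hq
  obtain ⟨y, rfl⟩ := (hbij _).2 y
  exact ⟨y, (hbij m).1 ((map_smul _ _ _).symm.trans hk.symm)⟩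

lemma acyclic_ext_term (M : GrMod 𝒜) (m : ℕ) :
    ((ext hf).obj ((term hf (m + 1)).obj M)).Acyclic := by
  intro q
  rw [HomologicalComplex.exactAt_iff_isZero_homology]
  have := Abelian.hasFiniteBiproducts (C := GrMod 𝒜)
  let X (s : Fin (m + 1) ↪o Fin r) : GrMod 𝒜 := (loc (prodF_mem hf s)).obj M
  let H := ext hf ⋙ HomologicalComplex.homologyFunctor (GrMod 𝒜) (ComplexShape.up ℕ) q
  have hX (s : Fin (m + 1) ↪o Fin r) : IsZero (H.obj (X s)) :=
    (HomologicalComplex.exactAt_iff_isZero_homology _ _).1 <|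
      acyclic_ext_of_isUnit hf (isUnit_of_dvd (dvd_prodF s 0) M ⟨f (s 0), 1, pow_one _⟩) q
  exact (Tot.isZero_obj_biproduct H X hX).of_iso (H.mapIso (piIsoBiproduct X))

lemma isZero_term_of_torPos (hI : Ideal.span (Set.range f) = idealPos 𝒜) (m : ℕ) (M : GrMod 𝒜)
    (hM : torPos 𝒜 M) : IsZero ((term hf (m + 1)).obj M) := by
  rw [IsZero.iff_id_eq_zero]
  ext x
  funext s
  obtain ⟨y, n, hy⟩ := exists_frac (f := prodF f s) (x s)
  obtain ⟨k, hk⟩ := (torPos_iff_of_span hI M).1 hM (s 0) y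
  obtain ⟨c, hc⟩ := pow_dvd_pow_of_dvd (dvd_prodF (f := f) s 0) k
  refine hy.trans ((frac_eq_zero_iff _ _).2 ⟨k, ?_⟩)
  rw [hc, mul_comm, mul_smul, hk, smul_zero]

lemma isZero_term (m : ℕ) (hm : r < m) (M : GrMod 𝒜) : IsZero ((term hf m).obj M) := by
  have : IsEmpty (Fin m ↪o Fin r) :=
    ⟨fun s => hm.not_ge (by simpa using Fintype.card_le_of_injective s s.injective)⟩
  rw [IsZero.iff_id_eq_zero]
  ext x
  exact funext isEmptyElim

/-- The localization map from `M` to `M_1`, which is the term of degree `0` of the extended Čech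
complex. -/
def toTermZero (M : GrMod 𝒜) : M ⟶ (term hf 0).obj M where
  lin := LinearMap.pi fun s => mkLinearMap (Submonoid.powers (prodF f s)) M
  map_deg := fun {i x} hx s _ => ⟨0, x, by simpa using hx,
    congrArg (LocalizedModule.mk x) (Subtype.ext (pow_zero _).symm)⟩

lemma toTermZero_apply (M : GrMod 𝒜) (x : M) (s : Fin 0 ↪o Fin r) :
    (toTermZero hf M).lin x s = frac x 0 :=
  congrArg (LocalizedModule.mk x) (Subtype.ext (pow_zero _).symm)

lemma toTermZero_naturality {M N : GrMod 𝒜} (g : M ⟶ N) :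
    g ≫ toTermZero hf N = toTermZero hf M ≫ (term hf 0).map g := by
  ext x
  refine funext fun s => (toTermZero_apply hf N (g.lin x) s).trans ?_
  refine (locMap_frac (prodF_mem hf s) g x 0).symm.trans ?_
  exact congrArg (locMap (prodF_mem hf s) g).lin (toTermZero_apply hf M x s).symm

lemma bijective_toTermZero (M : GrMod 𝒜) : Function.Bijective (toTermZero hf M).lin := by
  have hloc (s : Fin 0 ↪o Fin r) :
      Function.Bijective (mkLinearMap (Submonoid.powers (prodF f s)) M) := by
    refine bijective_mkLinearMap_of_isUnit _ ?_
    rintro ⟨_, n, rfl⟩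
    change IsUnit (algebraMap A (Module.End A M) ((∏ j : Fin 0, f (s j)) ^ n))
    rw [Fin.prod_univ_zero, one_pow, map_one]
    exact isUnit_one
  let s₀ : Fin 0 ↪o Fin r := Fin.castLEOrderEmb r.zero_le
  refine ⟨fun x y hxy => (hloc s₀).1 (congrFun hxy s₀), fun z => ?_⟩
  obtain ⟨x, hx⟩ := (hloc s₀).2 (z s₀)
  refine ⟨x, funext fun s => ?_⟩
  obtain rfl : s = s₀ := DFunLike.ext _ _ fun l => l.elim0
  exact hx

/-- The term of degree `0` of the extended Čech complex of `M` is `M`. -/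
def termZeroIso (M : GrMod 𝒜) : M ≅ (term hf 0).obj M :=
  have := isIso_of_bijective _ (bijective_toTermZero hf M)
  asIso (toTermZero hf M)

end Cech

namespace Tot.Augmentation

section Iso

variable {C : Type*} [Category C] [HasZeroMorphisms C] {F F' : C ⥤ CochainComplex C ℕ}

/-- The transport of an augmentation along an isomorphism. -/
def ofIso (a : Augmentation F) (e : F ≅ F') : Augmentation F' where
  ι X := a.ι X ≫ (e.hom.app X).f 0
  naturality {X Y} g := by
    have h : (F.map g).f 0 ≫ (e.hom.app Y).f 0 = (e.hom.app X).f 0 ≫ (F'.map g).f 0 :=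
      congrArg (fun k => HomologicalComplex.Hom.f k 0) (e.hom.naturality g)
    rw [reassoc_of% a.naturality, h, Category.assoc]
  ι_d X := by
    rw [Category.assoc, HomologicalComplex.Hom.comm, reassoc_of% a.ι_d, zero_comp]

end Iso

section AugmentedIso

variable {C : Type*} [Category C] [Preadditive C] {F : C ⥤ CochainComplex C ℕ}
  (a : Augmentation F)

/-- The components of `augmentedObjIso`. -/
def augmentedObjIsoX (X : C) {K : CochainComplex C ℕ} (e₀ : X ≅ K.X 0)
    (e : ∀ q, (F.obj X).X q ≅ K.X (q + 1)) : ∀ q, (a.augmented.obj X).X q ≅ K.X q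
  | 0 => e₀
  | q + 1 => e q

/-- A complex `K` with `K⁰ ≅ X` and `Kᵠ⁺¹ ≅ F(X)ᵠ` is isomorphic to the augmented complex of `X`. -/
def augmentedObjIso (X : C) {K : CochainComplex C ℕ} (e₀ : X ≅ K.X 0)
    (e : ∀ q, (F.obj X).X q ≅ K.X (q + 1)) (comm₀ : e₀.hom ≫ K.d 0 1 = a.ι X ≫ (e 0).hom)
    (comm : ∀ q, (e q).hom ≫ K.d (q + 1) (q + 2) = (F.obj X).d q (q + 1) ≫ (e (q + 1)).hom) :
    a.augmented.obj X ≅ K :=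
  HomologicalComplex.Hom.isoOfComponents (a.augmentedObjIsoX X e₀ e) (by
    rintro i _ rfl
    match i with
    | 0 => exact comm₀
    | i + 1 => exact comm i)

/-- The natural version of `augmentedObjIso`. -/
def augmentedIso {G : C ⥤ CochainComplex C ℕ} (e₀ : ∀ X, X ≅ (G.obj X).X 0)
    (e : ∀ X q, (F.obj X).X q ≅ (G.obj X).X (q + 1))
    (naturality₀ : ∀ {X Y} (g : X ⟶ Y), g ≫ (e₀ Y).hom = (e₀ X).hom ≫ (G.map g).f 0)
    (naturality : ∀ {X Y} (g : X ⟶ Y) q,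
      (F.map g).f q ≫ (e Y q).hom = (e X q).hom ≫ (G.map g).f (q + 1))
    (comm₀ : ∀ X, (e₀ X).hom ≫ (G.obj X).d 0 1 = a.ι X ≫ (e X 0).hom)
    (comm : ∀ X q, (e X q).hom ≫ (G.obj X).d (q + 1) (q + 2) =
      (F.obj X).d q (q + 1) ≫ (e X (q + 1)).hom) :
    a.augmented ≅ G :=
  NatIso.ofComponents (fun X => a.augmentedObjIso X (e₀ X) (e X) (comm₀ X) (comm X)) (by
    intro X Y g
    ext q
    match q with
    | 0 => exact naturality₀ g
    | q + 1 => exact naturality g q)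

/-- The augmented complexes of an augmentation and of its transport along an isomorphism. -/
def augmentedOfIso {F' : C ⥤ CochainComplex C ℕ} (e : F ≅ F') :
    (a.ofIso e).augmented ≅ a.augmented :=
  Iso.symm <| a.augmentedIso (a.ofIso e).zeroIso
    (fun X q => HomologicalComplex.Hom.isoApp (e.app X) q ≪≫ (a.ofIso e).succIso X q)
    (a.ofIso e).zeroIso_hom_naturality
    (fun {X Y} g q => by
      have h : (F.map g).f q ≫ (e.hom.app Y).f q = (e.hom.app X).f q ≫ (F'.map g).f q :=
        congrArg (fun k => HomologicalComplex.Hom.f k q) (e.hom.naturality g)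
      change (F.map g).f q ≫ (e.hom.app Y).f q ≫ ((a.ofIso e).succIso Y q).hom =
        ((e.hom.app X).f q ≫ ((a.ofIso e).succIso X q).hom) ≫ _
      rw [reassoc_of% h, succIso_hom_naturality, Category.assoc])
    (fun X => ((a.ofIso e).zeroIso_hom_d X).trans (Category.assoc _ _ _))
    (fun X q => by
      change ((e.hom.app X).f q ≫ ((a.ofIso e).succIso X q).hom) ≫ _ =
        _ ≫ (e.hom.app X).f (q + 1) ≫ ((a.ofIso e).succIso X (q + 1)).hom
      rw [Category.assoc, succIso_hom_d, HomologicalComplex.Hom.comm_assoc])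

end AugmentedIso

section Localization

variable {C D : Type*} [Category C] [Category D] [HasZeroMorphisms C]
  (L : C ⥤ D) (W : MorphismProperty C) [L.IsLocalization W] (F : D ⥤ CochainComplex C ℕ)
  (a : Augmentation (L ⋙ F))

/-- The transformation `Y ⟶ L(F(Y)⁰)` on a localization `L : C ⥤ D` which is induced by an
augmentation `M ⟶ F(L(M))⁰` on `C`. -/
def descendι : 𝟭 D ⟶ F ⋙ HomologicalComplex.eval C (ComplexShape.up ℕ) 0 ⋙ L :=
  Localization.liftNatTrans L W L (L ⋙ F ⋙ HomologicalComplex.eval C _ 0 ⋙ L) _ _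
    { app M := L.map (a.ι M)
      naturality {M N} g := by
        refine (L.map_comp g (a.ι N)).symm.trans ((congrArg _ (a.naturality g)).trans ?_)
        exact L.map_comp (a.ι M) ((F.map (L.map g)).f 0) }

lemma descendι_app_obj (M : C) : (a.descendι L W F).app (L.obj M) = L.map (a.ι M) := by
  refine (Localization.liftNatTrans_app L W _ _ _ _ _ M).trans ?_
  exact (Category.id_comp _).trans (Category.comp_id _)

/-- The augmentation of `Y ↦ L(F(Y))` on a localization `L : C ⥤ D` which is induced by an
augmentation of `M ↦ F(L(M))`. -/
def descend [HasZeroMorphisms D] [L.PreservesZeroMorphisms] :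
    Augmentation (F ⋙ L.mapHomologicalComplex (ComplexShape.up ℕ)) where
  ι Y := (a.descendι L W F).app Y
  naturality g := (a.descendι L W F).naturality g
  ι_d Y := by
    have := Localization.essSurj L W
    let M := L.objPreimage Y
    let e : L.obj M ≅ Y := L.objObjPreimageIso Y
    have hι : e.hom ≫ (a.descendι L W F).app Y = L.map (a.ι M ≫ (F.map e.hom).f 0) := by
      rw [L.map_comp, ← a.descendι_app_obj L W F]
      exact (a.descendι L W F).naturality e.hom
    have hd : (a.ι M ≫ (F.map e.hom).f 0) ≫ (F.obj Y).d 0 1 = 0 := by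
      rw [Category.assoc, HomologicalComplex.Hom.comm]
      refine (Category.assoc _ _ _).symm.trans ?_
      exact (congrArg (· ≫ (F.map e.hom).f 1) (a.ι_d M)).trans zero_comp
    rw [← cancel_epi e.hom, comp_zero]
    refine (Category.assoc _ _ _).symm.trans ?_
    refine (congrArg (· ≫ L.map ((F.obj Y).d 0 1)) hι).trans ?_
    refine (L.map_comp _ _).symm.trans ?_
    exact (congrArg L.map hd).trans (L.map_zero _ _)

end Localization

section Localization

variable {C D : Type*} [Category C] [Category D] [Preadditive C] [Preadditive D]
  (L : C ⥤ D) [L.PreservesZeroMorphisms] (W : MorphismProperty C) [L.IsLocalization W]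
  (F : D ⥤ CochainComplex C ℕ) (a : Augmentation (L ⋙ F))

/-- The functor `L` commutes with the formation of the augmented complexes. -/
def augmentedDescendIso (M : C) : (a.descend L W F).augmented.obj (L.obj M) ≅
    (L.mapHomologicalComplex (ComplexShape.up ℕ)).obj (a.augmented.obj M) :=
  augmentedObjIso _ _ (L.mapIso (a.zeroIso M)) (fun q => L.mapIso (a.succIso M q))
    (by
      refine (L.map_comp _ _).symm.trans ((congrArg L.map (a.zeroIso_hom_d M)).trans ?_)
      refine (L.map_comp _ _).trans ?_
      exact congrArg (· ≫ L.map (a.succIso M 0).hom) (a.descendι_app_obj L W F M).symm)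
    (fun q => by
      refine (L.map_comp _ _).symm.trans ((congrArg L.map (a.succIso_hom_d M q)).trans ?_)
      exact L.map_comp _ _)

end Localization

end Tot.Augmentation

section SerreQuotient

variable {C : Type*} [Category C] [Abelian C] (P : ObjectProperty C) [P.IsSerreClass]

instance : (SerreQuotient.functor P).EssSurj :=
  Localization.essSurj (SerreQuotient.functor P) P.isoModSerre

end SerreQuotient

namespace Cech

open GrMod

variable {A : Type u} [CommRing A] {𝒜 : ℤ → AddSubgroup A} [SetLike.GradedMonoid 𝒜]
  {r : ℕ} {f : Fin r → A} {d : Fin r → ℤ} (hf : ∀ i, f i ∈ 𝒜 (d i))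

/-- The augmentation of the Čech complex which is given by the localization maps. -/
def augmentation : Tot.Augmentation (cech hf) where
  ι M := (termZeroIso hf M).hom ≫ (diff hf 0).app M
  naturality g := by
    refine (Category.assoc _ _ _).symm.trans ?_
    refine (congrArg (· ≫ (diff hf 0).app _) (toTermZero_naturality hf g)).trans ?_
    refine (Category.assoc _ _ _).trans ?_
    exact (congrArg (toTermZero hf _ ≫ ·) ((diff hf 0).naturality g)).trans
      (Category.assoc _ _ _).symm
  ι_d M := by
    have h : (diff hf 0).app M ≫ (diff hf 1).app M = 0 := NatTrans.congr_app (diff_comp hf 0) M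
    rw [cech_d]
    change ((termZeroIso hf M).hom ≫ (diff hf 0).app M) ≫ (-(diff hf 1).app M) = 0
    rw [Preadditive.comp_neg, Category.assoc, h, comp_zero, neg_zero]

/-- Multiplication by the sign `(-1) ^ q`. -/
def signIso {C : Type*} [Category C] [Preadditive C] (q : ℕ) (X : C) : X ≅ X where
  hom := (-1 : ℤ) ^ q • 𝟙 X
  inv := (-1 : ℤ) ^ q • 𝟙 X
  hom_inv_id := by simp [smul_smul, ← mul_pow]
  inv_hom_id := by simp [smul_smul, ← mul_pow]

/-- The extended Čech complex is the augmented Čech complex, up to the signs `(-1) ^ q` in degree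
`q + 1` which turn the differential `-d` of the Čech complex into `d`. -/
def augmentedIsoExt : (augmentation hf).augmented ≅ ext hf :=
  Tot.Augmentation.augmentedIso _ (termZeroIso hf)
    (fun M q => signIso q ((term hf (q + 1)).obj M)) (toTermZero_naturality hf)
    (fun {M N} g q => by
      change (term hf (q + 1)).map g ≫ ((-1 : ℤ) ^ q • 𝟙 _) =
        ((-1 : ℤ) ^ q • 𝟙 _) ≫ (term hf (q + 1)).map g
      rw [Preadditive.comp_zsmul, Preadditive.zsmul_comp, Category.comp_id, Category.id_comp])
    (fun M => by
      have h : (signIso 0 ((term hf 1).obj M)).hom = 𝟙 _ :=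
        (congrArg (· • 𝟙 _) (pow_zero (-1 : ℤ))).trans (one_smul ℤ _)
      rw [ext_d]
      exact ((congrArg (_ ≫ ·) h).trans (Category.comp_id _)).symm)
    (fun M q => by
      rw [ext_d, cech_d]
      change ((-1 : ℤ) ^ q • 𝟙 _) ≫ (diff hf (q + 1)).app M =
        (-(diff hf (q + 1)).app M) ≫ ((-1 : ℤ) ^ (q + 1) • 𝟙 _)
      rw [Preadditive.zsmul_comp, Preadditive.comp_zsmul, Category.id_comp, Category.comp_id,
        pow_succ, mul_neg_one, neg_smul, smul_neg, neg_neg])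

lemma preservesFiniteLimits_and_colimits_term (m : ℕ) :
    PreservesFiniteLimits (term hf m) ∧ PreservesFiniteColimits (term hf m) :=
  ((term hf m).exact_tfae.out 1 3).1 (term_exact hf m)

variable (hI : Ideal.span (Set.range f) = idealPos 𝒜)

include hI in
lemma isInvertedBy_cech : (torPos 𝒜).isoModSerre.IsInvertedBy (cech hf) := by
  intro M N g hg
  have (q : ℕ) : IsIso (((cech hf).map g).f q) := by
    obtain ⟨h₁, h₂⟩ := preservesFiniteLimits_and_colimits_term hf (q + 1)
    exact (ObjectProperty.isoModSerre_isInvertedBy_iff (torPos 𝒜) (term hf (q + 1))).2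
      (isZero_term_of_torPos hf hI q) g hg
  exact HomologicalComplex.Hom.isIso_of_components _

/-- The functor `Q⁺Gr(A) ⥤ Ch(Gr(A))` induced by the Čech complex. -/
def quotCech : QGr 𝒜 ⥤ CochainComplex (GrMod 𝒜) ℕ :=
  Localization.lift (cech hf) (isInvertedBy_cech hf hI) (SerreQuotient.functor (torPos 𝒜))

/-- The functor `quotCech` is induced by the Čech complex. -/
def facQuotCech : SerreQuotient.functor (torPos 𝒜) ⋙ quotCech hf hI ≅ cech hf :=
  Localization.fac _ _ _

instance : (quotCech hf hI).Additive := by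
  refine (Localization.functor_additive_iff (SerreQuotient.functor (torPos 𝒜))
    (torPos 𝒜).isoModSerre (quotCech hf hI)).2 ?_
  exact Functor.additive_of_iso (facQuotCech hf hI).symm

lemma quotCech_exact (q : ℕ) (S : ShortComplex (QGr 𝒜)) (hS : S.Exact) :
    (S.map (quotCech hf hI ⋙ HomologicalComplex.eval _ (ComplexShape.up ℕ) q)).Exact := by
  let e : SerreQuotient.functor (torPos 𝒜) ⋙ quotCech hf hI ⋙
      HomologicalComplex.eval _ (ComplexShape.up ℕ) q ≅ term hf (q + 1) :=
    Functor.isoWhiskerRight (facQuotCech hf hI) (HomologicalComplex.eval _ _ q)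
  obtain ⟨h₁, h₂⟩ := preservesFiniteLimits_and_colimits_term hf (q + 1)
  have : PreservesFiniteLimits (quotCech hf hI ⋙ HomologicalComplex.eval _ _ q) := by
    rw [← ObjectProperty.SerreClassLocalization.preservesFiniteLimits_comp_iff
      (SerreQuotient.functor (torPos 𝒜)) (torPos 𝒜)]
    exact preservesFiniteLimits_of_natIso e.symm
  have : PreservesFiniteColimits (quotCech hf hI ⋙ HomologicalComplex.eval _ _ q) := by
    rw [← ObjectProperty.SerreClassLocalization.preservesFiniteColimits_comp_iff
      (SerreQuotient.functor (torPos 𝒜)) (torPos 𝒜)]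
    exact preservesFiniteColimits_of_natIso e.symm
  exact hS.map _

/-- The value of `quotCech` on an object of `Q⁺Gr(A)` is the Čech complex of a graded module which
represents it. -/
def quotCechObjIso (Y : QGr 𝒜) : (quotCech hf hI).obj Y ≅
    (cech hf).obj ((SerreQuotient.functor (torPos 𝒜)).objPreimage Y) :=
  (quotCech hf hI).mapIso ((SerreQuotient.functor (torPos 𝒜)).objObjPreimageIso Y).symm ≪≫
    (facQuotCech hf hI).app _

/-- The augmentation of the Čech complex of the objects of `Q⁺Gr(A)` which come from `Gr(A)`. -/
def quotAugmentation :
    Tot.Augmentation (SerreQuotient.functor (torPos 𝒜) ⋙ quotCech hf hI) :=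
  (augmentation hf).ofIso (facQuotCech hf hI).symm

/-- The augmented complex of `quotAugmentation` is the extended Čech complex. -/
def quotAugmentedIso : (quotAugmentation hf hI).augmented ≅ ext hf :=
  (augmentation hf).augmentedOfIso (facQuotCech hf hI).symm ≪≫ augmentedIsoExt hf

/-- The resolution of the objects of `Q⁺Gr(A)` by Čech complexes. -/
def resolution : Tot.Resolution (SerreQuotient.functor (torPos 𝒜)) r where
  E := quotCech hf hI
  exact_E := quotCech_exact hf hI
  isZero_E Y := (isZero_term hf (r + 1) r.lt_succ_self _).of_iso
    (HomologicalComplex.Hom.isoApp (quotCechObjIso hf hI Y) r)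
  ε := quotAugmentation hf hI
  acyclic_ε Y q n := (acyclic_ext_term hf _ q n).of_iso
    ((ext hf).mapIso (HomologicalComplex.Hom.isoApp (quotCechObjIso hf hI Y) q).symm ≪≫
      (quotAugmentedIso hf hI).symm.app _)
  θ := (quotAugmentation hf hI).descend (SerreQuotient.functor (torPos 𝒜))
    (torPos 𝒜).isoModSerre (quotCech hf hI)
  θ_obj := (quotAugmentation hf hI).descendι_app_obj _ _ _
  acyclic_θ Y n := by
    let L := SerreQuotient.functor (torPos 𝒜)
    refine (acyclic_map_ext hf hI (L.objPreimage Y) n).of_iso ?_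
    exact (L.mapHomologicalComplex _).mapIso ((quotAugmentedIso hf hI).symm.app _) ≪≫
      ((quotAugmentation hf hI).augmentedDescendIso L _ _ _).symm ≪≫
      (Tot.Augmentation.augmented _).mapIso (L.objObjPreimageIso Y)

end Cech

/-! ### The categories `D^♠` -/

section RestrictedAdjunction

variable {C D : Type*} [Category C] [Category D] {L : C ⥤ D} {R : D ⥤ C} (adj : L ⊣ R)
  (P : ObjectProperty C) (P' : ObjectProperty D) (hL : ∀ X : P.FullSubcategory, P' (L.obj X.obj))
  (hR : ∀ Y : P'.FullSubcategory, P (R.obj Y.obj))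

/-- The restriction of an adjunction to full subcategories which the two functors preserve. -/
def restrictAdjunction : P'.lift (P.ι ⋙ L) hL ⊣ P.lift (P'.ι ⋙ R) hR :=
  adj.restrictFullyFaithful P.fullyFaithfulι P'.fullyFaithfulι (Iso.refl _) (Iso.refl _)

lemma isIso_restrictAdjunction_unit_app_iff (X : P.FullSubcategory) :
    IsIso ((restrictAdjunction adj P P' hL hR).unit.app X) ↔ IsIso (adj.unit.app X.obj) := by
  rw [← isIso_iff_of_reflects_iso _ P.ι, restrictAdjunction,
    Adjunction.map_restrictFullyFaithful_unit_app]
  exact isIso_comp_right_iff _ _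

lemma isIso_restrictAdjunction_counit [IsIso adj.counit] :
    IsIso (restrictAdjunction adj P P' hL hR).counit := by
  rw [NatTrans.isIso_iff_isIso_app]
  intro Y
  rw [← isIso_iff_of_reflects_iso _ P'.ι, restrictAdjunction,
    Adjunction.map_restrictFullyFaithful_counit_app]
  infer_instance

end RestrictedAdjunction

section Kernel

lemma isZero_map_iff_of_fullyFaithful {C D : Type*} [Category C] [Category D]
    [HasZeroMorphisms C] [HasZeroMorphisms D] (F : C ⥤ D) [F.PreservesZeroMorphisms] [F.Full]
    [F.Faithful] (X : C) : IsZero (F.obj X) ↔ IsZero X :=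
  ⟨IsZero.of_full_of_faithful_of_isZero F X, F.map_isZero⟩

variable {C : Type*} [Category C] [Abelian C] (S : ObjectProperty C) [S.IsSerreClass]
  [HasDerivedCategory.{w} C] [HasDerivedCategory.{w'} (SerreQuotient S)]

lemma isZero_phiStar_obj_iff (X : DerivedCategory C) : IsZero ((phiStar S).obj X) ↔
    ∀ n : ℤ, S ((DerivedCategory.homologyFunctor C n).obj X) := by
  let L := SerreQuotient.functor S
  obtain ⟨K, ⟨e⟩⟩ : ∃ K, Nonempty (DerivedCategory.Q.obj K ≅ X) :=
    ⟨_, ⟨DerivedCategory.Q.objObjPreimageIso X⟩⟩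
  rw [((phiStar S).mapIso e.symm ≪≫ L.mapDerivedCategoryFactors.app K).isZero_iff]
  refine (isZero_Q_obj_iff ((L.mapHomologicalComplex (ComplexShape.up ℤ)).obj K)).trans
    (forall_congr' fun n => ?_)
  have hK : ((L.mapHomologicalComplex (ComplexShape.up ℤ)).obj K).homology n ≅
      L.obj (K.homology n) := (K.sc n).mapHomologyIso L
  rw [HomologicalComplex.exactAt_iff_isZero_homology, hK.isZero_iff,
    ObjectProperty.SerreClassLocalization.isZero_obj_iff _ S]
  exact S.prop_iff_of_iso (((DerivedCategory.homologyFunctorFactors C n).app K).symm ≪≫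
    (DerivedCategory.homologyFunctor C n).mapIso e)

lemma dCohomologyIn_iff (b : Spade) (X : DCat C b) :
    dCohomologyIn S b X ↔ IsZero ((phiStarD S b).obj X) := by
  rw [← isZero_map_iff_of_fullyFaithful (dProp (SerreQuotient S) b).ι]
  exact (isZero_phiStar_obj_iff S X.obj).symm

end Kernel

section GradedModules

variable {A : Type u} [CommRing A] {𝒜 : ℤ → AddSubgroup A} [SetLike.GradedMonoid 𝒜]
  {r : ℕ} {f : Fin r → A} {d : Fin r → ℤ} (hf : ∀ i, f i ∈ 𝒜 (d i))
  [HasDerivedCategory.{w} (GrMod 𝒜)]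

/-- `RΓ_I` is computed by the total complexes of extended Čech complexes. -/
def rGammaFac : DerivedCategory.Q ⋙ rGamma hf ≅ rGammaComplex hf ⋙ DerivedCategory.Q :=
  Localization.fac _ _ _

/-- `Č_I` is computed by the total complexes of Čech complexes. -/
def cechDFac : DerivedCategory.Q ⋙ cechD hf ≅ cechComplex hf ⋙ DerivedCategory.Q :=
  Localization.fac _ _ _

lemma dProp_cechD_obj (b : Spade) (X : DCat (GrMod 𝒜) b) :
    dProp (GrMod 𝒜) b ((cechD hf).obj X.obj) :=
  Tot.dProp_of_fac (cechDFac hf) b X.obj X.property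

/-- The Čech functor `Č_I` on `D^♠(Gr(A))`. -/
def cechDRestrict (b : Spade) : DCat (GrMod 𝒜) b ⥤ DCat (GrMod 𝒜) b :=
  (dProp (GrMod 𝒜) b).lift ((dProp (GrMod 𝒜) b).ι ⋙ cechD hf) (dProp_cechD_obj hf b)

variable [HasDerivedCategory.{w'} (QGr 𝒜)] (hI : Ideal.span (Set.range f) = idealPos 𝒜)

/-- The functor `Rφ_* : D(Q⁺Gr(A)) ⥤ D(Gr(A))`. -/
abbrev rPhi : DerivedCategory (QGr 𝒜) ⥤ DerivedCategory (GrMod 𝒜) :=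
  (Cech.resolution hf hI).R

/-- The adjunction between `φ^*` and `Rφ_*`. -/
abbrev phiAdj : phiStar (torPos 𝒜) ⊣ rPhi hf hI :=
  (Cech.resolution hf hI).adj

lemma isZero_rGamma_obj_iff (X : DerivedCategory (GrMod 𝒜)) :
    IsZero ((rGamma hf).obj X) ↔ IsIso ((phiAdj hf hI).unit.app X) := by
  obtain ⟨K, ⟨e⟩⟩ : ∃ K, Nonempty (DerivedCategory.Q.obj K ≅ X) :=
    ⟨_, ⟨DerivedCategory.Q.objObjPreimageIso X⟩⟩
  have hK : DerivedCategory.Q.obj ((rGammaComplex hf).obj K) ≅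
      DerivedCategory.Q.obj (Tot.obj r (Cech.quotAugmentation hf hI).augmented K) :=
    DerivedCategory.Q.mapIso ((Tot.natIso r (Cech.quotAugmentedIso hf hI)).symm.app K)
  rw [← NatTrans.isIso_app_iff_of_iso _ e, Tot.Resolution.isIso_adj_unit_app_iff,
    ((rGamma hf).mapIso e.symm ≪≫ (rGammaFac hf).app K ≪≫ hK).isZero_iff]
  exact isZero_Q_obj_iff _

/-- `Rφ_* ∘ φ^*` is the Čech functor. -/
def phiStarCompRPhiIso : phiStar (torPos 𝒜) ⋙ rPhi hf hI ≅ cechD hf :=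
  (Cech.resolution hf hI).compRIso (Cech.facQuotCech hf hI) (cechDFac hf)

lemma dProp_rPhi_obj (b : Spade) (Y : DCat (QGr 𝒜) b) :
    dProp (GrMod 𝒜) b ((rPhi hf hI).obj Y.obj) :=
  Tot.dProp_of_fac (Cech.resolution hf hI).facR b Y.obj Y.property

/-- The functor `Rφ_* : D^♠(Q⁺Gr(A)) ⥤ D^♠(Gr(A))`. -/
abbrev rPhiD (b : Spade) : DCat (QGr 𝒜) b ⥤ DCat (GrMod 𝒜) b :=
  (dProp (GrMod 𝒜) b).lift ((dProp (QGr 𝒜) b).ι ⋙ rPhi hf hI) (dProp_rPhi_obj hf hI b)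

/-- The adjunction between `φ^*` and `Rφ_*` on `D^♠`. -/
def phiAdjD (b : Spade) : phiStarD (torPos 𝒜) b ⊣ rPhiD hf hI b :=
  restrictAdjunction (phiAdj hf hI) (dProp (GrMod 𝒜) b) (dProp (QGr 𝒜) b) _ _

instance (b : Spade) : IsIso (phiAdjD hf hI b).counit :=
  isIso_restrictAdjunction_counit (phiAdj hf hI) _ _ _ _

/-- `Rφ_* ∘ φ^*` is the Čech functor on `D^♠`. -/
def phiStarDCompRPhiDIso (b : Spade) :
    phiStarD (torPos 𝒜) b ⋙ rPhiD hf hI b ≅ cechDRestrict hf b :=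
  NatIso.ofComponents
    (fun X => (dProp (GrMod 𝒜) b).fullyFaithfulι.preimageIso
      ((phiStarCompRPhiIso hf hI).app X.obj))
    (fun g => (dProp (GrMod 𝒜) b).ι.map_injective
      ((phiStarCompRPhiIso hf hI).hom.naturality g.hom))

lemma isSemiorthogonalDecomposition_rPhiD (b : Spade) :
    IsSemiorthogonalDecomposition (rPhiD hf hI b).essImage (dCohomologyIn (torPos 𝒜) b) :=
  isSemiorthogonalDecomposition_of_adjunction (dCohomologyIn_iff (torPos 𝒜) b) (phiAdjD hf hI b)

lemma trivD_iff (b : Spade) (X : DCat (GrMod 𝒜) b) :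
    trivD hf b X ↔ IsIso ((phiAdjD hf hI b).unit.app X) :=
  (isZero_rGamma_obj_iff hf hI X.obj).trans
    (isIso_restrictAdjunction_unit_app_iff (phiAdj hf hI) _ _ _ _ X).symm

include hI in
lemma isTriangulated_trivD (b : Spade) : (trivD hf b).IsTriangulated := by
  rw [← essImage_eq_of_isIso_unit (phiAdjD.{u, w, w'} hf hI b) (trivD_iff hf hI b)]
  exact (isSemiorthogonalDecomposition_rPhiD hf hI b).isTriangulated₁

end GradedModules

end

theorem mainTheorem7_general {A : Type u} [CommRing A] (𝒜 : ℤ → AddSubgroup A)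
    [SetLike.GradedMonoid 𝒜]
    [HasDerivedCategory.{w} (GrMod 𝒜)] [HasDerivedCategory.{w'} (QGr 𝒜)]
    {r : ℕ} (f : Fin r → A) (d : Fin r → ℤ) (hf : ∀ i, f i ∈ 𝒜 (d i))
    (hI : Ideal.span (Set.range f) = idealPos 𝒜) :
    (∀ b : Spade, IsDLocalizing.{w, w'} (torPos 𝒜) b) ∧
    ∃ (R : DerivedCategory (QGr 𝒜) ⥤ DerivedCategory (GrMod 𝒜)) (adj : phiStar (torPos 𝒜) ⊣ R),
      IsIso adj.counit ∧ R.Full ∧ R.Faithful ∧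
      ∀ b : Spade, ∃ (Rb : DCat (QGr 𝒜) b ⥤ DCat (GrMod 𝒜) b) (adjb : phiStarD (torPos 𝒜) b ⊣ Rb),
        IsIso adjb.counit ∧
        Nonempty (Rb ⋙ (dProp (GrMod 𝒜) b).ι ≅ (dProp (QGr 𝒜) b).ι ⋙ R) ∧
        IsSemiorthogonalDecomposition Rb.essImage (dCohomologyIn (torPos 𝒜) b) ∧
        (∃ hC : ∀ X : DCat (GrMod 𝒜) b, dProp (GrMod 𝒜) b ((cechD hf).obj X.obj),
          Nonempty (phiStarD (torPos 𝒜) b ⋙ Rb ≅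
            (dProp (GrMod 𝒜) b).lift ((dProp (GrMod 𝒜) b).ι ⋙ cechD hf) hC)) ∧
        ∃ (_ : (trivD hf b).IsTriangulated) (e : (trivD hf b).FullSubcategory ≌ DCat (QGr 𝒜) b),
          Nonempty (e.functor ≅ (trivD hf b).ι ⋙ phiStarD (torPos 𝒜) b) ∧
          Nonempty (e.inverse ⋙ (trivD hf b).ι ≅ Rb) ∧
          ((trivD hf b).ι ⋙ phiStarD (torPos 𝒜) b).IsTriangulated := by
  let adj := phiAdj hf hI
  let adjD (b : Spade) := phiAdjD hf hI b
  have hR := adj.fullyFaithfulROfIsIsoCounit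
  refine ⟨fun b => ⟨_, adjD b, inferInstance⟩, _, adj, inferInstance, hR.full, hR.faithful,
    fun b => ⟨_, adjD b, inferInstance, ⟨Iso.refl _⟩,
      isSemiorthogonalDecomposition_rPhiD hf hI b,
      ⟨dProp_cechD_obj hf b, ⟨phiStarDCompRPhiDIso hf hI b⟩⟩, ?_⟩⟩
  have hT := isTriangulated_trivD hf hI b
  exact ⟨hT, equivalenceOfIsIsoUnit (adjD b) (trivD_iff hf hI b), ⟨Iso.refl _⟩, ⟨Iso.refl _⟩,
    inferInstance⟩

theorem mainTheorem7 {A : Type u} [CommRing A] (𝒜 : ℤ → AddSubgroup A) [GradedRing 𝒜]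
    [HasDerivedCategory.{w} (GrMod 𝒜)] [HasDerivedCategory.{w'} (QGr 𝒜)]
    {r : ℕ} (f : Fin r → A) (d : Fin r → ℤ) (hf : ∀ i, f i ∈ 𝒜 (d i))
    (hI : Ideal.span (Set.range f) = idealPos 𝒜) :
    (∀ b : Spade, IsDLocalizing.{w, w'} (torPos 𝒜) b) ∧
    ∃ (R : DerivedCategory (QGr 𝒜) ⥤ DerivedCategory (GrMod 𝒜)) (adj : phiStar (torPos 𝒜) ⊣ R),
      IsIso adj.counit ∧ R.Full ∧ R.Faithful ∧
      ∀ b : Spade, ∃ (Rb : DCat (QGr 𝒜) b ⥤ DCat (GrMod 𝒜) b) (adjb : phiStarD (torPos 𝒜) b ⊣ Rb),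
        IsIso adjb.counit ∧
        Nonempty (Rb ⋙ (dProp (GrMod 𝒜) b).ι ≅ (dProp (QGr 𝒜) b).ι ⋙ R) ∧
        IsSemiorthogonalDecomposition Rb.essImage (dCohomologyIn (torPos 𝒜) b) ∧
        (∃ hC : ∀ X : DCat (GrMod 𝒜) b, dProp (GrMod 𝒜) b ((cechD hf).obj X.obj),
          Nonempty (phiStarD (torPos 𝒜) b ⋙ Rb ≅
            (dProp (GrMod 𝒜) b).lift ((dProp (GrMod 𝒜) b).ι ⋙ cechD hf) hC)) ∧
        ∃ (_ : (trivD hf b).IsTriangulated) (e : (trivD hf b).FullSubcategory ≌ DCat (QGr 𝒜) b),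
          Nonempty (e.functor ≅ (trivD hf b).ι ⋙ phiStarD (torPos 𝒜) b) ∧
          Nonempty (e.inverse ⋙ (trivD hf b).ι ≅ Rb) ∧
          ((trivD hf b).ι ⋙ phiStarD (torPos 𝒜) b).IsTriangulated :=
  mainTheorem7_general 𝒜 f d hf hI
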